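/- Let $\Omega\subset\mathbb R^n$ ($n\ge 1$) be a bounded domain (nonempty, open, connected) with $C^\infty$ boundary, let $1<p<\infty$ and $\sigma>0$, and let $\mathcal H^{n-1}$ denote the $(n-1)$-dimensional Hausdorff measure on $\partial\Omega$. For $\phi\in L^\infty(\partial\Omega)$ define $$\lambda(\sigma,\phi)=\inf\Big\{\int_\Omega |\nabla u|^p+|u|^p\,dx+\sigma\int_{\partial\Omega}\phi|u|^p\,d\mathcal H^{n-1}\ :\ u\in W^{1,p}(\Omega),\ \|u\|_{L^p(\partial\Omega)}=1\Big\},$$ where the boundary values of $u$ are taken in the sense of traces. A positive normalized eigenfunction associated to $\lambda(\sigma,\phi)$ is a function $u\in W^{1,p}(\Omega)$ with $u>0$ a.e. in $\Omega$ and $\|u\|_{L^p(\partial\Omega)}=1$ that solves, with $\lambda=\lambda(\sigma,\phi)$, the problem $$-\Delta_p u+|u|^{p-2}u=0\ \text{ in }\Omega,\qquad |\nabla u|^{p-2}\frac{\partial u}{\partial\mathbf n}+\sigma\phi|u|^{p-2}u=\lambda|u|^{p-2}u\ \text{ on }\partial\Omega$$ in the weak sense, that is, for all $v\in W^{1,p}(\Omega)$,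 $$\int_\Omega |\nabla u|^{p-2}\nabla u\cdot\nabla v+|u|^{p-2}uv\,dx+\sigma\int_{\partial\Omega}\phi|u|^{p-2}uv\,d\mathcal H^{n-1}=\lambda\int_{\partial\Omega}|u|^{p-2}uv\,d\mathcal H^{n-1}.$$ Let $\phi_j,\phi\in L^\infty(\partial\Omega)$ ($j\in\mathbb N$) be such that $\phi_j\overset{*}{\rightharpoonup}\phi$ in $L^\infty(\partial\Omega)$, i.e. $\int_{\partial\Omega}\phi_j f\,d\mathcal H^{n-1}\to\int_{\partial\Omega}\phi f\,d\mathcal H^{n-1}$ for every $f\in L^1(\partial\Omega)$. Then $\lambda(\sigma,\phi_j)\to\lambda(\sigma,\phi)$ as $j\to\infty$. Moreover, if $u_j$ and $u$ are positive normalized eigenfunctions associated to $\lambda(\sigma,\phi_j)$ and $\lambda(\sigma,\phi)$ respectively, then $u_j\to u$ strongly in $W^{1,p}(\Omega)$ as $j\to\infty$. -/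

import Mathlib

open MeasureTheory Filter Topology Set
open scoped ENNReal ContDiff

noncomputable section

namespace Steklov

/-- Euclidean space of dimension `m + 1`; so every dimension `n = m + 1 ≥ 1` is covered. -/
abbrev Eucl (m : ℕ) : Type := EuclideanSpace ℝ (Fin (m + 1))

/-- The first `m` coordinates of a point of `ℝ^(m+1)`. -/
def initCoords {m : ℕ} (y : Eucl m) : EuclideanSpace ℝ (Fin m) :=
  WithLp.toLp 2 fun i => y i.castSucc

/-- The last coordinate of a point of `ℝ^(m+1)`. -/
def lastCoord {m : ℕ} (y : Eucl m) : ℝ := y (Fin.last m)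

/-- A bounded smooth domain: a bounded, nonempty, connected open set which, near each of its
boundary points and after a rotation or reflection of the axes, is the set of points strictly
above the graph of a `C^∞` function. -/
structure IsBoundedSmoothDomain {m : ℕ} (Ω : Set (Eucl m)) : Prop where
  isOpen : IsOpen Ω
  isConnected : IsConnected Ω
  isBounded : Bornology.IsBounded Ω
  smooth_boundary : ∀ x ∈ frontier Ω, ∃ (R : Eucl m ≃ₗᵢ[ℝ] Eucl m)
    (γ : EuclideanSpace ℝ (Fin m) → ℝ) (r : ℝ), ContDiff ℝ ∞ γ ∧ 0 < r ∧
      ∀ y ∈ Metric.ball x r, (y ∈ Ω ↔ γ (initCoords (R y)) < lastCoord (R y))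

/-- Lebesgue measure on `Ω`. -/
abbrev interiorMeasure {m : ℕ} (Ω : Set (Eucl m)) : Measure (Eucl m) := volume.restrict Ω

/-- Surface measure: the (Euclidean-normalized) Hausdorff measure of dimension `n - 1 = m`
on `∂Ω`. -/
abbrev surfaceMeasure {m : ℕ} (Ω : Set (Eucl m)) : Measure (Eucl m) :=
  (Measure.euclideanHausdorffMeasure m).restrict (frontier Ω)

/-- `G` is the weak gradient of `u` in `Ω`, tested against `C_c^∞(Ω)`. -/
def IsWeakGradient {m : ℕ} (Ω : Set (Eucl m)) (u : Eucl m → ℝ) (G : Eucl m → Eucl m) : Prop :=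
  ∀ ψ : Eucl m → ℝ, ContDiff ℝ ∞ ψ → HasCompactSupport ψ → tsupport ψ ⊆ Ω → ∀ v : Eucl m,
    ∫ x, u x * fderiv ℝ ψ x v ∂(interiorMeasure Ω) =
      -∫ x, inner ℝ (G x) v * ψ x ∂(interiorMeasure Ω)

section

variable {m : ℕ} {Ω : Set (Eucl m)} {p : ℝ≥0∞} [Fact (1 ≤ p)]

/-- A function in `L^p` times a continuous compactly supported one is integrable. -/
lemma integrable_mul_test {f ψ : Eucl m → ℝ} (hf : MemLp f p (interiorMeasure Ω))
    (hψ : Continuous ψ) (hc : HasCompactSupport ψ) :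
    Integrable (fun x => f x * ψ x) (interiorMeasure Ω) := by
  have hK : IsCompact (tsupport ψ) := hc
  have h1 : IntegrableOn f (tsupport ψ) (interiorMeasure Ω) := by
    have : IsFiniteMeasure ((interiorMeasure Ω).restrict (tsupport ψ)) :=
      ⟨by
        rw [Measure.restrict_apply_univ]
        exact (Measure.restrict_apply_le _ _).trans_lt hK.measure_lt_top⟩
    exact (hf.restrict _).integrable Fact.out
  have h2 : IntegrableOn (fun x => f x * ψ x) (tsupport ψ) (interiorMeasure Ω) :=
    h1.mul_continuousOn hψ.continuousOn hK
  refine (integrableOn_iff_integrable_of_support_subset ?_).1 h2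
  intro x hx
  exact subset_tsupport ψ (right_ne_zero_of_mul hx)

end

/-- The Sobolev space `W^{1,p}(Ω)`: pairs `(u, ∇u)` in `L^p(Ω) × L^p(Ω; ℝⁿ)` whose second entry is
the weak gradient of the first, with the norm `(‖u‖_p^p + ‖∇u‖_p^p)^{1/p}`. -/
def Sobolev {m : ℕ} (Ω : Set (Eucl m)) (p : ℝ≥0∞) [Fact (1 ≤ p)] :
    Submodule ℝ (WithLp p (Lp ℝ p (interiorMeasure Ω) × Lp (Eucl m) p (interiorMeasure Ω))) where
  carrier := {w | IsWeakGradient Ω w.fst w.snd}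
  zero_mem' := by
    intro ψ _ _ _ v
    have h1 := Lp.coeFn_zero ℝ p (interiorMeasure Ω)
    have h2 := Lp.coeFn_zero (Eucl m) p (interiorMeasure Ω)
    rw [integral_eq_zero_of_ae, integral_eq_zero_of_ae, neg_zero]
    · filter_upwards [h2] with x hx
      rw [WithLp.zero_snd, hx]
      simp
    · filter_upwards [h1] with x hx
      rw [WithLp.zero_fst, hx]
      simp
  add_mem' := by
    intro a b ha hb ψ hψ hc hs v
    have hd : Continuous fun x => fderiv ℝ ψ x v :=
      (hψ.continuous_fderiv (by simp)).clm_apply continuous_const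
    have hdc : HasCompactSupport fun x => fderiv ℝ ψ x v := hc.fderiv_apply (𝕜 := ℝ) v
    have e1 := Lp.coeFn_add a.fst b.fst
    have e2 := Lp.coeFn_add a.snd b.snd
    have l : ∫ x, (a + b).fst x * fderiv ℝ ψ x v ∂(interiorMeasure Ω) =
        ∫ x, (a.fst x * fderiv ℝ ψ x v + b.fst x * fderiv ℝ ψ x v) ∂(interiorMeasure Ω) := by
      refine integral_congr_ae ?_
      filter_upwards [e1] with x hx
      simp only [WithLp.add_fst, hx, Pi.add_apply, add_mul]
    have r : ∫ x, inner ℝ ((a + b).snd x) v * ψ x ∂(interiorMeasure Ω) =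
        ∫ x, (inner ℝ (a.snd x) v * ψ x + inner ℝ (b.snd x) v * ψ x) ∂(interiorMeasure Ω) := by
      refine integral_congr_ae ?_
      filter_upwards [e2] with x hx
      simp only [WithLp.add_snd, hx, Pi.add_apply, inner_add_left, add_mul]
    rw [l, r, integral_add (integrable_mul_test (Lp.memLp _) hd hdc)
        (integrable_mul_test (Lp.memLp _) hd hdc),
      integral_add (integrable_mul_test ((Lp.memLp a.snd).inner_const v) hψ.continuous hc)
        (integrable_mul_test ((Lp.memLp b.snd).inner_const v) hψ.continuous hc),
      ha ψ hψ hc hs v, hb ψ hψ hc hs v, neg_add]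
  smul_mem' := by
    intro c a ha ψ hψ hc hs v
    have e1 := Lp.coeFn_smul c a.fst
    have e2 := Lp.coeFn_smul c a.snd
    have l : ∫ x, (c • a).fst x * fderiv ℝ ψ x v ∂(interiorMeasure Ω) =
        ∫ x, c * (a.fst x * fderiv ℝ ψ x v) ∂(interiorMeasure Ω) := by
      refine integral_congr_ae ?_
      filter_upwards [e1] with x hx
      simp only [WithLp.smul_fst, hx, Pi.smul_apply, smul_eq_mul, mul_assoc]
    have r : ∫ x, inner ℝ ((c • a).snd x) v * ψ x ∂(interiorMeasure Ω) =
        ∫ x, c * (inner ℝ (a.snd x) v * ψ x) ∂(interiorMeasure Ω) := by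
      refine integral_congr_ae ?_
      filter_upwards [e2] with x hx
      simp only [WithLp.smul_snd, hx, Pi.smul_apply, real_inner_smul_left, mul_assoc]
    rw [l, r, integral_const_mul, integral_const_mul, ha ψ hψ hc hs v, mul_neg]

section

variable {m : ℕ} {Ω : Set (Eucl m)} {p : ℝ≥0∞} [Fact (1 ≤ p)]

/-- The underlying `L^p` function of an element of `W^{1,p}(Ω)`. -/
def fn (u : Sobolev Ω p) : Lp ℝ p (interiorMeasure Ω) :=
  (u : WithLp p (Lp ℝ p (interiorMeasure Ω) × Lp (Eucl m) p (interiorMeasure Ω))).fst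

/-- The weak gradient of an element of `W^{1,p}(Ω)`. -/
def grad (u : Sobolev Ω p) : Lp (Eucl m) p (interiorMeasure Ω) :=
  (u : WithLp p (Lp ℝ p (interiorMeasure Ω) × Lp (Eucl m) p (interiorMeasure Ω))).snd

/-- `g ∈ L^p(∂Ω)` is the boundary trace of `u ∈ W^{1,p}(Ω)`: the trace operator is the continuous
extension of the restriction `ψ ↦ ψ|_{∂Ω}` from `C^1` functions up to the boundary, so there are
`C^1` functions converging to `u` in `W^{1,p}(Ω)` whose restrictions to `∂Ω` converge to `g` in
`L^p(∂Ω)`. -/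
def HasTrace (u : Sobolev Ω p) (g : Lp ℝ p (surfaceMeasure Ω)) : Prop :=
  ∃ ψ : ℕ → Eucl m → ℝ, (∀ k, ContDiff ℝ 1 (ψ k)) ∧
    Tendsto (fun k => eLpNorm (fun x => ψ k x - fn u x) p (interiorMeasure Ω)) atTop (𝓝 0) ∧
    Tendsto (fun k => eLpNorm (fun x => gradient (ψ k) x - grad u x) p (interiorMeasure Ω))
      atTop (𝓝 0) ∧
    Tendsto (fun k => eLpNorm (fun x => ψ k x - g x) p (surfaceMeasure Ω)) atTop (𝓝 0)

/-- The functional `I(u, φ) = ∫_Ω |∇u|^p + |u|^p dx + σ ∫_{∂Ω} φ |u|^p dH^{n-1}`, where `g` is the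
trace of `u`. -/
def energy (σ : ℝ) (φ : Lp ℝ ∞ (surfaceMeasure Ω)) (u : Sobolev Ω p)
    (g : Lp ℝ p (surfaceMeasure Ω)) : ℝ :=
  ∫ x, (‖grad u x‖ ^ p.toReal + |fn u x| ^ p.toReal) ∂(interiorMeasure Ω) +
    σ * ∫ x, φ x * |g x| ^ p.toReal ∂(surfaceMeasure Ω)

/-- The first eigenvalue
`λ(σ, φ) = inf {I(u, φ) : u ∈ W^{1,p}(Ω), ‖u‖_{L^p(∂Ω)} = 1}`. -/
def firstEigenvalue (p : ℝ≥0∞) [Fact (1 ≤ p)] (σ : ℝ) (φ : Lp ℝ ∞ (surfaceMeasure Ω)) : ℝ :=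
  sInf {t : ℝ | ∃ (u : Sobolev Ω p) (g : Lp ℝ p (surfaceMeasure Ω)),
    HasTrace u g ∧ ‖g‖ = 1 ∧ t = energy σ φ u g}

/-- `u ∈ W^{1,p}(Ω)`, with trace `g`, is a weak solution of
`-Δ_p u + |u|^{p-2} u = 0` in `Ω`,
`|∇u|^{p-2} ∂u/∂n + σ φ |u|^{p-2} u = lam |u|^{p-2} u` on `∂Ω`. -/
def IsWeakSolution (σ : ℝ) (φ : Lp ℝ ∞ (surfaceMeasure Ω)) (lam : ℝ) (u : Sobolev Ω p)
    (g : Lp ℝ p (surfaceMeasure Ω)) : Prop :=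
  HasTrace u g ∧ ∀ (v : Sobolev Ω p) (h : Lp ℝ p (surfaceMeasure Ω)), HasTrace v h →
    ∫ x, (‖grad u x‖ ^ (p.toReal - 2) * inner ℝ (grad u x) (grad v x) +
        |fn u x| ^ (p.toReal - 2) * fn u x * fn v x) ∂(interiorMeasure Ω) +
      σ * ∫ x, φ x * (|g x| ^ (p.toReal - 2) * g x * h x) ∂(surfaceMeasure Ω) =
    lam * ∫ x, |g x| ^ (p.toReal - 2) * g x * h x ∂(surfaceMeasure Ω)

/-- `u` is a positive eigenfunction associated to `λ(σ, φ)`, normalized by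
`‖u‖_{L^p(∂Ω)} = 1`. -/
def IsPositiveNormalizedEigenfunction (σ : ℝ) (φ : Lp ℝ ∞ (surfaceMeasure Ω))
    (u : Sobolev Ω p) : Prop :=
  (∀ᵐ x ∂(interiorMeasure Ω), 0 < fn u x) ∧
    ∃ g : Lp ℝ p (surfaceMeasure Ω), ‖g‖ = 1 ∧
      IsWeakSolution σ φ (firstEigenvalue p σ φ) u g

/-- Weak-* convergence in `L^∞(∂Ω)`, the dual of `L^1(∂Ω)`. -/
def WeakStarTendsto (φs : ℕ → Lp ℝ ∞ (surfaceMeasure Ω)) (φ : Lp ℝ ∞ (surfaceMeasure Ω)) : Prop :=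
  ∀ f : Lp ℝ 1 (surfaceMeasure Ω),
    Tendsto (fun j => ∫ x, φs j x * f x ∂(surfaceMeasure Ω)) atTop
      (𝓝 (∫ x, φ x * f x ∂(surfaceMeasure Ω)))

end

end Steklov

end

/-! The boundary term passes to the limit because the trace operator is compact. If the traces `g_j`
converge to `g` in `L^p(∂Ω)`, then `|g_j|^p → |g|^p` in `L^1(∂Ω)`, while the `φ_j` are uniformly
bounded as functionals on `L^1(∂Ω)` by Banach–Steinhaus; hence `∫ φ_j |g_j|^p → ∫ φ |g|^p`
(`WeakStarTendsto.tendsto_bdryTerm`). A fixed competitor gives `limsup λ(φ_j) ≤ λ(φ)`.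
Near-minimizers for `φ_j` are bounded in `W^{1,p}`, so their traces converge along a subsequence,
and using them as competitors for `φ` gives the reverse bound (`tendsto_firstEigenvalue`).

Compactness of traces (`HasTrace.exists_subseq_tendsto`) does not go through weak compactness. It
rests on an estimate `‖g‖^p ≤ ε ‖u‖^p + C ∑ |T_i u|^p` with finitely many continuous functionals
`T_i`, namely averages over balls. For `C^1` functions it follows by sliding the boundary inward in
graph charts and averaging over small interior balls; it extends to all pairs with a trace by
density, and it also makes traces unique.

Testing the equation with the solution itself shows that a normalized eigenfunction minimizes the
energy. For minimizers `u_j` the norms converge, and the variational inequality for `φ` at the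
midpoint of `u_j` and `u_k` bounds the norm of the midpoint from below; uniform convexity makes a
subsequence Cauchy in `W^{1,p}`, with a nonnegative minimizer `w` for `φ` as its limit
(`exists_subseq_tendsto_minimizer`).

It remains to see that `w = u` (`IsWeakSolution.eq_of_minimizer`). By hidden convexity, the power
mean `((u^p + w^p)/2)^{1/p}` has Dirichlet energy at most the mean of the two energies, while its
`L^p` and boundary terms are exact means. It is again a competitor, so equality holds and yields `u
∇w = w ∇u`. Division by `u` is justified without regularity theory or a Harnack inequality: the
logarithmic estimate puts `∇u / u` locally in `L^p`, so `arctan (w / √(u² + ε²))` has gradient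
tending to zero with `ε`, and `arctan (w / u)` is constant on the connected set `Ω`. Normalization
and sign fix the factor. As every subsequence has a further subsequence converging to the same `u`,
the whole sequence converges. -/

noncomputable section

namespace Steklov

/-! ### Graph coordinates near the boundary, and surface measure in them -/

section Graph

variable {m : ℕ}

/-- The point of `ℝ^(m+1)` with given first `m` coordinates and last coordinate. -/
def snocPoint (q : EuclideanSpace ℝ (Fin m) × ℝ) : Eucl m :=
  WithLp.toLp 2 (Fin.snoc (α := fun _ => ℝ) (fun i => q.1 i) q.2)

/-- The last vector of the standard basis. -/
def lastVec (m : ℕ) : Eucl m := snocPoint (0, 1)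

lemma snocPoint_initCoords_lastCoord (y : Eucl m) :
    snocPoint (initCoords y, lastCoord y) = y := by
  ext i
  refine Fin.lastCases ?_ (fun j => ?_) i <;> simp [snocPoint, initCoords, lastCoord]

lemma snocPoint_add_smul_lastVec (x : EuclideanSpace ℝ (Fin m)) (s t : ℝ) :
    snocPoint (x, s) + t • lastVec m = snocPoint (x, s + t) := by
  ext i
  refine Fin.lastCases ?_ (fun j => ?_) i <;> simp [snocPoint, lastVec]

lemma initCoords_add_smul_lastVec (y : Eucl m) (t : ℝ) :
    initCoords (y + t • lastVec m) = initCoords y := by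
  ext i; simp [initCoords, lastVec, snocPoint]

lemma lastCoord_add_smul_lastVec (y : Eucl m) (t : ℝ) :
    lastCoord (y + t • lastVec m) = lastCoord y + t := by
  simp [lastCoord, lastVec, snocPoint]

lemma norm_lastVec : ‖lastVec m‖ = 1 := by
  rw [EuclideanSpace.norm_eq, Fin.sum_univ_castSucc]
  simp [lastVec, snocPoint]

lemma contDiff_snocPoint : ContDiff ℝ ∞ (snocPoint (m := m)) := by
  rw [contDiff_euclidean]
  intro i
  refine Fin.lastCases ?_ (fun j => ?_) i
  · simpa [snocPoint] using contDiff_snd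
  · have : ContDiff ℝ ∞ fun q : EuclideanSpace ℝ (Fin m) × ℝ => q.1 j :=
      (contDiff_euclidean.1 contDiff_id j).comp contDiff_fst
    simpa [snocPoint] using this

lemma continuous_initCoords : Continuous (initCoords (m := m)) := by
  unfold initCoords
  exact (PiLp.continuous_toLp 2 _).comp (by fun_prop)

lemma continuous_lastCoord : Continuous (lastCoord (m := m)) := by
  unfold lastCoord; fun_prop

lemma measurePreserving_snocPoint : MeasurePreserving (snocPoint (m := m)) := by
  have h1 : MeasurePreserving (fun q : EuclideanSpace ℝ (Fin m) × ℝ => (q.2, WithLp.ofLp q.1)) :=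
    Measure.measurePreserving_swap.comp
      ((PiLp.volume_preserving_ofLp (Fin m)).prod (MeasurePreserving.id volume))
  have h2 := (volume_preserving_piFinSuccAbove (fun _ : Fin (m + 1) => ℝ) (Fin.last m)).symm
  have h3 := (PiLp.volume_preserving_toLp (Fin (m + 1))).comp (h2.comp h1)
  convert h3 using 1
  ext q i
  simp [snocPoint, MeasurableEquiv.piFinSuccAbove, Fin.insertNthEquiv]

variable {Ω : Set (Eucl m)} {R : Eucl m ≃ₗᵢ[ℝ] Eucl m} {γ : EuclideanSpace ℝ (Fin m) → ℝ}
  {x : Eucl m} {r : ℝ}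

/-- A frontier point of an open set lies outside it, hence not above the graph; were it strictly
below, so would a whole neighbourhood, which would miss `Ω`. -/
lemma lastCoord_eq_of_mem_frontier (ho : IsOpen Ω) (hγ : Continuous γ)
    (hch : ∀ y ∈ Metric.ball x r, (y ∈ Ω ↔ γ (initCoords (R y)) < lastCoord (R y)))
    {y : Eucl m} (hy : y ∈ frontier Ω) (hyr : y ∈ Metric.ball x r) :
    lastCoord (R y) = γ (initCoords (R y)) := by
  rw [ho.frontier_eq] at hy
  refine le_antisymm (not_lt.1 fun h => hy.2 ((hch y hyr).2 h)) (not_lt.1 fun h => ?_)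
  have h1 : IsOpen {z : Eucl m | lastCoord (R z) < γ (initCoords (R z))} :=
    isOpen_lt (continuous_lastCoord.comp R.continuous)
      (hγ.comp (continuous_initCoords.comp R.continuous))
  obtain ⟨z, ⟨hz1, hz2⟩, hz3⟩ := mem_closure_iff.1 hy.1 _ (h1.inter Metric.isOpen_ball) ⟨h, hyr⟩
  exact absurd ((hch z hz2).1 hz3) (not_lt.2 (le_of_lt hz1))

/-- The direction pointing into the domain in a graph chart. -/
def inward (R : Eucl m ≃ₗᵢ[ℝ] Eucl m) : Eucl m := R.symm (lastVec m)

lemma norm_inward : ‖inward R‖ = 1 := by simp [inward, norm_lastVec]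

lemma add_smul_inward_mem (ho : IsOpen Ω) (hγ : Continuous γ)
    (hch : ∀ y ∈ Metric.ball x r, (y ∈ Ω ↔ γ (initCoords (R y)) < lastCoord (R y)))
    {y : Eucl m} (hy : y ∈ frontier Ω) (hyr : y ∈ Metric.closedBall x (r / 2)) {t : ℝ}
    (ht : 0 < t) (htr : t < r / 2) : y + t • inward R ∈ Ω := by
  rw [Metric.mem_closedBall, dist_eq_norm] at hyr
  have h1 : y ∈ Metric.ball x r := by
    rw [Metric.mem_ball, dist_eq_norm]; linarith
  have h2 : y + t • inward R ∈ Metric.ball x r := by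
    rw [Metric.mem_ball, dist_eq_norm]
    calc ‖y + t • inward R - x‖ = ‖(y - x) + t • inward R‖ := by congr 1; abel
      _ ≤ ‖y - x‖ + ‖t • inward R‖ := norm_add_le _ _
      _ < r := by rw [norm_smul, norm_inward, Real.norm_of_nonneg ht.le]; linarith
  rw [hch _ h2, map_add, map_smul, inward, R.apply_symm_apply, initCoords_add_smul_lastVec,
    lastCoord_add_smul_lastVec, lastCoord_eq_of_mem_frontier ho hγ hch hy h1]
  linarith

/-- Near a boundary point the surface measure is controlled by Lebesgue measure in the graph
coordinates: it is finite and translating along the inward direction sweeps out at most a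
multiple of Lebesgue measure. -/
lemma exists_surface_sweep_le (ho : IsOpen Ω) (hγ : ContDiff ℝ ∞ γ) (hr : 0 < r)
    (hch : ∀ y ∈ Metric.ball x r, (y ∈ Ω ↔ γ (initCoords (R y)) < lastCoord (R y))) :
    ∃ C : ℝ≥0∞, C ≠ ⊤ ∧
      (Measure.euclideanHausdorffMeasure m : Measure (Eucl m))
        (frontier Ω ∩ Metric.closedBall x (r / 2)) ≠ ⊤ ∧
      ∀ F : Eucl m → ℝ≥0∞, Measurable F →
        ∫⁻ y in frontier Ω ∩ Metric.closedBall x (r / 2), (∫⁻ t : ℝ, F (y + t • inward R))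
          ∂(Measure.euclideanHausdorffMeasure m) ≤ C * ∫⁻ z, F z := by
  set A := frontier Ω ∩ Metric.closedBall x (r / 2) with hA
  have hAc : IsCompact A := (isCompact_closedBall x (r / 2)).inter_left isClosed_frontier
  set P : Eucl m → EuclideanSpace ℝ (Fin m) := fun y => initCoords (R y) with hP
  have hPc : Continuous P := continuous_initCoords.comp R.continuous
  set G : EuclideanSpace ℝ (Fin m) → Eucl m := fun z => R.symm (snocPoint (z, γ z)) with hG
  have hGd : ContDiff ℝ ∞ G :=
    R.symm.contDiff.comp (contDiff_snocPoint.comp (contDiff_id.prodMk hγ))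
  have hGP : ∀ y ∈ A, G (P y) = y := by
    intro y hy
    have h1 : y ∈ Metric.ball x r := by
      have := hy.2
      rw [Metric.mem_closedBall] at this
      rw [Metric.mem_ball]; linarith
    simp only [hG, hP]
    rw [← lastCoord_eq_of_mem_frontier ho hγ.continuous hch hy.1 h1,
      snocPoint_initCoords_lastCoord, R.symm_apply_apply]
  -- `γ` is smooth but need not be globally Lipschitz, so `G` is used only over a ball containing
  -- the compact shadow of `A`.
  obtain ⟨ρ, hρ⟩ := (hAc.image hPc).isBounded.subset_closedBall (0 : EuclideanSpace ℝ (Fin m))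
  obtain ⟨K, hK⟩ := hGd.contDiffOn.exists_lipschitzOnWith (s := Metric.closedBall 0 ρ) (by simp)
    (convex_closedBall _ _) (isCompact_closedBall _ _)
  have key : ∀ E ⊆ A, (Measure.euclideanHausdorffMeasure m : Measure (Eucl m)) E ≤
      (K : ℝ≥0∞) ^ (m : ℝ) * volume (P '' E) := by
    intro E hE
    have h1 : E = G '' (P '' E) := by
      rw [image_image]
      conv_lhs => rw [← image_id E]
      exact image_congr fun y hy => (hGP y (hE hy)).symm
    conv_lhs => rw [h1]
    -- Both sides carry the same normalizing constant, so the Lipschitz bound for the unnormalized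
    -- Hausdorff measure suffices.
    rw [← EuclideanSpace.euclideanHausdorffMeasure_eq_volume m,
      Measure.euclideanHausdorffMeasure_def, Measure.euclideanHausdorffMeasure_def,
      Measure.smul_apply, Measure.smul_apply, mul_smul_comm]
    gcongr
    exact (hK.mono ((image_mono hE).trans hρ)).hausdorffMeasure_image_le (Nat.cast_nonneg m)
  have hle : (Measure.euclideanHausdorffMeasure m : Measure (Eucl m)).restrict A ≤
      ((K : ℝ≥0∞) ^ (m : ℝ)) • Measure.map G volume := by
    refine Measure.le_iff.2 fun E hE => ?_
    rw [Measure.restrict_apply hE, Measure.smul_apply, Measure.map_apply hGd.continuous.measurable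
      hE, smul_eq_mul]
    refine (key _ inter_subset_right).trans ?_
    gcongr
    rintro _ ⟨y, hy, rfl⟩
    rw [mem_preimage, hGP y hy.2]
    exact hy.1
  have hC : (K : ℝ≥0∞) ^ (m : ℝ) ≠ ⊤ := ENNReal.rpow_ne_top_of_nonneg (by positivity) (by simp)
  refine ⟨_, hC, ?_, fun F hF => ?_⟩
  · refine ne_top_of_le_ne_top (ENNReal.mul_ne_top hC ?_) (key A subset_rfl)
    exact ((hAc.image hPc).isBounded.measure_lt_top).ne
  · have hFm : Measurable fun y : Eucl m => ∫⁻ t : ℝ, F (y + t • inward R) := by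
      refine Measurable.lintegral_prod_right' (f := fun q : Eucl m × ℝ => F (q.1 + q.2 • inward R))
        (hF.comp ?_)
      fun_prop
    calc _ ≤ ∫⁻ y, (∫⁻ t : ℝ, F (y + t • inward R)) ∂(((K : ℝ≥0∞) ^ (m : ℝ)) • Measure.map G volume) :=
          lintegral_mono' hle le_rfl
      _ = (K : ℝ≥0∞) ^ (m : ℝ) * ∫⁻ z, ∫⁻ t : ℝ, F (G z + t • inward R) := by
          rw [lintegral_smul_measure, lintegral_map hFm hGd.continuous.measurable, smul_eq_mul]
      _ = (K : ℝ≥0∞) ^ (m : ℝ) * ∫⁻ z, ∫⁻ t : ℝ, F (R.symm (snocPoint (z, t))) := by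
          congr 1
          refine lintegral_congr fun z => ?_
          -- Shifting `t` by `γ z` turns the line issuing from the graph point over `z` into the
          -- coordinate line over `z`; these lines fill space, and Tonelli applies.
          rw [← lintegral_add_left_eq_self (fun t => F (R.symm (snocPoint (z, t)))) (γ z)]
          refine lintegral_congr fun t => ?_
          rw [← snocPoint_add_smul_lastVec]
          simp [hG, inward]
      _ = (K : ℝ≥0∞) ^ (m : ℝ) * ∫⁻ z, F z := by
          congr 1
          have h1 : MeasurePreserving fun q => R.symm (snocPoint (m := m) q) :=
            R.symm.measurePreserving.comp measurePreserving_snocPoint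
          rw [← h1.lintegral_comp hF, Measure.volume_eq_prod, lintegral_prod]
          exact (hF.comp h1.measurable).aemeasurable

end Graph

/-! ### Compactness estimates for `C^1` functions, in the interior and on the boundary -/

section TraceInequality

/-- Hölder against the constant function `1`. -/
lemma lintegral_rpow_le {α : Type*} [MeasurableSpace α] {μ : Measure α} {g : α → ℝ≥0∞}
    (hg : AEMeasurable g μ) {q : ℝ} (hq : 1 ≤ q) :
    (∫⁻ a, g a ∂μ) ^ q ≤ μ univ ^ (q - 1) * ∫⁻ a, g a ^ q ∂μ := by
  have hq0 : 0 < q := by linarith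
  have h := eLpNorm'_le_eLpNorm'_mul_rpow_measure_univ (f := g) (μ := μ) zero_lt_one hq
    hg.aestronglyMeasurable
  simp only [eLpNorm', enorm_eq_self, ENNReal.rpow_one, div_one, one_div] at h
  calc (∫⁻ a, g a ∂μ) ^ q ≤ ((∫⁻ a, g a ^ q ∂μ) ^ q⁻¹ * μ univ ^ (1 - q⁻¹)) ^ q := by gcongr
    _ = μ univ ^ (q - 1) * ∫⁻ a, g a ^ q ∂μ := by
      rw [ENNReal.mul_rpow_of_nonneg _ _ hq0.le, ← ENNReal.rpow_mul, ← ENNReal.rpow_mul,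
        inv_mul_cancel₀ hq0.ne', ENNReal.rpow_one, sub_mul, inv_mul_cancel₀ hq0.ne', one_mul,
        mul_comm]

variable {m : ℕ} {f : Eucl m → ℝ}

lemma enorm_sub_le_lintegral_fderiv (hf : ContDiff ℝ 1 f) (y v : Eucl m) {t : ℝ} (ht : 0 ≤ t) :
    ‖f (y + t • v) - f y‖ₑ ≤ ∫⁻ s in Ioc 0 t, ‖fderiv ℝ f (y + s • v)‖ₑ * ‖v‖ₑ := by
  have hd : ∀ s : ℝ, HasDerivAt (fun s : ℝ => f (y + s • v)) (fderiv ℝ f (y + s • v) v) s := by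
    intro s
    have h1 : HasDerivAt (fun s : ℝ => y + s • v) v s := by
      simpa using ((hasDerivAt_id s).smul_const v).const_add y
    exact ((hf.differentiable one_ne_zero) _).hasFDerivAt.comp_hasDerivAt s h1
  have hc : Continuous fun s : ℝ => fderiv ℝ f (y + s • v) v :=
    ((hf.continuous_fderiv one_ne_zero).comp (by fun_prop)).clm_apply continuous_const
  have h := intervalIntegral.integral_eq_sub_of_hasDerivAt (a := 0) (b := t) (fun s _ => hd s)
    (hc.intervalIntegrable _ _)
  rw [zero_smul, add_zero] at h
  rw [← h, intervalIntegral.integral_of_le ht]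
  refine (enorm_integral_le_lintegral_enorm _).trans (lintegral_mono fun s => ?_)
  exact ContinuousLinearMap.le_opENorm _ _

/-- The fundamental theorem of calculus along a segment, followed by Hölder in `s`. The factor `t ^
(q - 1)` is what becomes small near the boundary when `1 < q`. -/
lemma enorm_sub_rpow_le (hf : ContDiff ℝ 1 f) (y v : Eucl m) {q : ℝ} (hq : 1 ≤ q) {t : ℝ}
    (ht : 0 ≤ t) :
    ‖f (y + t • v) - f y‖ₑ ^ q ≤ ENNReal.ofReal t ^ (q - 1) *
      ∫⁻ s in Ioc 0 t, ‖fderiv ℝ f (y + s • v)‖ₑ ^ q * ‖v‖ₑ ^ q := by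
  have hc : Continuous fun s : ℝ => ‖fderiv ℝ f (y + s • v)‖ₑ :=
    ((hf.continuous_fderiv one_ne_zero).comp (by fun_prop)).enorm
  calc _ ≤ (∫⁻ s in Ioc 0 t, ‖fderiv ℝ f (y + s • v)‖ₑ * ‖v‖ₑ) ^ q :=
        ENNReal.rpow_le_rpow (enorm_sub_le_lintegral_fderiv hf y v ht) (by linarith)
    _ ≤ _ := lintegral_rpow_le (hc.measurable.mul_const _).aemeasurable hq
    _ = _ := by
      rw [Measure.restrict_apply_univ, Real.volume_Ioc, sub_zero]
      simp_rw [ENNReal.mul_rpow_of_nonneg _ _ (show 0 ≤ q by linarith)]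

/-- Averaged translation estimate for `C^1` functions. -/
lemma lintegral_translate_sub_le (hf : ContDiff ℝ 1 f) {q : ℝ} (hq : 1 ≤ q) {K U : Set (Eucl m)}
    (hK : MeasurableSet K) (hU : MeasurableSet U) {ρ : ℝ}
    (hKU : ∀ x ∈ K, ∀ v ∈ Metric.ball (0 : Eucl m) ρ, x + v ∈ U) :
    ∫⁻ x in K, ∫⁻ v in Metric.ball 0 ρ, ‖f (x + v) - f x‖ₑ ^ q ≤
      ENNReal.ofReal ρ ^ q * volume (Metric.ball (0 : Eucl m) ρ) *
        ∫⁻ x in U, ‖fderiv ℝ f x‖ₑ ^ q := by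
  have hq0 : 0 ≤ q := by linarith
  have hD : Measurable fun x => ‖fderiv ℝ f x‖ₑ ^ q :=
    ((hf.continuous_fderiv one_ne_zero).enorm.measurable).pow_const q
  have hf' : Continuous f := hf.continuous
  have hmeas : Measurable fun z : (Eucl m) × (Eucl m) =>
      ∫⁻ s in Ioc (0 : ℝ) 1, ‖fderiv ℝ f (z.1 + s • z.2)‖ₑ ^ q := by
    refine Measurable.lintegral_prod_right' (ν := volume.restrict (Ioc (0 : ℝ) 1))
      (f := fun w : ((Eucl m) × (Eucl m)) × ℝ => ‖fderiv ℝ f (w.1.1 + w.2 • w.1.2)‖ₑ ^ q)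
      (hD.comp ?_)
    fun_prop
  calc ∫⁻ x in K, ∫⁻ v in Metric.ball 0 ρ, ‖f (x + v) - f x‖ₑ ^ q
      ≤ ∫⁻ x in K, ∫⁻ v in Metric.ball 0 ρ, ENNReal.ofReal ρ ^ q *
          ∫⁻ s in Ioc (0 : ℝ) 1, ‖fderiv ℝ f (x + s • v)‖ₑ ^ q := by
        refine lintegral_mono fun x => setLIntegral_mono' measurableSet_ball fun v hv => ?_
        have h1 := enorm_sub_rpow_le hf x v hq zero_le_one
        rw [one_smul, ENNReal.ofReal_one, ENNReal.one_rpow, one_mul,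
          lintegral_mul_const' _ _ (ENNReal.rpow_ne_top_of_nonneg hq0 enorm_ne_top), mul_comm] at h1
        refine h1.trans ?_
        gcongr
        rw [← ofReal_norm]
        exact ENNReal.ofReal_le_ofReal (mem_ball_zero_iff.1 hv).le
    _ = ENNReal.ofReal ρ ^ q * ∫⁻ x in K, ∫⁻ v in Metric.ball 0 ρ,
          ∫⁻ s in Ioc (0 : ℝ) 1, ‖fderiv ℝ f (x + s • v)‖ₑ ^ q := by
        rw [← lintegral_const_mul']
        · refine lintegral_congr fun x => ?_
          rw [lintegral_const_mul']
          exact ENNReal.rpow_ne_top_of_nonneg hq0 ENNReal.ofReal_ne_top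
        · exact ENNReal.rpow_ne_top_of_nonneg hq0 ENNReal.ofReal_ne_top
    _ = ENNReal.ofReal ρ ^ q * ∫⁻ v in Metric.ball 0 ρ, ∫⁻ s in Ioc (0 : ℝ) 1,
          ∫⁻ x in K, ‖fderiv ℝ f (x + s • v)‖ₑ ^ q := by
        congr 1
        rw [lintegral_lintegral_swap hmeas.aemeasurable]
        refine lintegral_congr fun v => ?_
        rw [lintegral_lintegral_swap]
        exact (hD.comp (by fun_prop)).aemeasurable
    _ ≤ ENNReal.ofReal ρ ^ q * ∫⁻ v in Metric.ball (0 : Eucl m) ρ, ∫⁻ s in Ioc (0 : ℝ) 1,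
          ∫⁻ x in U, ‖fderiv ℝ f x‖ₑ ^ q := by
        gcongr ENNReal.ofReal ρ ^ q * ?_
        refine setLIntegral_mono' measurableSet_ball fun v hv =>
          setLIntegral_mono' measurableSet_Ioc fun s hs => ?_
        -- Translation by `s • v` carries `K` into `U`, because balls about `0` are star-shaped;
        -- Lebesgue measure is invariant under it.
        rw [← lintegral_indicator hK, ← lintegral_indicator hU,
          ← lintegral_add_right_eq_self (U.indicator fun x => ‖fderiv ℝ f x‖ₑ ^ q) (s • v)]
        refine lintegral_mono fun x => ?_
        by_cases hx : x ∈ K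
        · rw [indicator_of_mem hx, indicator_of_mem]
          refine hKU x hx _ ?_
          rw [mem_ball_zero_iff] at hv ⊢
          rw [norm_smul, Real.norm_of_nonneg hs.1.le]
          exact (mul_le_of_le_one_left (norm_nonneg _) hs.2).trans_lt hv
        · rw [indicator_of_notMem hx]; exact zero_le
    _ = _ := by
        simp only [lintegral_const, Measure.restrict_apply_univ, Real.volume_Ioc, sub_zero,
          ENNReal.ofReal_one, mul_one]
        ring

/-- Pointwise bound by the average over a ball and the oscillation. -/
lemma measure_ball_rpow_mul_enorm_rpow_le (hf : Continuous f) {q : ℝ} (hq : 1 ≤ q) {z x : Eucl m}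
    {h : ℝ} (hx : x ∈ Metric.ball z h) :
    volume (Metric.ball z h) ^ q * ‖f x‖ₑ ^ q ≤ 2 ^ (q - 1) * (‖∫ y in Metric.ball z h, f y‖ₑ ^ q +
      volume (Metric.ball z h) ^ (q - 1) *
        ∫⁻ v in Metric.ball 0 (2 * h), ‖f (x + v) - f x‖ₑ ^ q) := by
  have hq0 : 0 ≤ q := by linarith
  set B := Metric.ball z h with hB
  have hBt : volume B ≠ ⊤ := Metric.isBounded_ball.measure_lt_top.ne
  have hfi : IntegrableOn f B :=
    (hf.continuousOn.integrableOn_compact (isCompact_closedBall z h)).mono_set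
      Metric.ball_subset_closedBall
  -- The value at `x` is split as `|B| f(x) = ∫_B f - ∫_B (f - f(x))`.
  have h1 : ∫ y in B, (f y - f x) = (∫ y in B, f y) - (volume B).toReal * f x := by
    rw [integral_sub hfi (integrableOn_const hBt), setIntegral_const, smul_eq_mul]
    rfl
  have h2 : volume B * ‖f x‖ₑ ≤ ‖∫ y in B, f y‖ₑ + ∫⁻ y in B, ‖f y - f x‖ₑ := by
    calc volume B * ‖f x‖ₑ = ‖(volume B).toReal * f x‖ₑ := by
          rw [enorm_mul, Real.enorm_eq_ofReal ENNReal.toReal_nonneg, ENNReal.ofReal_toReal hBt]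
      _ = ‖(∫ y in B, f y) - ∫ y in B, (f y - f x)‖ₑ := by rw [h1]; congr 1; ring
      _ ≤ ‖∫ y in B, f y‖ₑ + ‖∫ y in B, (f y - f x)‖ₑ := enorm_sub_le
      _ ≤ _ := by gcongr; exact enorm_integral_le_lintegral_enorm _
  have h3 : ∫⁻ y in B, ‖f y - f x‖ₑ ^ q ≤
      ∫⁻ v in Metric.ball 0 (2 * h), ‖f (x + v) - f x‖ₑ ^ q := by
    -- Two points of `B` differ by less than `2 * h`, so `B` seen from `x` fits in a ball of that
    -- radius about `0`.
    rw [← lintegral_indicator measurableSet_ball, ← lintegral_indicator measurableSet_ball,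
      ← lintegral_add_left_eq_self (B.indicator fun y => ‖f y - f x‖ₑ ^ q) x]
    refine lintegral_mono fun v => ?_
    by_cases hv : x + v ∈ B
    · rw [indicator_of_mem hv, indicator_of_mem]
      rw [hB, Metric.mem_ball, dist_eq_norm] at hv hx
      rw [mem_ball_zero_iff]
      calc ‖v‖ = ‖(x + v - z) - (x - z)‖ := by congr 1; abel
        _ ≤ ‖x + v - z‖ + ‖x - z‖ := norm_sub_le _ _
        _ < 2 * h := by linarith
    · rw [indicator_of_notMem hv]; exact zero_le
  calc volume B ^ q * ‖f x‖ₑ ^ q = (volume B * ‖f x‖ₑ) ^ q :=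
        (ENNReal.mul_rpow_of_nonneg _ _ hq0).symm
    _ ≤ (‖∫ y in B, f y‖ₑ + ∫⁻ y in B, ‖f y - f x‖ₑ) ^ q := by gcongr
    _ ≤ 2 ^ (q - 1) * (‖∫ y in B, f y‖ₑ ^ q + (∫⁻ y in B, ‖f y - f x‖ₑ) ^ q) :=
        ENNReal.rpow_add_le_mul_rpow_add_rpow _ _ hq
    _ ≤ _ := by
      gcongr
      refine (lintegral_rpow_le ?_ hq).trans ?_
      · exact (hf.sub continuous_const).enorm.measurable.aemeasurable
      · rw [Measure.restrict_apply_univ]; gcongr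

/-- The finitely many linear functionals of the compactness estimates: the sum of the `q`-th powers
of the integrals of `f` over the balls listed in `s`. -/
def ballSum (s : Finset (Eucl m × ℝ)) (q : ℝ) (f : Eucl m → ℝ) : ℝ≥0∞ :=
  ∑ b ∈ s, ‖∫ y in Metric.ball b.1 b.2, f y‖ₑ ^ q

lemma ballSum_mono {s t : Finset (Eucl m × ℝ)} (h : s ⊆ t) (q : ℝ) (f : Eucl m → ℝ) :
    ballSum s q f ≤ ballSum t q f :=
  Finset.sum_le_sum_of_subset h

lemma le_ballSum {s : Finset (Eucl m × ℝ)} {b : Eucl m × ℝ} (hb : b ∈ s) (q : ℝ)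
    (f : Eucl m → ℝ) : ‖∫ y in Metric.ball b.1 b.2, f y‖ₑ ^ q ≤ ballSum s q f :=
  Finset.single_le_sum_of_canonicallyOrdered (f := fun b : Eucl m × ℝ =>
    ‖∫ y in Metric.ball b.1 b.2, f y‖ₑ ^ q) hb

/-- Interior compactness estimate for `C^1` functions. -/
lemma exists_lintegral_compact_le {Ω K : Set (Eucl m)} (hΩ : IsOpen Ω) (hK : IsCompact K)
    (hKΩ : K ⊆ Ω) {q : ℝ} (hq : 1 ≤ q) {ε : ℝ≥0∞} (hε : ε ≠ 0) :
    ∃ (s : Finset (Eucl m × ℝ)) (C : ℝ≥0∞), C ≠ ⊤ ∧ (∀ b ∈ s, Metric.ball b.1 b.2 ⊆ Ω) ∧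
      ∀ f : Eucl m → ℝ, ContDiff ℝ 1 f →
        ∫⁻ x in K, ‖f x‖ₑ ^ q ≤ ε * (∫⁻ x in Ω, ‖fderiv ℝ f x‖ₑ ^ q) + C * ballSum s q f := by
  classical
  have hq0 : 0 < q := by linarith
  obtain ⟨δ, hδ, hδΩ⟩ := hK.exists_thickening_subset_open hΩ hKΩ
  -- This is the final coefficient of the gradient: `2 ^ (q - 1)` comes from splitting a `q`-th
  -- power of a sum, `(2h)^q` from the oscillation, and `2 ^ (m + 1)` is the volume ratio of the
  -- balls of radii `2h` and `h`.
  have hlim : Tendsto (fun h : ℝ => (2 : ℝ≥0∞) ^ (q - 1) * (ENNReal.ofReal (2 * h) ^ q *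
      2 ^ (m + 1))) (𝓝[>] 0) (𝓝 0) := by
    have h1 : Tendsto (fun h : ℝ => ENNReal.ofReal (2 * h)) (𝓝[>] 0) (𝓝 0) := by
      have : Tendsto (fun h : ℝ => ENNReal.ofReal (2 * h)) (𝓝 0) (𝓝 (ENNReal.ofReal (2 * 0))) :=
        (ENNReal.continuous_ofReal.comp (by fun_prop)).tendsto 0
      simp only [mul_zero, ENNReal.ofReal_zero] at this
      exact this.mono_left nhdsWithin_le_nhds
    have h2 := (ENNReal.continuous_rpow_const (y := q)).tendsto 0 |>.comp h1
    rw [ENNReal.zero_rpow_of_pos hq0] at h2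
    have h3 := ENNReal.Tendsto.const_mul (a := (2 : ℝ≥0∞) ^ (q - 1))
      (ENNReal.Tendsto.mul_const (b := (2 : ℝ≥0∞) ^ (m + 1)) h2 (Or.inr (by simp)))
      (Or.inr (ENNReal.rpow_ne_top_of_nonneg (by linarith) (by simp)))
    simpa using h3
  obtain ⟨h, hhε, hh0, hhδ⟩ : ∃ h : ℝ, (2 : ℝ≥0∞) ^ (q - 1) * (ENNReal.ofReal (2 * h) ^ q *
      2 ^ (m + 1)) ≤ ε ∧ 0 < h ∧ h < δ / 2 := by
    have e1 := hlim.eventually_le_const (pos_iff_ne_zero.2 hε)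
    have e2 : ∀ᶠ h : ℝ in 𝓝[>] 0, h ∈ Ioo 0 (δ / 2) := Ioo_mem_nhdsGT (by linarith)
    obtain ⟨h, h1, h2⟩ := (e1.and e2).exists
    exact ⟨h, h1, h2.1, h2.2⟩
  obtain ⟨t, htK, hcov⟩ := hK.elim_finite_subcover_image (b := K)
    (c := fun z => Metric.ball z h) (fun _ _ => Metric.isOpen_ball)
    (fun x hx => mem_iUnion₂.2 ⟨x, hx, Metric.mem_ball_self hh0⟩)
  obtain ⟨htf, hcov⟩ := hcov
  set V : ℝ≥0∞ := volume (Metric.ball (0 : Eucl m) h) with hV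
  have hV0 : V ≠ 0 := (Metric.measure_ball_pos _ _ hh0).ne'
  have hVt : V ≠ ⊤ := Metric.isBounded_ball.measure_lt_top.ne
  have hVz : ∀ z : Eucl m, volume (Metric.ball z h) = V := fun z =>
    Measure.addHaar_ball_center volume z h
  have hV2 : volume (Metric.ball (0 : Eucl m) (2 * h)) = 2 ^ (m + 1) * V := by
    rw [Measure.addHaar_ball_mul _ _ (by norm_num)]
    simp [hV, ENNReal.ofReal_pow]
  have hVq0 : V ^ q ≠ 0 := by simp [hV0, hVt, ENNReal.rpow_eq_zero_iff]
  have hVqt : V ^ q ≠ ⊤ := ENNReal.rpow_ne_top_of_nonneg hq0.le hVt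
  refine ⟨htf.toFinset.image fun z => (z, h), (V ^ q)⁻¹ * (2 ^ (q - 1) * volume K), ?_, ?_, ?_⟩
  · refine ENNReal.mul_ne_top (ENNReal.inv_ne_top.2 hVq0) (ENNReal.mul_ne_top ?_
      hK.measure_lt_top.ne)
    exact ENNReal.rpow_ne_top_of_nonneg (by linarith) (by simp)
  · intro b hb
    obtain ⟨z, hz, rfl⟩ := Finset.mem_image.1 hb
    refine subset_trans (fun y hy => ?_) hδΩ
    rw [Metric.mem_thickening_iff]
    exact ⟨z, htK (htf.mem_toFinset.1 hz), (Metric.mem_ball.1 hy).trans (by linarith)⟩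
  · intro f hf
    set s := htf.toFinset.image fun z => (z, h) with hs
    have hmeas : Measurable fun x => ∫⁻ v in Metric.ball (0 : Eucl m) (2 * h),
        ‖f (x + v) - f x‖ₑ ^ q := by
      have hf' : Continuous f := hf.continuous
      refine Measurable.lintegral_prod_right' (ν := volume.restrict (Metric.ball (0 : Eucl m) (2 * h)))
        (f := fun w : (Eucl m) × (Eucl m) => ‖f (w.1 + w.2) - f w.1‖ₑ ^ q)
        (Measurable.pow_const ?_ q)
      exact (by fun_prop : Continuous fun w : (Eucl m) × (Eucl m) =>
        f (w.1 + w.2) - f w.1).enorm.measurable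
    have hpt : ∀ x ∈ K, V ^ q * ‖f x‖ₑ ^ q ≤ 2 ^ (q - 1) * (ballSum s q f +
        V ^ (q - 1) * ∫⁻ v in Metric.ball 0 (2 * h), ‖f (x + v) - f x‖ₑ ^ q) := by
      intro x hx
      obtain ⟨z, hz, hxz⟩ := mem_iUnion₂.1 (hcov hx)
      have h1 := measure_ball_rpow_mul_enorm_rpow_le hf.continuous hq hxz
      rw [hVz] at h1
      refine h1.trans ?_
      gcongr
      have hzs : (z, h) ∈ s := Finset.mem_image.2 ⟨z, htf.mem_toFinset.2 hz, rfl⟩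
      exact le_ballSum hzs q f
    have hint : V ^ q * ∫⁻ x in K, ‖f x‖ₑ ^ q ≤ 2 ^ (q - 1) * (ballSum s q f * volume K +
        V ^ (q - 1) * (ENNReal.ofReal (2 * h) ^ q * (2 ^ (m + 1) * V) *
          (∫⁻ x in Ω, ‖fderiv ℝ f x‖ₑ ^ q))) := by
      have htr := lintegral_translate_sub_le hf hq hK.measurableSet hΩ.measurableSet (ρ := 2 * h)
        (fun x hx v hv => hδΩ (Metric.mem_thickening_iff.2 ⟨x, hx, by
          rw [dist_eq_norm, add_sub_cancel_left]
          exact (mem_ball_zero_iff.1 hv).trans (by linarith)⟩))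
      rw [hV2] at htr
      calc V ^ q * ∫⁻ x in K, ‖f x‖ₑ ^ q = ∫⁻ x in K, V ^ q * ‖f x‖ₑ ^ q :=
            (lintegral_const_mul' _ _ hVqt).symm
        _ ≤ ∫⁻ x in K, 2 ^ (q - 1) * (ballSum s q f +
            V ^ (q - 1) * ∫⁻ v in Metric.ball 0 (2 * h), ‖f (x + v) - f x‖ₑ ^ q) :=
          setLIntegral_mono' hK.measurableSet hpt
        _ = 2 ^ (q - 1) * (ballSum s q f * volume K +
            V ^ (q - 1) * ∫⁻ x in K, ∫⁻ v in Metric.ball 0 (2 * h), ‖f (x + v) - f x‖ₑ ^ q) := by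
          rw [lintegral_const_mul _ ((hmeas.const_mul _).const_add _),
            lintegral_add_left measurable_const, lintegral_const_mul _ hmeas, lintegral_const,
            Measure.restrict_apply_univ]
        _ ≤ _ := by gcongr
    have hVq : V ^ (q - 1) * V = V ^ q := by
      conv_lhs => rw [← ENNReal.rpow_one V, ← ENNReal.rpow_mul, one_mul]
      rw [← ENNReal.rpow_add _ _ hV0 hVt, sub_add_cancel]
    calc ∫⁻ x in K, ‖f x‖ₑ ^ q = (V ^ q)⁻¹ * (V ^ q * ∫⁻ x in K, ‖f x‖ₑ ^ q) := by
          rw [← mul_assoc, ENNReal.inv_mul_cancel hVq0 hVqt, one_mul]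
      _ ≤ (V ^ q)⁻¹ * (2 ^ (q - 1) * (ballSum s q f * volume K +
        V ^ (q - 1) * (ENNReal.ofReal (2 * h) ^ q * (2 ^ (m + 1) * V) *
          (∫⁻ x in Ω, ‖fderiv ℝ f x‖ₑ ^ q)))) := by gcongr
      _ = ((V ^ q)⁻¹ * V ^ q) * (2 ^ (q - 1) * (ENNReal.ofReal (2 * h) ^ q * 2 ^ (m + 1))) *
            (∫⁻ x in Ω, ‖fderiv ℝ f x‖ₑ ^ q) +
          (V ^ q)⁻¹ * (2 ^ (q - 1) * volume K) * ballSum s q f := by rw [← hVq]; ring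
      _ ≤ _ := by
        rw [ENNReal.inv_mul_cancel hVq0 hVqt, one_mul]
        gcongr

/-- Estimate of the boundary values near a boundary point by the values in a compact subset. -/
lemma exists_lintegral_surface_chart_le {Ω : Set (Eucl m)} {R : Eucl m ≃ₗᵢ[ℝ] Eucl m}
    {γ : EuclideanSpace ℝ (Fin m) → ℝ} {x : Eucl m} {r : ℝ}
    (ho : IsOpen Ω) (hγ : ContDiff ℝ ∞ γ) (hr : 0 < r)
    (hch : ∀ y ∈ Metric.ball x r, (y ∈ Ω ↔ γ (initCoords (R y)) < lastCoord (R y)))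
    {q : ℝ} (hq : 1 < q) {ε : ℝ≥0∞} (hε : ε ≠ 0) :
    ∃ (K : Set (Eucl m)) (C : ℝ≥0∞), IsCompact K ∧ K ⊆ Ω ∧ C ≠ ⊤ ∧
      ∀ f : Eucl m → ℝ, ContDiff ℝ 1 f →
        ∫⁻ y in frontier Ω ∩ Metric.closedBall x (r / 2), ‖f y‖ₑ ^ q
          ∂(Measure.euclideanHausdorffMeasure m) ≤
        ε * (∫⁻ x in Ω, ‖fderiv ℝ f x‖ₑ ^ q) + C * ∫⁻ x in K, ‖f x‖ₑ ^ q := by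
  have hq0 : 0 < q := by linarith
  obtain ⟨C, hCt, -, hC⟩ := exists_surface_sweep_le ho hγ hr hch
  set A := frontier Ω ∩ Metric.closedBall x (r / 2) with hA
  have hAc : IsCompact A := (isCompact_closedBall x (r / 2)).inter_left isClosed_frontier
  set e := inward R with he
  have h2t : (2 : ℝ≥0∞) ^ (q - 1) ≠ ⊤ := ENNReal.rpow_ne_top_of_nonneg (by linarith) (by simp)
  -- The final coefficient of the gradient; it tends to zero with the sliding distance `d` precisely
  -- because `q - 1 > 0`.
  have hlim : Tendsto (fun d : ℝ => (2 : ℝ≥0∞) ^ (q - 1) * (ENNReal.ofReal d ^ (q - 1) * C))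
      (𝓝[>] 0) (𝓝 0) := by
    have h1 : Tendsto (fun h : ℝ => ENNReal.ofReal h) (𝓝[>] 0) (𝓝 0) := by
      have := ENNReal.continuous_ofReal.tendsto 0
      rw [ENNReal.ofReal_zero] at this
      exact this.mono_left nhdsWithin_le_nhds
    have h2 := (ENNReal.continuous_rpow_const (y := q - 1)).tendsto 0 |>.comp h1
    rw [ENNReal.zero_rpow_of_pos (by linarith)] at h2
    have h3 := ENNReal.Tendsto.const_mul (a := (2 : ℝ≥0∞) ^ (q - 1))
      (ENNReal.Tendsto.mul_const (b := C) h2 (Or.inr hCt)) (Or.inr h2t)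
    simpa using h3
  obtain ⟨d, hdε, hd0, hdr⟩ : ∃ d : ℝ, (2 : ℝ≥0∞) ^ (q - 1) * (ENNReal.ofReal d ^ (q - 1) * C) ≤ ε ∧
      0 < d ∧ d < r / 2 := by
    have e1 := hlim.eventually_le_const (pos_iff_ne_zero.2 hε)
    have e2 : ∀ᶠ h : ℝ in 𝓝[>] 0, h ∈ Ioo 0 (r / 2) := Ioo_mem_nhdsGT (by linarith)
    obtain ⟨h, h1, h2⟩ := (e1.and e2).exists
    exact ⟨h, h1, h2.1, h2.2⟩
  -- Averaging over sliding distances bounded away from zero keeps the swept set `K` compact inside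
  -- `Ω`.
  set I : Set ℝ := Icc (d / 2) d with hI
  have hmem : ∀ y ∈ A, ∀ t, 0 < t → t ≤ d → y + t • e ∈ Ω := fun y hy t ht htd =>
    add_smul_inward_mem ho hγ.continuous hch hy.1 hy.2 ht (htd.trans_lt hdr)
  set K : Set (Eucl m) := (fun w : Eucl m × ℝ => w.1 + w.2 • e) '' (A ×ˢ I) with hKdef
  have hKc : IsCompact K := (hAc.prod isCompact_Icc).image (by fun_prop)
  have hI0 : volume I = ENNReal.ofReal (d / 2) := by rw [hI, Real.volume_Icc]; congr 1; ring
  have hI1 : volume I ≠ 0 := by rw [hI0]; simp; linarith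
  have hI2 : volume I ≠ ⊤ := by rw [hI0]; simp
  refine ⟨K, (volume I)⁻¹ * (2 ^ (q - 1) * C), hKc, ?_, ?_, fun f hf => ?_⟩
  · rintro _ ⟨⟨y, t⟩, ⟨hy, ht⟩, rfl⟩
    exact hmem y hy t (by linarith [ht.1]) ht.2
  · exact ENNReal.mul_ne_top (ENNReal.inv_ne_top.2 hI1) (ENNReal.mul_ne_top h2t hCt)
  set F1 : Eucl m → ℝ≥0∞ := K.indicator fun z => ‖f z‖ₑ ^ q with hF1
  set F2 : Eucl m → ℝ≥0∞ := Ω.indicator fun z => ‖fderiv ℝ f z‖ₑ ^ q with hF2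
  have hF1m : Measurable F1 :=
    (hf.continuous.enorm.measurable.pow_const q).indicator hKc.measurableSet
  have hF2m : Measurable F2 :=
    ((hf.continuous_fderiv one_ne_zero).enorm.measurable.pow_const q).indicator ho.measurableSet
  have hsw : ∀ F : Eucl m → ℝ≥0∞, Measurable F →
      Measurable fun y : Eucl m => ∫⁻ t : ℝ, F (y + t • e) := fun F hF =>
    Measurable.lintegral_prod_right' (f := fun q : Eucl m × ℝ => F (q.1 + q.2 • e))
      (hF.comp (by fun_prop))
  have hpt : ∀ y ∈ A, volume I * ‖f y‖ₑ ^ q ≤ 2 ^ (q - 1) * ((∫⁻ t : ℝ, F1 (y + t • e)) +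
      volume I * (ENNReal.ofReal d ^ (q - 1) * ∫⁻ t : ℝ, F2 (y + t • e))) := by
    intro y hy
    have h1 : ∀ t ∈ I, ‖f y‖ₑ ^ q ≤ 2 ^ (q - 1) * (F1 (y + t • e) +
        ENNReal.ofReal d ^ (q - 1) * ∫⁻ t : ℝ, F2 (y + t • e)) := by
      intro t ht
      have ht0 : 0 ≤ t := by linarith [ht.1]
      have h2 := enorm_sub_rpow_le hf y e hq.le ht0
      have h3 : ∫⁻ s in Ioc 0 t, ‖fderiv ℝ f (y + s • e)‖ₑ ^ q * ‖e‖ₑ ^ q ≤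
          ∫⁻ t : ℝ, F2 (y + t • e) := by
        rw [← lintegral_indicator measurableSet_Ioc]
        refine lintegral_mono fun s => ?_
        by_cases hs : s ∈ Ioc 0 t
        · have : ‖e‖ₑ = 1 := by rw [← ofReal_norm, he, norm_inward, ENNReal.ofReal_one]
          rw [indicator_of_mem hs, hF2, indicator_of_mem (hmem y hy s hs.1 (hs.2.trans ht.2)), this,
            ENNReal.one_rpow, mul_one]
        · rw [indicator_of_notMem hs]; exact zero_le
      have h4 : F1 (y + t • e) = ‖f (y + t • e)‖ₑ ^ q :=
        indicator_of_mem (mem_image_of_mem _ (show (y, t) ∈ A ×ˢ I from ⟨hy, ht⟩)) _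
      calc ‖f y‖ₑ ^ q ≤ (‖f (y + t • e)‖ₑ + ‖f (y + t • e) - f y‖ₑ) ^ q := by
            gcongr
            calc ‖f y‖ₑ = ‖f (y + t • e) - (f (y + t • e) - f y)‖ₑ := by congr 1; ring
              _ ≤ _ := enorm_sub_le
        _ ≤ _ := ENNReal.rpow_add_le_mul_rpow_add_rpow _ _ hq.le
        _ ≤ _ := by
          rw [h4]
          gcongr
          refine h2.trans ?_
          gcongr
          exact ht.2
    have hm1 : Measurable fun t : ℝ => F1 (y + t • e) := hF1m.comp (by fun_prop)
    calc volume I * ‖f y‖ₑ ^ q = ∫⁻ t in I, ‖f y‖ₑ ^ q := by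
          rw [lintegral_const, Measure.restrict_apply_univ, mul_comm]
      _ ≤ ∫⁻ t in I, 2 ^ (q - 1) * (F1 (y + t • e) +
        ENNReal.ofReal d ^ (q - 1) * ∫⁻ t : ℝ, F2 (y + t • e)) :=
          setLIntegral_mono' measurableSet_Icc h1
      _ = 2 ^ (q - 1) * ((∫⁻ t in I, F1 (y + t • e)) +
          volume I * (ENNReal.ofReal d ^ (q - 1) * ∫⁻ t : ℝ, F2 (y + t • e))) := by
          rw [lintegral_const_mul _ (hm1.add_const _), lintegral_add_left hm1, lintegral_const,
            Measure.restrict_apply_univ, mul_comm (volume I)]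
      _ ≤ _ := by gcongr; exact Measure.restrict_le_self
  have hint : volume I * ∫⁻ y in A, ‖f y‖ₑ ^ q ∂(Measure.euclideanHausdorffMeasure m) ≤
      2 ^ (q - 1) * (C * (∫⁻ z in K, ‖f z‖ₑ ^ q) +
      volume I * (ENNReal.ofReal d ^ (q - 1) * (C * (∫⁻ z in Ω, ‖fderiv ℝ f z‖ₑ ^ q)))) := by
    have e1 := hC F1 hF1m
    have e2 := hC F2 hF2m
    rw [hF1, lintegral_indicator hKc.measurableSet] at e1
    rw [hF2, lintegral_indicator ho.measurableSet] at e2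
    calc _ = ∫⁻ y in A, volume I * ‖f y‖ₑ ^ q ∂(Measure.euclideanHausdorffMeasure m) :=
          (lintegral_const_mul' _ _ hI2).symm
      _ ≤ ∫⁻ y in A, (2 ^ (q - 1) * ((∫⁻ t : ℝ, F1 (y + t • e)) +
          volume I * (ENNReal.ofReal d ^ (q - 1) * ∫⁻ t : ℝ, F2 (y + t • e))))
          ∂(Measure.euclideanHausdorffMeasure m) := setLIntegral_mono' hAc.measurableSet hpt
      _ = 2 ^ (q - 1) * ((∫⁻ y in A, (∫⁻ t : ℝ, F1 (y + t • e))
            ∂(Measure.euclideanHausdorffMeasure m)) +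
          volume I * (ENNReal.ofReal d ^ (q - 1) * (∫⁻ y in A, (∫⁻ t : ℝ, F2 (y + t • e))
            ∂(Measure.euclideanHausdorffMeasure m)))) := by
          rw [lintegral_const_mul _ (by have := hsw _ hF1m; have := hsw _ hF2m; fun_prop),
            lintegral_add_left (hsw _ hF1m),
            lintegral_const_mul _ (by have := hsw _ hF2m; fun_prop),
            lintegral_const_mul _ (hsw _ hF2m)]
      _ ≤ _ := by gcongr
  calc _ = (volume I)⁻¹ * (volume I *
        ∫⁻ y in A, ‖f y‖ₑ ^ q ∂(Measure.euclideanHausdorffMeasure m)) := by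
        rw [← mul_assoc, ENNReal.inv_mul_cancel hI1 hI2, one_mul]
    _ ≤ (volume I)⁻¹ * (2 ^ (q - 1) * (C * (∫⁻ z in K, ‖f z‖ₑ ^ q) +
      volume I * (ENNReal.ofReal d ^ (q - 1) * (C * (∫⁻ z in Ω, ‖fderiv ℝ f z‖ₑ ^ q))))) := by gcongr
    _ = ((volume I)⁻¹ * volume I) * (2 ^ (q - 1) * (ENNReal.ofReal d ^ (q - 1) * C)) *
          (∫⁻ z in Ω, ‖fderiv ℝ f z‖ₑ ^ q) +
        (volume I)⁻¹ * (2 ^ (q - 1) * C) * ∫⁻ z in K, ‖f z‖ₑ ^ q := by ring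
    _ ≤ _ := by
      rw [ENNReal.inv_mul_cancel hI1 hI2, one_mul]
      gcongr

variable {Ω : Set (Eucl m)}

/-- The boundary of a bounded smooth domain is covered by finitely many graph charts. -/
lemma IsBoundedSmoothDomain.exists_finite_cover (hΩ : IsBoundedSmoothDomain Ω)
    {P : Set (Eucl m) → Prop} (hempty : P ∅) (hunion : ∀ A B, P A → P B → P (A ∪ B))
    (hmono : ∀ A B, A ⊆ B → P B → P A)
    (hchart : ∀ (x : Eucl m) (R : Eucl m ≃ₗᵢ[ℝ] Eucl m) (γ : EuclideanSpace ℝ (Fin m) → ℝ) (r : ℝ),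
      ContDiff ℝ ∞ γ → 0 < r →
      (∀ y ∈ Metric.ball x r, (y ∈ Ω ↔ γ (initCoords (R y)) < lastCoord (R y))) →
      P (frontier Ω ∩ Metric.closedBall x (r / 2))) : P (frontier Ω) := by
  have hc : IsCompact (frontier Ω) :=
    Metric.isCompact_of_isClosed_isBounded isClosed_frontier
      (hΩ.isBounded.closure.subset frontier_subset_closure)
  refine hc.induction_on hempty (fun s t hst ht => hmono _ _ hst ht) (fun s t hs ht => hunion _ _ hs ht) ?_
  intro x hx
  obtain ⟨R, γ, r, hγ, hr, hch⟩ := hΩ.smooth_boundary x hx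
  refine ⟨_, ?_, hchart x R γ r hγ hr hch⟩
  exact inter_mem_nhdsWithin _ (Metric.closedBall_mem_nhds x (by linarith))

lemma IsBoundedSmoothDomain.isFiniteMeasure_surfaceMeasure (hΩ : IsBoundedSmoothDomain Ω) :
    IsFiniteMeasure (surfaceMeasure Ω) := by
  refine ⟨?_⟩
  rw [Measure.restrict_apply_univ]
  refine hΩ.exists_finite_cover
    (P := fun A => (Measure.euclideanHausdorffMeasure m : Measure (Eucl m)) A < ⊤) (by simp)
    (fun A B hA hB => measure_union_lt_top hA hB) (fun A B hAB hB => (measure_mono hAB).trans_lt hB)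
    fun x R γ r hγ hr hch => ?_
  obtain ⟨-, -, h, -⟩ := exists_surface_sweep_le hΩ.isOpen hγ hr hch
  exact h.lt_top

/-- Compactness estimate for boundary values of `C^1` functions: up to an arbitrarily small multiple
of the gradient norm, they are controlled by finitely many averages. -/
theorem IsBoundedSmoothDomain.exists_lintegral_surface_le (hΩ : IsBoundedSmoothDomain Ω)
    {q : ℝ} (hq : 1 < q) {ε : ℝ≥0∞} (hε : ε ≠ 0) :
    ∃ (s : Finset (Eucl m × ℝ)) (C : ℝ≥0∞), C ≠ ⊤ ∧ (∀ b ∈ s, Metric.ball b.1 b.2 ⊆ Ω) ∧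
      ∀ f : Eucl m → ℝ, ContDiff ℝ 1 f →
        ∫⁻ y, ‖f y‖ₑ ^ q ∂(surfaceMeasure Ω) ≤
          ε * (∫⁻ x in Ω, ‖fderiv ℝ f x‖ₑ ^ q) + C * ballSum s q f := by
  classical
  revert ε
  refine hΩ.exists_finite_cover (P := fun A => ∀ {ε : ℝ≥0∞}, ε ≠ 0 →
    ∃ (s : Finset (Eucl m × ℝ)) (C : ℝ≥0∞), C ≠ ⊤ ∧ (∀ b ∈ s, Metric.ball b.1 b.2 ⊆ Ω) ∧
      ∀ f : Eucl m → ℝ, ContDiff ℝ 1 f →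
        ∫⁻ y in A, ‖f y‖ₑ ^ q ∂(Measure.euclideanHausdorffMeasure m) ≤
          ε * (∫⁻ x in Ω, ‖fderiv ℝ f x‖ₑ ^ q) + C * ballSum s q f) ?_ ?_ ?_ ?_
  · intro ε _
    exact ⟨∅, 0, by simp, by simp, fun f _ => by simp⟩
  · intro A B hA hB ε hε
    have hε2 : ε / 2 ≠ 0 := by simp [hε]
    obtain ⟨s, C, hC, hs, h1⟩ := hA hε2
    obtain ⟨s', C', hC', hs', h2⟩ := hB hε2
    refine ⟨s ∪ s', C + C', by simp [hC, hC'], ?_, fun f hf => ?_⟩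
    · intro b hb
      rcases Finset.mem_union.1 hb with hb | hb
      exacts [hs b hb, hs' b hb]
    · calc _ ≤ _ := lintegral_union_le _ _ _
        _ ≤ _ := add_le_add (h1 f hf) (h2 f hf)
        _ ≤ (ε / 2 * (∫⁻ x in Ω, ‖fderiv ℝ f x‖ₑ ^ q) + C * ballSum (s ∪ s') q f) +
            (ε / 2 * (∫⁻ x in Ω, ‖fderiv ℝ f x‖ₑ ^ q) + C' * ballSum (s ∪ s') q f) := by
          gcongr
          · exact ballSum_mono Finset.subset_union_left _ _
          · exact ballSum_mono Finset.subset_union_right _ _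
        _ = (ε / 2 + ε / 2) * (∫⁻ x in Ω, ‖fderiv ℝ f x‖ₑ ^ q) + (C + C') * ballSum (s ∪ s') q f := by
          ring
        _ = _ := by rw [ENNReal.add_halves]
  · intro A B hAB hB ε hε
    obtain ⟨s, C, hC, hs, h⟩ := hB hε
    exact ⟨s, C, hC, hs, fun f hf => (lintegral_mono_set hAB).trans (h f hf)⟩
  · intro x R γ r hγ hr hch ε hε
    have hε2 : ε / 2 ≠ 0 := by simp [hε]
    obtain ⟨K, C, hK, hKΩ, hC, h⟩ :=
      exists_lintegral_surface_chart_le hΩ.isOpen hγ hr hch hq hε2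
    -- The interior estimate is later multiplied by `C`, so its tolerance is `ε / 2` divided by `C +
    -- 1`; the added `1` avoids dividing by zero.
    have hε3 : ε / 2 / (C + 1) ≠ 0 := by
      simp [ENNReal.div_eq_zero_iff, hε, hC]
    obtain ⟨s, C', hC', hs, h'⟩ := exists_lintegral_compact_le hΩ.isOpen hK hKΩ hq.le hε3
    refine ⟨s, C * C', ENNReal.mul_ne_top hC hC', hs, fun f hf => (h f hf).trans ?_⟩
    calc _ ≤ ε / 2 * (∫⁻ x in Ω, ‖fderiv ℝ f x‖ₑ ^ q) + C * (ε / 2 / (C + 1) *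
          (∫⁻ x in Ω, ‖fderiv ℝ f x‖ₑ ^ q) + C' * ballSum s q f) := by gcongr; exact h' f hf
      _ = (ε / 2 + C * (ε / 2 / (C + 1))) * (∫⁻ x in Ω, ‖fderiv ℝ f x‖ₑ ^ q) +
          C * C' * ballSum s q f := by ring
      _ ≤ (ε / 2 + ε / 2) * (∫⁻ x in Ω, ‖fderiv ℝ f x‖ₑ ^ q) + C * C' * ballSum s q f := by
        gcongr
        calc C * (ε / 2 / (C + 1)) ≤ (C + 1) * (ε / 2 / (C + 1)) := by gcongr; exact le_self_add
          _ ≤ _ := ENNReal.mul_div_le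
      _ = _ := by rw [ENNReal.add_halves]

end TraceInequality

/-! ### Finite measures, continuous functions and classical gradients on the domain -/

section Basic

variable {m : ℕ} {Ω : Set (Eucl m)}

lemma IsBoundedSmoothDomain.isFiniteMeasure_interiorMeasure (hΩ : IsBoundedSmoothDomain Ω) :
    IsFiniteMeasure (interiorMeasure Ω) :=
  ⟨by rw [Measure.restrict_apply_univ]; exact hΩ.isBounded.measure_lt_top⟩

lemma IsBoundedSmoothDomain.isCompact_closure (hΩ : IsBoundedSmoothDomain Ω) :
    IsCompact (closure Ω) := hΩ.isBounded.isCompact_closure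

lemma IsBoundedSmoothDomain.exists_bound (hΩ : IsBoundedSmoothDomain Ω) {E : Type*}
    [NormedAddCommGroup E] {f : Eucl m → E} (hf : Continuous f) :
    ∃ C, 0 ≤ C ∧ ∀ x ∈ closure Ω, ‖f x‖ ≤ C := by
  obtain ⟨C, hC⟩ := hΩ.isCompact_closure.exists_bound_of_continuousOn hf.continuousOn
  exact ⟨max C 0, le_max_right _ _, fun x hx => (hC x hx).trans (le_max_left _ _)⟩

lemma IsBoundedSmoothDomain.ae_interior_closure (hΩ : IsBoundedSmoothDomain Ω) :
    ∀ᵐ x ∂(interiorMeasure Ω), x ∈ closure Ω :=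
  (ae_restrict_mem hΩ.isOpen.measurableSet).mono fun _ hx => subset_closure hx

lemma ae_surface_closure :
    ∀ᵐ x ∂(surfaceMeasure Ω), x ∈ closure Ω :=
  (ae_restrict_mem isClosed_frontier.measurableSet).mono fun _ hx => frontier_subset_closure hx

lemma IsBoundedSmoothDomain.memLp_interior (hΩ : IsBoundedSmoothDomain Ω) {E : Type*}
    [NormedAddCommGroup E] [SecondCountableTopology E] {f : Eucl m → E}
    (hf : Continuous f) (p : ℝ≥0∞) : MemLp f p (interiorMeasure Ω) := by
  have := hΩ.isFiniteMeasure_interiorMeasure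
  obtain ⟨C, -, hC⟩ := hΩ.exists_bound hf
  exact MemLp.of_bound hf.aestronglyMeasurable C (hΩ.ae_interior_closure.mono hC)

lemma IsBoundedSmoothDomain.memLp_surface (hΩ : IsBoundedSmoothDomain Ω) {f : Eucl m → ℝ}
    (hf : Continuous f) (p : ℝ≥0∞) : MemLp f p (surfaceMeasure Ω) := by
  have := hΩ.isFiniteMeasure_surfaceMeasure
  obtain ⟨C, -, hC⟩ := hΩ.exists_bound hf
  exact MemLp.of_bound hf.aestronglyMeasurable C (ae_surface_closure.mono hC)

lemma continuous_gradient {ψ : Eucl m → ℝ} (hψ : ContDiff ℝ 1 ψ) : Continuous (gradient ψ) :=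
  (InnerProductSpace.toDual ℝ (Eucl m)).symm.continuous.comp (hψ.continuous_fderiv one_ne_zero)

lemma norm_gradient (ψ : Eucl m → ℝ) (x : Eucl m) : ‖gradient ψ x‖ = ‖fderiv ℝ ψ x‖ :=
  (InnerProductSpace.toDual ℝ (Eucl m)).symm.norm_map _

lemma inner_gradient (ψ : Eucl m → ℝ) (x v : Eucl m) :
    inner ℝ (gradient ψ x) v = fderiv ℝ ψ x v := by
  simp [gradient, InnerProductSpace.toDual_symm_apply]

lemma gradient_add' {ψ χ : Eucl m → ℝ} (hψ : ContDiff ℝ 1 ψ) (hχ : ContDiff ℝ 1 χ) :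
    gradient (ψ + χ) = gradient ψ + gradient χ := by
  ext1 x
  simp only [gradient, Pi.add_apply]
  rw [fderiv_add (hψ.differentiable one_ne_zero x) (hχ.differentiable one_ne_zero x), map_add]

lemma gradient_smul' {ψ : Eucl m → ℝ} (hψ : ContDiff ℝ 1 ψ) (c : ℝ) :
    gradient (c • ψ) = c • gradient ψ := by
  ext1 x
  simp only [gradient, Pi.smul_apply]
  rw [fderiv_const_smul (hψ.differentiable one_ne_zero x), map_smul]

/-- The test function is supported in `Ω`, so both integrals extend to the whole space, where
integration by parts has no boundary term. -/
lemma isWeakGradient_gradient {ψ : Eucl m → ℝ} (hψ : ContDiff ℝ 1 ψ) :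
    IsWeakGradient Ω ψ (gradient ψ) := by
  intro ζ hζ hc hs v
  have hψd := hψ.continuous_fderiv one_ne_zero
  have hζd : Continuous fun x => fderiv ℝ ζ x v :=
    (hζ.continuous_fderiv (by simp)).clm_apply continuous_const
  have hdc : HasCompactSupport fun x => fderiv ℝ ζ x v := hc.fderiv_apply (𝕜 := ℝ) v
  have e1 : ∫ x, ψ x * fderiv ℝ ζ x v ∂(interiorMeasure Ω) = ∫ x, ψ x * fderiv ℝ ζ x v := by
    refine setIntegral_eq_integral_of_forall_compl_eq_zero fun x hx => ?_
    have : fderiv ℝ ζ x = 0 := by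
      by_contra h
      exact hx (hs (support_fderiv_subset ℝ h))
    simp [this]
  have e2 : ∫ x, inner ℝ (gradient ψ x) v * ζ x ∂(interiorMeasure Ω) =
      ∫ x, fderiv ℝ ψ x v * ζ x := by
    simp_rw [inner_gradient]
    refine setIntegral_eq_integral_of_forall_compl_eq_zero fun x hx => ?_
    have : ζ x = 0 := by
      by_contra h
      exact hx (hs (subset_tsupport _ h))
    simp [this]
  rw [e1, e2]
  refine integral_mul_fderiv_eq_neg_fderiv_mul_of_integrable ?_ ?_ ?_ ?_ ?_
  · exact ((hψd.clm_apply continuous_const).mul hζ.continuous).integrable_of_hasCompactSupport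
      hc.mul_left
  · exact (hψ.continuous.mul hζd).integrable_of_hasCompactSupport hdc.mul_left
  · exact (hψ.continuous.mul hζ.continuous).integrable_of_hasCompactSupport hc.mul_left
  · exact fun x _ => hψ.differentiable one_ne_zero x
  · exact fun x _ => hζ.differentiable (by simp) x

end Basic

/-! ### Norm, convergence and completeness of `W^{1,p}(Ω)` -/

section SobolevSpace

variable {m : ℕ} {Ω : Set (Eucl m)} {p : ℝ≥0∞} [Fact (1 ≤ p)]

lemma fn_add (u v : Sobolev Ω p) : fn (u + v) = fn u + fn v := rfl
lemma fn_smul (c : ℝ) (u : Sobolev Ω p) : fn (c • u) = c • fn u := rfl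
lemma fn_sub (u v : Sobolev Ω p) : fn (u - v) = fn u - fn v := rfl
lemma grad_add (u v : Sobolev Ω p) : grad (u + v) = grad u + grad v := rfl
lemma grad_smul (c : ℝ) (u : Sobolev Ω p) : grad (c • u) = c • grad u := rfl
lemma grad_sub (u v : Sobolev Ω p) : grad (u - v) = grad u - grad v := rfl

lemma continuous_fn : Continuous (fn : Sobolev Ω p → _) :=
  (WithLp.prod_continuous_ofLp p _ _).fst.comp continuous_subtype_val

lemma continuous_grad : Continuous (grad : Sobolev Ω p → _) :=
  (WithLp.prod_continuous_ofLp p _ _).snd.comp continuous_subtype_val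

lemma tendsto_sobolev_iff {ι : Type*} {l : Filter ι} {us : ι → Sobolev Ω p} {u : Sobolev Ω p} :
    Tendsto us l (𝓝 u) ↔ Tendsto (fun i => fn (us i)) l (𝓝 (fn u)) ∧
      Tendsto (fun i => grad (us i)) l (𝓝 (grad u)) := by
  refine ⟨fun h => ⟨(continuous_fn.tendsto u).comp h, (continuous_grad.tendsto u).comp h⟩, ?_⟩
  rintro ⟨h1, h2⟩
  rw [tendsto_subtype_rng]
  exact ((WithLp.prod_continuous_toLp p _ _).tendsto (fn u, grad u)).comp (h1.prodMk_nhds h2)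

lemma norm_rpow_lp {E : Type*} [NormedAddCommGroup E] {α : Type*} [MeasurableSpace α]
    {μ : Measure α} (hp_top : p ≠ ⊤) (f : Lp E p μ) :
    ‖f‖ ^ p.toReal = ∫ x, ‖f x‖ ^ p.toReal ∂μ := by
  have hp0 : p ≠ 0 := (zero_lt_one.trans_le Fact.out).ne'
  have hp1 : 0 < p.toReal := ENNReal.toReal_pos hp0 hp_top
  rw [Lp.norm_def, (Lp.memLp f).eLpNorm_eq_integral_rpow_norm hp0 hp_top,
    ENNReal.toReal_ofReal (by positivity), ← Real.rpow_mul (by positivity),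
    inv_mul_cancel₀ hp1.ne', Real.rpow_one]

lemma integrable_norm_rpow_lp {E : Type*} [NormedAddCommGroup E] {α : Type*} [MeasurableSpace α]
    {μ : Measure α} (hp_top : p ≠ ⊤) (f : Lp E p μ) :
    Integrable (fun x => ‖f x‖ ^ p.toReal) μ :=
  (Lp.memLp f).integrable_norm_rpow (zero_lt_one.trans_le Fact.out).ne' hp_top

lemma norm_rpow_sobolev (hp_top : p ≠ ⊤) (u : Sobolev Ω p) :
    ‖u‖ ^ p.toReal = ‖fn u‖ ^ p.toReal + ‖grad u‖ ^ p.toReal := by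
  have hp1 : 0 < p.toReal :=
    ENNReal.toReal_pos (zero_lt_one.trans_le Fact.out).ne' hp_top
  rw [Submodule.coe_norm, WithLp.prod_norm_eq_add hp1, ← Real.rpow_mul (by positivity),
    one_div, inv_mul_cancel₀ hp1.ne', Real.rpow_one]
  rfl

lemma norm_rpow_sobolev_eq_integral (hp_top : p ≠ ⊤) (u : Sobolev Ω p) :
    ‖u‖ ^ p.toReal =
      ∫ x, (‖grad u x‖ ^ p.toReal + |fn u x| ^ p.toReal) ∂(interiorMeasure Ω) := by
  simp_rw [← Real.norm_eq_abs]
  rw [integral_add (integrable_norm_rpow_lp hp_top _) (integrable_norm_rpow_lp hp_top (fn u)),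
    norm_rpow_sobolev hp_top, norm_rpow_lp hp_top, norm_rpow_lp hp_top, add_comm]

lemma norm_grad_le (hp_top : p ≠ ⊤) (u : Sobolev Ω p) : ‖grad u‖ ≤ ‖u‖ := by
  have hp1 : 0 < p.toReal :=
    ENNReal.toReal_pos (zero_lt_one.trans_le Fact.out).ne' hp_top
  rw [← Real.rpow_le_rpow_iff (norm_nonneg _) (norm_nonneg _) hp1, norm_rpow_sobolev hp_top]
  linarith [Real.rpow_nonneg (norm_nonneg (fn u)) p.toReal]

/-- Integration against a bounded function is a continuous functional on `L^p` of a finite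
measure. -/
lemma exists_clm_integral_lp_mul {α : Type*} [MeasurableSpace α] {μ : Measure α}
    [IsFiniteMeasure μ] {h : α → ℝ} (hh : AEStronglyMeasurable h μ) {C : ℝ}
    (hC : ∀ᵐ x ∂μ, ‖h x‖ ≤ C) :
    ∃ T : Lp ℝ p μ →L[ℝ] ℝ, ∀ f : Lp ℝ p μ, T f = ∫ x, f x * h x ∂μ := by
  have hint : ∀ f : Lp ℝ p μ, Integrable (fun x => f x * h x) μ := fun f =>
    ((Lp.memLp f).integrable Fact.out).mul_bdd hh hC
  let T : Lp ℝ p μ →ₗ[ℝ] ℝ :=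
    { toFun := fun f => ∫ x, f x * h x ∂μ
      map_add' := fun f g => by
        rw [← integral_add (hint f) (hint g)]
        refine integral_congr_ae ?_
        filter_upwards [Lp.coeFn_add f g] with x hx
        rw [hx, Pi.add_apply, add_mul]
      map_smul' := fun c f => by
        rw [RingHom.id_apply, smul_eq_mul, ← integral_const_mul]
        refine integral_congr_ae ?_
        filter_upwards [Lp.coeFn_smul c f] with x hx
        rw [hx, Pi.smul_apply, smul_eq_mul, mul_assoc] }
  have hb : ∀ f, ‖T f‖ ≤ (max C 0 * (μ univ ^ (1 / (1 : ℝ≥0∞).toReal - 1 / p.toReal)).toReal) * ‖f‖ := by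
    intro f
    have hfin : μ univ ^ (1 / (1 : ℝ≥0∞).toReal - 1 / p.toReal) ≠ ⊤ := by
      refine ENNReal.rpow_ne_top_of_nonneg ?_ (measure_ne_top _ _)
      by_cases hp_top : p = ⊤
      · simp [hp_top]
      · have : 1 ≤ p.toReal := by
          rw [← ENNReal.toReal_one]; exact ENNReal.toReal_mono hp_top Fact.out
        simp only [ENNReal.toReal_one, div_one, one_div]
        linarith [inv_le_one_of_one_le₀ this]
    have h1 := eLpNorm_le_eLpNorm_mul_rpow_measure_univ (p := 1) (q := p) (μ := μ) (f := f) Fact.out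
      (Lp.aestronglyMeasurable f)
    have h2 : ∫ x, ‖f x‖ ∂μ ≤ (μ univ ^ (1 / (1 : ℝ≥0∞).toReal - 1 / p.toReal)).toReal * ‖f‖ := by
      rw [integral_norm_eq_lintegral_enorm (Lp.aestronglyMeasurable f), Lp.norm_def, mul_comm,
        ← ENNReal.toReal_mul, ← eLpNorm_one_eq_lintegral_enorm]
      exact ENNReal.toReal_mono (ENNReal.mul_ne_top (Lp.eLpNorm_ne_top f) hfin) h1
    calc ‖T f‖ ≤ ∫ x, ‖f x * h x‖ ∂μ := norm_integral_le_integral_norm _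
      _ ≤ ∫ x, max C 0 * ‖f x‖ ∂μ := by
        refine integral_mono_ae (hint f).norm
          ((((Lp.memLp f).integrable Fact.out).norm).const_mul _) ?_
        filter_upwards [hC] with x hx
        rw [norm_mul, mul_comm]
        gcongr
        exact hx.trans (le_max_left _ _)
      _ = max C 0 * ∫ x, ‖f x‖ ∂μ := integral_const_mul _ _
      _ ≤ max C 0 * ((μ univ ^ (1 / (1 : ℝ≥0∞).toReal - 1 / p.toReal)).toReal * ‖f‖) := by gcongr
      _ = _ := by ring
  exact ⟨T.mkContinuous _ hb, fun f => rfl⟩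

lemma continuous_integral_lp_mul {α : Type*} [MeasurableSpace α] {μ : Measure α}
    [IsFiniteMeasure μ] {h : α → ℝ} (hh : AEStronglyMeasurable h μ) {C : ℝ}
    (hC : ∀ᵐ x ∂μ, ‖h x‖ ≤ C) : Continuous fun f : Lp ℝ p μ => ∫ x, f x * h x ∂μ := by
  obtain ⟨T, hT⟩ := exists_clm_integral_lp_mul (p := p) hh hC
  exact T.continuous.congr hT

/-- Each test function and direction imposes equality of two continuous functionals of `(u, G)`, and
the space is the intersection of these closed conditions. -/
lemma IsBoundedSmoothDomain.isClosed_sobolev (hΩ : IsBoundedSmoothDomain Ω) :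
    IsClosed (Sobolev Ω p : Set (WithLp p (Lp ℝ p (interiorMeasure Ω) ×
      Lp (Eucl m) p (interiorMeasure Ω)))) := by
  have := hΩ.isFiniteMeasure_interiorMeasure
  have : (Sobolev Ω p : Set (WithLp p (Lp ℝ p (interiorMeasure Ω) ×
      Lp (Eucl m) p (interiorMeasure Ω)))) = ⋂ (ψ : Eucl m → ℝ) (_ : ContDiff ℝ ∞ ψ)
      (_ : HasCompactSupport ψ) (_ : tsupport ψ ⊆ Ω) (v : Eucl m),
      {w | ∫ x, w.fst x * fderiv ℝ ψ x v ∂(interiorMeasure Ω) =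
        -∫ x, inner ℝ (w.snd x) v * ψ x ∂(interiorMeasure Ω)} := by
    ext w
    simp only [mem_iInter, mem_ofPred_eq]
    rfl
  rw [this]
  refine isClosed_iInter fun ψ => isClosed_iInter fun hψ => isClosed_iInter fun hc =>
    isClosed_iInter fun hs => isClosed_iInter fun v => ?_
  have hd : Continuous fun x => fderiv ℝ ψ x v :=
    (hψ.continuous_fderiv (by simp)).clm_apply continuous_const
  obtain ⟨C, -, hC⟩ := hΩ.exists_bound hd
  obtain ⟨C', -, hC'⟩ := hΩ.exists_bound hψ.continuous
  refine isClosed_eq ?_ ?_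
  · exact (continuous_integral_lp_mul hd.aestronglyMeasurable
      (hΩ.ae_interior_closure.mono hC)).comp (WithLp.prod_continuous_ofLp p _ _).fst
  · have h1 := continuous_integral_lp_mul (p := p) (μ := interiorMeasure Ω)
      hψ.continuous.aestronglyMeasurable (hΩ.ae_interior_closure.mono hC')
    have h2 : Continuous fun G : Lp (Eucl m) p (interiorMeasure Ω) =>
        (innerSL ℝ v).compLp G :=
      ((innerSL ℝ v).compLpL p (interiorMeasure Ω)).continuous
    refine ((h1.comp h2).comp (WithLp.prod_continuous_ofLp p _ _).snd).neg.congr fun w => ?_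
    congr 1
    refine integral_congr_ae ?_
    filter_upwards [(innerSL ℝ v).coeFn_compLp w.snd] with x hx
    simp only [WithLp.ofLp_snd] at hx ⊢
    rw [hx, innerSL_apply_apply, real_inner_comm]

lemma IsBoundedSmoothDomain.completeSpace_sobolev (hΩ : IsBoundedSmoothDomain Ω) :
    CompleteSpace (Sobolev Ω p) :=
  (hΩ.isClosed_sobolev).completeSpace_coe

end SobolevSpace

/-! ### Traces as the closure of the graph of restriction -/

section Trace

variable {m : ℕ} {Ω : Set (Eucl m)} {p : ℝ≥0∞} [Fact (1 ≤ p)]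

/-- The space of `C^1` functions on `ℝ^(m+1)`. -/
def C1 (m : ℕ) : Submodule ℝ (Eucl m → ℝ) where
  carrier := {ψ | ContDiff ℝ 1 ψ}
  zero_mem' := (contDiff_const : ContDiff ℝ 1 fun _ : Eucl m => (0 : ℝ))
  add_mem' := fun {ψ χ} (h1 : ContDiff ℝ 1 ψ) (h2 : ContDiff ℝ 1 χ) => h1.add h2
  smul_mem' := fun c ψ (h : ContDiff ℝ 1 ψ) => h.const_smul c

lemma C1.contDiff (ψ : C1 m) : ContDiff ℝ 1 ψ.1 := ψ.2

/-- A `C^1` function as an element of `W^{1,p}(Ω)` together with its boundary values. -/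
def c1Pair (hΩ : IsBoundedSmoothDomain Ω) (p : ℝ≥0∞) [Fact (1 ≤ p)] :
    C1 m →ₗ[ℝ] Sobolev Ω p × Lp ℝ p (surfaceMeasure Ω) where
  toFun ψ := (⟨WithLp.toLp p ((hΩ.memLp_interior (C1.contDiff ψ).continuous p).toLp _,
      (hΩ.memLp_interior (continuous_gradient (C1.contDiff ψ)) p).toLp _), by
        intro ζ hζ hc hs v
        have h := isWeakGradient_gradient (Ω := Ω) (C1.contDiff ψ) ζ hζ hc hs v
        refine Eq.trans (integral_congr_ae ?_) (h.trans (congrArg _ (integral_congr_ae ?_)))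
        · filter_upwards [(hΩ.memLp_interior (C1.contDiff ψ).continuous p).coeFn_toLp] with x hx
          rw [WithLp.toLp_fst, hx]
        · filter_upwards [(hΩ.memLp_interior (continuous_gradient (C1.contDiff ψ)) p).coeFn_toLp] with x hx
          rw [WithLp.toLp_snd, hx]⟩,
    (hΩ.memLp_surface (C1.contDiff ψ).continuous p).toLp _)
  map_add' ψ χ := by
    refine Prod.ext (Subtype.ext ?_) rfl
    apply (WithLp.equiv p _).injective
    refine Prod.ext rfl ?_
    refine (MemLp.toLp_congr (hΩ.memLp_interior
      (continuous_gradient (C1.contDiff (ψ + χ))) p) _ ?_).trans (MemLp.toLp_add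
      (hΩ.memLp_interior (continuous_gradient (C1.contDiff ψ)) p) (hΩ.memLp_interior (continuous_gradient (C1.contDiff χ)) p))
    exact Eventually.of_forall fun x => congrFun (gradient_add' (C1.contDiff ψ) (C1.contDiff χ)) x
  map_smul' c ψ := by
    refine Prod.ext (Subtype.ext ?_) rfl
    apply (WithLp.equiv p _).injective
    refine Prod.ext rfl ?_
    refine (MemLp.toLp_congr (hΩ.memLp_interior
      (continuous_gradient (C1.contDiff (c • ψ))) p) _ ?_).trans (MemLp.toLp_const_smul c
      (hΩ.memLp_interior (continuous_gradient (C1.contDiff ψ)) p))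
    exact Eventually.of_forall fun x => congrFun (gradient_smul' (C1.contDiff ψ) c) x

lemma fn_c1Pair (hΩ : IsBoundedSmoothDomain Ω) (ψ : C1 m) :
    fn (c1Pair hΩ p ψ).1 = (hΩ.memLp_interior (C1.contDiff ψ).continuous p).toLp _ := rfl

lemma grad_c1Pair (hΩ : IsBoundedSmoothDomain Ω) (ψ : C1 m) :
    grad (c1Pair hΩ p ψ).1 = (hΩ.memLp_interior (continuous_gradient (C1.contDiff ψ)) p).toLp _ := rfl

lemma c1Pair_snd (hΩ : IsBoundedSmoothDomain Ω) (ψ : C1 m) :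
    (c1Pair hΩ p ψ).2 = (hΩ.memLp_surface (C1.contDiff ψ).continuous p).toLp _ := rfl

lemma fn_c1Pair_ae (hΩ : IsBoundedSmoothDomain Ω) (ψ : C1 m) :
    fn (c1Pair hΩ p ψ).1 =ᵐ[interiorMeasure Ω] ψ.1 :=
  (hΩ.memLp_interior (C1.contDiff ψ).continuous p).coeFn_toLp

lemma grad_c1Pair_ae (hΩ : IsBoundedSmoothDomain Ω) (ψ : C1 m) :
    grad (c1Pair hΩ p ψ).1 =ᵐ[interiorMeasure Ω] gradient ψ.1 :=
  (hΩ.memLp_interior (continuous_gradient (C1.contDiff ψ)) p).coeFn_toLp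

lemma c1Pair_snd_ae (hΩ : IsBoundedSmoothDomain Ω) (ψ : C1 m) :
    (c1Pair hΩ p ψ).2 =ᵐ[surfaceMeasure Ω] ψ.1 :=
  (hΩ.memLp_surface (C1.contDiff ψ).continuous p).coeFn_toLp

lemma tendsto_toLp_iff {α E ι : Type*} [MeasurableSpace α] [NormedAddCommGroup E] {μ : Measure α}
    {l : Filter ι} {f : ι → α → E} (hf : ∀ i, MemLp (f i) p μ) (g : Lp E p μ) :
    Tendsto (fun i => (hf i).toLp (f i)) l (𝓝 g) ↔
      Tendsto (fun i => eLpNorm (fun x => f i x - g x) p μ) l (𝓝 0) := by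
  rw [Lp.tendsto_Lp_iff_tendsto_eLpNorm']
  refine tendsto_congr fun i => eLpNorm_congr_ae ?_
  filter_upwards [(hf i).coeFn_toLp] with x hx
  rw [Pi.sub_apply, hx]

/-- The graph of the trace operator. -/
def traceGraph (hΩ : IsBoundedSmoothDomain Ω) (p : ℝ≥0∞) [Fact (1 ≤ p)] :
    Submodule ℝ (Sobolev Ω p × Lp ℝ p (surfaceMeasure Ω)) :=
  (LinearMap.range (c1Pair hΩ p)).topologicalClosure

lemma hasTrace_iff_exists (hΩ : IsBoundedSmoothDomain Ω) {u : Sobolev Ω p}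
    {g : Lp ℝ p (surfaceMeasure Ω)} :
    HasTrace u g ↔ ∃ ψ : ℕ → C1 m, Tendsto (fun k => c1Pair hΩ p (ψ k)) atTop (𝓝 (u, g)) := by
  have key : ∀ ψ : ℕ → C1 m, Tendsto (fun k => c1Pair hΩ p (ψ k)) atTop (𝓝 (u, g)) ↔
    Tendsto (fun k => eLpNorm (fun x => (ψ k).1 x - fn u x) p (interiorMeasure Ω)) atTop (𝓝 0) ∧
    Tendsto (fun k => eLpNorm (fun x => gradient (ψ k).1 x - grad u x) p (interiorMeasure Ω))
      atTop (𝓝 0) ∧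
    Tendsto (fun k => eLpNorm (fun x => (ψ k).1 x - g x) p (surfaceMeasure Ω)) atTop (𝓝 0) := by
    intro ψ
    rw [nhds_prod_eq, tendsto_prod_iff', tendsto_sobolev_iff]
    simp only [fn_c1Pair, grad_c1Pair, c1Pair_snd]
    rw [tendsto_toLp_iff (fun k => hΩ.memLp_interior (C1.contDiff (ψ k)).continuous p),
      tendsto_toLp_iff (fun k => hΩ.memLp_interior (continuous_gradient (C1.contDiff (ψ k))) p),
      tendsto_toLp_iff (fun k => hΩ.memLp_surface (C1.contDiff (ψ k)).continuous p), and_assoc]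
  constructor
  · rintro ⟨ψ, hψ, h⟩
    exact ⟨fun k => ⟨ψ k, hψ k⟩, (key _).2 h⟩
  · rintro ⟨ψ, h⟩
    exact ⟨fun k => (ψ k).1, fun k => (ψ k).2, (key _).1 h⟩

/-- Closure in a metric space is sequential. As a closed subspace, the graph gives linearity and
closedness of the trace relation at once, before it is known to be single-valued. -/
lemma hasTrace_iff_mem (hΩ : IsBoundedSmoothDomain Ω) {u : Sobolev Ω p}
    {g : Lp ℝ p (surfaceMeasure Ω)} : HasTrace u g ↔ (u, g) ∈ traceGraph hΩ p := by
  rw [hasTrace_iff_exists hΩ, traceGraph, ← SetLike.mem_coe, Submodule.topologicalClosure_coe,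
    mem_closure_iff_seq_limit]
  constructor
  · rintro ⟨ψ, h⟩
    exact ⟨_, fun k => ⟨ψ k, rfl⟩, h⟩
  · rintro ⟨s, hs, h⟩
    choose ψ hψ using hs
    exact ⟨ψ, by simpa only [hψ] using h⟩

lemma HasTrace.add (hΩ : IsBoundedSmoothDomain Ω) {u v : Sobolev Ω p}
    {g h : Lp ℝ p (surfaceMeasure Ω)} (hu : HasTrace u g) (hv : HasTrace v h) :
    HasTrace (u + v) (g + h) := by
  rw [hasTrace_iff_mem hΩ] at *
  exact (traceGraph hΩ p).add_mem hu hv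

lemma HasTrace.sub (hΩ : IsBoundedSmoothDomain Ω) {u v : Sobolev Ω p}
    {g h : Lp ℝ p (surfaceMeasure Ω)} (hu : HasTrace u g) (hv : HasTrace v h) :
    HasTrace (u - v) (g - h) := by
  rw [hasTrace_iff_mem hΩ] at *
  exact (traceGraph hΩ p).sub_mem hu hv

lemma HasTrace.smul (hΩ : IsBoundedSmoothDomain Ω) {u : Sobolev Ω p}
    {g : Lp ℝ p (surfaceMeasure Ω)} (c : ℝ) (hu : HasTrace u g) :
    HasTrace (c • u) (c • g) := by
  rw [hasTrace_iff_mem hΩ] at *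
  exact (traceGraph hΩ p).smul_mem c hu

lemma HasTrace.of_tendsto (hΩ : IsBoundedSmoothDomain Ω) {us : ℕ → Sobolev Ω p} {u : Sobolev Ω p}
    {gs : ℕ → Lp ℝ p (surfaceMeasure Ω)} {g : Lp ℝ p (surfaceMeasure Ω)}
    (h : ∀ j, HasTrace (us j) (gs j)) (hu : Tendsto us atTop (𝓝 u))
    (hg : Tendsto gs atTop (𝓝 g)) : HasTrace u g := by
  simp only [hasTrace_iff_mem hΩ] at *
  exact (Submodule.isClosed_topologicalClosure _).mem_of_tendsto (hu.prodMk_nhds hg)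
    (Eventually.of_forall h)

end Trace

/-! ### Uniqueness of traces and compactness of the trace operator -/

section TraceCompactness

lemma one_lt_toReal {p : ℝ≥0∞} (hp : 1 < p) (hp_top : p ≠ ⊤) : 1 < p.toReal := by
  rw [← ENNReal.toReal_one]
  exact (ENNReal.toReal_lt_toReal ENNReal.one_ne_top hp_top).2 hp

variable {m : ℕ} {Ω : Set (Eucl m)} {p : ℝ≥0∞} [Fact (1 ≤ p)]

lemma enorm_rpow_lp {E : Type*} [NormedAddCommGroup E] {α : Type*} [MeasurableSpace α]
    {μ : Measure α} (hp_top : p ≠ ⊤) (f : Lp E p μ) :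
    ‖f‖ₑ ^ p.toReal = ∫⁻ x, ‖f x‖ₑ ^ p.toReal ∂μ := by
  have hp0 : p ≠ 0 := (zero_lt_one.trans_le Fact.out).ne'
  have hp1 : 0 < p.toReal := ENNReal.toReal_pos hp0 hp_top
  rw [Lp.enorm_def, eLpNorm_eq_lintegral_rpow_enorm_toReal hp0 hp_top, ← ENNReal.rpow_mul, one_div,
    inv_mul_cancel₀ hp1.ne', ENNReal.rpow_one]

/-- The integral over a ball contained in `Ω`, as a functional on `W^{1,p}(Ω)`. -/
lemma IsBoundedSmoothDomain.exists_clm_ball (hΩ : IsBoundedSmoothDomain Ω) (p : ℝ≥0∞)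
    [Fact (1 ≤ p)] {z : Eucl m} {h : ℝ} (hb : Metric.ball z h ⊆ Ω) :
    ∃ T : Sobolev Ω p →L[ℝ] ℝ, ∀ u, T u = ∫ y in Metric.ball z h, fn u y := by
  have := hΩ.isFiniteMeasure_interiorMeasure
  obtain ⟨T, hT⟩ := exists_clm_integral_lp_mul (p := p) (μ := interiorMeasure Ω)
    (h := (Metric.ball z h).indicator fun _ => 1) (C := 1)
    ((measurable_const.indicator measurableSet_ball).aestronglyMeasurable)
    (Eventually.of_forall fun x => by
      by_cases hx : x ∈ Metric.ball z h <;> simp [hx])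
  refine ⟨T.comp (⟨{ toFun := fn, map_add' := fn_add, map_smul' := fn_smul }, continuous_fn⟩ :
    Sobolev Ω p →L[ℝ] Lp ℝ p (interiorMeasure Ω)), fun u => ?_⟩
  change T (fn u) = _
  rw [hT]
  have e : ∀ x, fn u x * (Metric.ball z h).indicator (fun _ => (1 : ℝ)) x =
      (Metric.ball z h).indicator (fn u) x := by
    intro x
    by_cases hx : x ∈ Metric.ball z h <;> simp [hx]
  simp_rw [e]
  rw [integral_indicator measurableSet_ball, Measure.restrict_restrict measurableSet_ball,
    inter_eq_left.2 hb]

/-- Compactness estimate for traces: up to an arbitrarily small multiple of the Sobolev norm, the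
trace is controlled by finitely many continuous functionals. -/
theorem IsBoundedSmoothDomain.exists_norm_trace_le (hΩ : IsBoundedSmoothDomain Ω) (hp : 1 < p)
    (hp_top : p ≠ ⊤) {ε : ℝ} (hε : 0 < ε) :
    ∃ (N : ℕ) (T : Fin N → (Sobolev Ω p →L[ℝ] ℝ)) (C : ℝ), 0 ≤ C ∧
      ∀ (u : Sobolev Ω p) (g : Lp ℝ p (surfaceMeasure Ω)), HasTrace u g →
        ‖g‖ ^ p.toReal ≤ ε * ‖u‖ ^ p.toReal + C * ∑ i, ‖T i u‖ ^ p.toReal := by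
  have hq := one_lt_toReal hp hp_top
  obtain ⟨s, C, hC, hs, h⟩ := hΩ.exists_lintegral_surface_le hq (ε := ENNReal.ofReal ε)
    (by simpa using hε)
  choose! T hT using fun (b : Eucl m × ℝ) (hb : Metric.ball b.1 b.2 ⊆ Ω) =>
    hΩ.exists_clm_ball p hb
  have key : ∀ (u : Sobolev Ω p) (g : Lp ℝ p (surfaceMeasure Ω)), HasTrace u g →
      ‖g‖ₑ ^ p.toReal ≤ ENNReal.ofReal ε * ‖grad u‖ₑ ^ p.toReal +
        C * ∑ b ∈ s, ‖T b u‖ₑ ^ p.toReal := by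
    intro u g hug
    obtain ⟨ψ, hψ⟩ := (hasTrace_iff_exists hΩ).1 hug
    -- Both sides are continuous in the pair `(u, g)`, so the inequality passes from the
    -- approximating `C^1` functions to the limit.
    have c1 : Continuous fun w : Sobolev Ω p × Lp ℝ p (surfaceMeasure Ω) => ‖w.2‖ₑ ^ p.toReal :=
      ENNReal.continuous_rpow_const.comp continuous_snd.enorm
    have c2 : Continuous fun w : Sobolev Ω p × Lp ℝ p (surfaceMeasure Ω) =>
        ENNReal.ofReal ε * ‖grad w.1‖ₑ ^ p.toReal + C * ∑ b ∈ s, ‖T b w.1‖ₑ ^ p.toReal := by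
      refine Continuous.add ?_ ?_
      · exact (ENNReal.continuous_const_mul ENNReal.ofReal_ne_top).comp
          (ENNReal.continuous_rpow_const.comp (continuous_grad.comp continuous_fst).enorm)
      · refine (ENNReal.continuous_const_mul hC).comp (continuous_finsetSum _ fun b _ => ?_)
        exact ENNReal.continuous_rpow_const.comp ((T b).continuous.comp continuous_fst).enorm
    have t1 := (c1.tendsto (u, g)).comp hψ
    have t2 := (c2.tendsto (u, g)).comp hψ
    refine le_of_tendsto_of_tendsto' t1 t2 fun k => ?_
    have h1 := h (ψ k).1 (C1.contDiff (ψ k))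
    have e1 : ‖(c1Pair hΩ p (ψ k)).2‖ₑ ^ p.toReal =
        ∫⁻ y, ‖(ψ k).1 y‖ₑ ^ p.toReal ∂(surfaceMeasure Ω) := by
      rw [enorm_rpow_lp hp_top]
      refine lintegral_congr_ae ?_
      filter_upwards [c1Pair_snd_ae (p := p) hΩ (ψ k)] with x hx
      rw [hx]
    have e2 : ‖grad (c1Pair hΩ p (ψ k)).1‖ₑ ^ p.toReal =
        ∫⁻ x in Ω, ‖fderiv ℝ (ψ k).1 x‖ₑ ^ p.toReal := by
      rw [enorm_rpow_lp hp_top]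
      refine lintegral_congr_ae ?_
      filter_upwards [grad_c1Pair_ae (p := p) hΩ (ψ k)] with x hx
      rw [hx, ← ofReal_norm, norm_gradient, ofReal_norm]
    have e3 : ∑ b ∈ s, ‖T b (c1Pair hΩ p (ψ k)).1‖ₑ ^ p.toReal = ballSum s p.toReal (ψ k).1 := by
      refine Finset.sum_congr rfl fun b hb => ?_
      rw [hT b (hs b hb)]
      congr 2
      refine integral_congr_ae ?_
      exact ae_restrict_of_ae_restrict_of_subset (hs b hb) (fn_c1Pair_ae (p := p) hΩ (ψ k))
    simp only [Function.comp_apply]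
    rw [e1, e2, e3]
    exact h1
  refine ⟨s.card, fun i => T (s.equivFin.symm i).1, C.toReal, ENNReal.toReal_nonneg,
    fun u g hug => ?_⟩
  have h1 := key u g hug
  have hq0 : 0 ≤ p.toReal := by linarith
  have e : ∑ i, ‖T (s.equivFin.symm i).1 u‖ ^ p.toReal = ∑ b ∈ s, ‖T b u‖ ^ p.toReal := by
    rw [Equiv.sum_comp s.equivFin.symm (fun b => ‖T b.1 u‖ ^ p.toReal),
      Finset.sum_coe_sort s (fun b => ‖T b u‖ ^ p.toReal)]
  rw [e]
  have h2 : ‖g‖ ^ p.toReal ≤ ε * ‖grad u‖ ^ p.toReal + C.toReal * ∑ b ∈ s, ‖T b u‖ ^ p.toReal := by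
    rw [← ENNReal.ofReal_le_ofReal_iff (by positivity), ENNReal.ofReal_add (by positivity)
      (by positivity), ENNReal.ofReal_mul hε.le, ENNReal.ofReal_mul ENNReal.toReal_nonneg,
      ENNReal.ofReal_toReal hC, ENNReal.ofReal_sum_of_nonneg (fun _ _ => by positivity)]
    simp_rw [← ENNReal.ofReal_rpow_of_nonneg (norm_nonneg _) hq0, ofReal_norm]
    exact h1
  refine h2.trans ?_
  have := norm_grad_le hp_top u
  gcongr

/-- `g - h` is a trace of the zero function, on which the right-hand side of the trace estimate
vanishes. -/
lemma HasTrace.unique (hΩ : IsBoundedSmoothDomain Ω) (hp : 1 < p) (hp_top : p ≠ ⊤)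
    {u : Sobolev Ω p} {g h : Lp ℝ p (surfaceMeasure Ω)} (hg : HasTrace u g) (hh : HasTrace u h) :
    g = h := by
  have hq0 : p.toReal ≠ 0 := by linarith [one_lt_toReal hp hp_top]
  obtain ⟨N, T, C, hC, hT⟩ := hΩ.exists_norm_trace_le hp hp_top zero_lt_one
  have h1 := hT _ _ (hg.sub hΩ hh)
  simp only [sub_self, norm_zero, map_zero, Real.zero_rpow hq0, Finset.sum_const_zero, mul_zero,
    add_zero] at h1
  have h2 : ‖g - h‖ = 0 := by
    by_contra hne
    have : 0 < ‖g - h‖ := lt_of_le_of_ne (norm_nonneg _) (Ne.symm hne)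
    exact absurd h1 (not_le.2 (Real.rpow_pos_of_pos this _))
  exact sub_eq_zero.1 (norm_eq_zero.1 h2)

/-- The trace operator is compact. -/
theorem HasTrace.exists_subseq_tendsto (hΩ : IsBoundedSmoothDomain Ω) (hp : 1 < p)
    (hp_top : p ≠ ⊤) {us : ℕ → Sobolev Ω p} {gs : ℕ → Lp ℝ p (surfaceMeasure Ω)}
    (h : ∀ j, HasTrace (us j) (gs j)) {M : ℝ} (hM : ∀ j, ‖us j‖ ≤ M) :
    ∃ (g : Lp ℝ p (surfaceMeasure Ω)) (κ : ℕ → ℕ), StrictMono κ ∧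
      Tendsto (fun j => gs (κ j)) atTop (𝓝 g) := by
  have hq := one_lt_toReal hp hp_top
  have hM0 : 0 ≤ M := (norm_nonneg _).trans (hM 0)
  choose N T C hC hT using fun n : ℕ => hΩ.exists_norm_trace_le hp hp_top
    (ε := 1 / ((n : ℝ) + 1)) (by positivity)
  let X : ℕ → (Σ n, Fin (N n)) → ℝ := fun j i => T i.1 i.2 (us j)
  -- The functionals for all tolerances `1 / (n + 1)` form a countable family; compactness of the
  -- product of intervals yields one subsequence along which all of them converge, replacing a
  -- diagonal argument.
  obtain ⟨a, -, κ, hκ, hlim⟩ := (isCompact_univ_pi fun i : Σ n, Fin (N n) =>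
      isCompact_Icc (a := -(‖T i.1 i.2‖ * M)) (b := ‖T i.1 i.2‖ * M)).tendsto_subseq (x := X)
    (fun j i _ => abs_le.1 (((T i.1 i.2).le_opNorm _).trans (by gcongr; exact hM j)))
  rw [tendsto_pi_nhds] at hlim
  have hcauchy : CauchySeq fun j => gs (κ j) := by
    rw [cauchySeq_iff_tendsto_dist_atTop_0, Metric.tendsto_nhds]
    intro η hη
    -- The tolerance is chosen so that `1 / (n + 1)` times `(2 * M) ^ p` stays below `η ^ p / 2`; `2
    -- * M` bounds the norm of a difference.
    obtain ⟨n, hn⟩ := exists_nat_one_div_lt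
      (show 0 < η ^ p.toReal / 2 / ((2 * M) ^ p.toReal + 1) by positivity)
    have h1 : Tendsto (fun w : ℕ × ℕ => C n * ∑ i, ‖T n i (us (κ w.1) - us (κ w.2))‖ ^ p.toReal)
        atTop (𝓝 0) := by
      have h2 : ∀ i, Tendsto (fun w : ℕ × ℕ => ‖T n i (us (κ w.1) - us (κ w.2))‖ ^ p.toReal)
          atTop (𝓝 0) := by
        intro i
        have h3 : Tendsto (fun w : ℕ × ℕ => T n i (us (κ w.1) - us (κ w.2))) atTop (𝓝 0) := by
          have h4 := hlim ⟨n, i⟩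
          rw [← sub_self (a ⟨n, i⟩), ← prod_atTop_atTop_eq]
          simp_rw [map_sub]
          exact (h4.comp tendsto_fst).sub (h4.comp tendsto_snd)
        have h5 := (h3.norm).rpow_const (p := p.toReal) (Or.inr (by linarith))
        rwa [norm_zero, Real.zero_rpow (by linarith)] at h5
      simpa using (tendsto_finsetSum Finset.univ fun i _ => h2 i).const_mul (C n)
    filter_upwards [h1.eventually_lt_const (show 0 < η ^ p.toReal / 2 by positivity)] with w hw
    rw [dist_zero_right, Real.norm_of_nonneg dist_nonneg, dist_eq_norm,
      ← Real.rpow_lt_rpow_iff (norm_nonneg _) hη.le (show 0 < p.toReal by linarith)]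
    have h6 := hT n _ _ ((h (κ w.1)).sub hΩ (h (κ w.2)))
    have h7 : ‖us (κ w.1) - us (κ w.2)‖ ^ p.toReal ≤ (2 * M) ^ p.toReal := by
      gcongr
      exact (norm_sub_le _ _).trans (by linarith [hM (κ w.1), hM (κ w.2)])
    have h8 : 1 / ((n : ℝ) + 1) * ‖us (κ w.1) - us (κ w.2)‖ ^ p.toReal ≤ η ^ p.toReal / 2 := by
      rw [lt_div_iff₀ (by positivity)] at hn
      refine le_trans ?_ hn.le
      gcongr
      linarith
    linarith
  obtain ⟨g, hg⟩ := cauchySeq_tendsto_of_complete hcauchy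
  exact ⟨g, κ, hκ, hg⟩

end TraceCompactness

/-! ### Pointwise inequalities by homogeneity and compactness -/

section HomogeneousEstimates

/-- Comparison of continuous functions that are homogeneous of degree `q` on a
finite-dimensional space. -/
lemma exists_le_of_homogeneous {W : Type*} [NormedAddCommGroup W] [NormedSpace ℝ W]
    [ProperSpace W] {q : ℝ} (hq : 0 < q) {X Y : W → ℝ} (hX : Continuous X) (hY : Continuous Y)
    (hXh : ∀ t : ℝ, 0 ≤ t → ∀ z, X (t • z) = t ^ q * X z)
    (hYh : ∀ t : ℝ, 0 ≤ t → ∀ z, Y (t • z) = t ^ q * Y z)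
    (hY0 : ∀ z, 0 ≤ Y z) (hXY : ∀ z, Y z = 0 → X z ≤ 0) {η : ℝ} (hη : 0 < η) :
    ∃ C, 0 ≤ C ∧ ∀ z, X z ≤ η * ‖z‖ ^ q + C * Y z := by
  have hc : IsCompact (Metric.sphere (0 : W) 1 ∩ {z | η ≤ X z}) :=
    (isCompact_sphere _ _).inter_right (isClosed_le continuous_const hX)
  obtain ⟨C, hC0, hC⟩ : ∃ C, 0 ≤ C ∧ ∀ z ∈ Metric.sphere (0 : W) 1, X z ≤ η + C * Y z := by
    obtain ⟨B, hB⟩ := hc.exists_bound_of_continuousOn hX.continuousOn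
    rcases (Metric.sphere (0 : W) 1 ∩ {z | η ≤ X z}).eq_empty_or_nonempty with he | hne
    · refine ⟨0, le_rfl, fun z hz => ?_⟩
      by_contra hcon
      have : z ∈ Metric.sphere (0 : W) 1 ∩ {z | η ≤ X z} :=
        ⟨hz, show η ≤ X z by simp only [zero_mul, add_zero, not_le] at hcon; exact hcon.le⟩
      rw [he] at this
      exact this
    -- On the compact part of the sphere where `X ≥ η > 0`, the function `Y` cannot vanish, so it
    -- has a positive minimum and a large multiple of it dominates `X`. Elsewhere on the sphere `η`
    -- alone suffices.
    · obtain ⟨z₀, hz₀, hmin⟩ := hc.exists_isMinOn hne hY.continuousOn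
      have hpos : 0 < Y z₀ := by
        refine lt_of_le_of_ne (hY0 _) fun h => ?_
        have h1 := hXY z₀ h.symm
        have h2 : η ≤ X z₀ := hz₀.2
        linarith
      refine ⟨|B| / Y z₀, by positivity, fun z hz => ?_⟩
      by_cases hzX : η ≤ X z
      · have h1 : Y z₀ ≤ Y z := hmin ⟨hz, hzX⟩
        have h2 : X z ≤ |B| := ((Real.le_norm_self _).trans (hB z ⟨hz, hzX⟩)).trans (le_abs_self B)
        have h3 : |B| ≤ |B| / Y z₀ * Y z := by
          rw [div_mul_eq_mul_div, le_div_iff₀ hpos]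
          gcongr
        linarith
      · have := mul_nonneg (div_nonneg (abs_nonneg B) hpos.le) (hY0 z)
        linarith [not_le.1 hzX]
  refine ⟨C, hC0, fun z => ?_⟩
  rcases eq_or_ne z 0 with rfl | hz
  · have h1 := hXh 0 le_rfl 0
    have h2 := hYh 0 le_rfl 0
    rw [Real.zero_rpow hq.ne', zero_mul, smul_zero] at h1 h2
    simp [h1, h2, Real.zero_rpow hq.ne']
  · have hn : 0 < ‖z‖ := norm_pos_iff.2 hz
    have hs : ‖z‖⁻¹ • z ∈ Metric.sphere (0 : W) 1 := by
      rw [mem_sphere_zero_iff_norm, norm_smul, norm_inv, norm_norm, inv_mul_cancel₀ hn.ne']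
    have hzz : ‖z‖ • (‖z‖⁻¹ • z) = z := smul_inv_smul₀ hn.ne' z
    have h1 := hXh ‖z‖ hn.le (‖z‖⁻¹ • z)
    have h2 := hYh ‖z‖ hn.le (‖z‖⁻¹ • z)
    rw [hzz] at h1 h2
    rw [h1, h2]
    have := mul_le_mul_of_nonneg_left (hC _ hs) (Real.rpow_nonneg hn.le q)
    linarith

variable {E : Type*} [NormedAddCommGroup E] [NormedSpace ℝ E] {q : ℝ}

lemma norm_prod_rpow_le {E : Type*} [NormedAddCommGroup E] (q : ℝ) (z : E × E) : ‖z‖ ^ q ≤ ‖z.1‖ ^ q + ‖z.2‖ ^ q := by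
  rw [Prod.norm_def]
  rcases max_choice ‖z.1‖ ‖z.2‖ with h | h <;> rw [h]
  · linarith [Real.rpow_nonneg (norm_nonneg z.2) q]
  · linarith [Real.rpow_nonneg (norm_nonneg z.1) q]

lemma norm_smul_rpow {t : ℝ} (ht : 0 ≤ t) (x : E) : ‖t • x‖ ^ q = t ^ q * ‖x‖ ^ q := by
  rw [norm_smul, Real.norm_of_nonneg ht, Real.mul_rpow ht (norm_nonneg _)]

lemma continuous_norm_rpow {E : Type*} [NormedAddCommGroup E] (hq : 0 ≤ q) : Continuous fun x : E => ‖x‖ ^ q :=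
  continuous_norm.rpow_const fun _ => Or.inr hq

/-- Both sides are homogeneous of degree `q` in `(a, b)`, and the difference of powers vanishes on
the diagonal. Integrated, this gives continuity of `g ↦ |g|^p` without dominated convergence. -/
lemma exists_abs_rpow_sub_le [ProperSpace E] (hq : 0 < q) {η : ℝ} (hη : 0 < η) :
    ∃ C, 0 ≤ C ∧ ∀ a b : E, |‖a‖ ^ q - ‖b‖ ^ q| ≤ η * (‖a‖ ^ q + ‖b‖ ^ q) + C * ‖a - b‖ ^ q := by
  obtain ⟨C, hC, h⟩ := exists_le_of_homogeneous (W := E × E) hq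
    (X := fun z => |‖z.1‖ ^ q - ‖z.2‖ ^ q|) (Y := fun z => ‖z.1 - z.2‖ ^ q)
    (((continuous_norm_rpow hq.le).comp continuous_fst).sub
      ((continuous_norm_rpow hq.le).comp continuous_snd)).abs
    ((continuous_norm_rpow hq.le).comp (continuous_fst.sub continuous_snd))
    (fun t ht z => by
      simp only [Prod.smul_fst, Prod.smul_snd]
      rw [norm_smul_rpow ht, norm_smul_rpow ht, ← mul_sub, abs_mul,
        abs_of_nonneg (Real.rpow_nonneg ht q)])
    (fun t ht z => by
      simp only [Prod.smul_fst, Prod.smul_snd]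
      rw [← smul_sub, norm_smul_rpow ht])
    (fun z => Real.rpow_nonneg (norm_nonneg _) _)
    (fun z hz => by
      rw [Real.rpow_eq_zero (norm_nonneg _) hq.ne', norm_eq_zero, sub_eq_zero] at hz
      simp [hz]) hη
  refine ⟨C, hC, fun a b => (h (a, b)).trans ?_⟩
  gcongr
  exact norm_prod_rpow_le q (a, b)

/-- Strict convexity of the `q`-th power of the norm. -/
lemma norm_rpow_strictConvex [StrictConvexSpace ℝ E] (hq : 1 < q) {a b : E} (hab : a ≠ b)
    {s t : ℝ} (hs : 0 < s) (ht : 0 < t) (hst : s + t = 1) :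
    ‖s • a + t • b‖ ^ q < s * ‖a‖ ^ q + t * ‖b‖ ^ q := by
  have hq0 : 0 < q := by linarith
  have htri : ‖s • a + t • b‖ ≤ s * ‖a‖ + t * ‖b‖ := by
    refine (norm_add_le _ _).trans ?_
    rw [norm_smul, norm_smul, Real.norm_of_nonneg hs.le, Real.norm_of_nonneg ht.le]
  -- Strictness comes from strict convexity of the space when the norms agree, and from strict
  -- convexity of `t ↦ t ^ q` when they differ.
  by_cases hn : ‖a‖ = ‖b‖
  · have h1 : ‖s • a + t • b‖ < ‖a‖ := by
      refine norm_combo_lt_of_ne le_rfl hn.symm.le hab hs ht hst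
    calc ‖s • a + t • b‖ ^ q < ‖a‖ ^ q := Real.rpow_lt_rpow (norm_nonneg _) h1 hq0
      _ = s * ‖a‖ ^ q + t * ‖b‖ ^ q := by rw [← hn, ← add_mul, hst, one_mul]
  · calc ‖s • a + t • b‖ ^ q ≤ (s * ‖a‖ + t * ‖b‖) ^ q :=
          Real.rpow_le_rpow (norm_nonneg _) htri hq0.le
      _ < _ := (strictConvexOn_rpow hq).2 (norm_nonneg a) (norm_nonneg b) hn hs ht hst

lemma norm_rpow_convex (hq : 1 ≤ q) (a b : E) {s t : ℝ} (hs : 0 ≤ s) (ht : 0 ≤ t)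
    (hst : s + t = 1) : ‖s • a + t • b‖ ^ q ≤ s * ‖a‖ ^ q + t * ‖b‖ ^ q := by
  have htri : ‖s • a + t • b‖ ≤ s * ‖a‖ + t * ‖b‖ := by
    refine (norm_add_le _ _).trans ?_
    rw [norm_smul, norm_smul, Real.norm_of_nonneg hs, Real.norm_of_nonneg ht]
  calc ‖s • a + t • b‖ ^ q ≤ (s * ‖a‖ + t * ‖b‖) ^ q :=
        Real.rpow_le_rpow (norm_nonneg _) htri (by linarith)
    _ ≤ _ := (convexOn_rpow hq).2 (norm_nonneg a) (norm_nonneg b) hs ht hst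

/-- Uniform convexity of the `q`-th power of the norm. -/
lemma exists_norm_sub_rpow_le [ProperSpace E] [StrictConvexSpace ℝ E] (hq : 1 < q) {η : ℝ}
    (hη : 0 < η) :
    ∃ C, 0 ≤ C ∧ ∀ a b : E, ‖a - b‖ ^ q ≤ η * (‖a‖ ^ q + ‖b‖ ^ q) +
      C * ((‖a‖ ^ q + ‖b‖ ^ q) / 2 - ‖(2⁻¹ : ℝ) • (a + b)‖ ^ q) := by
  have hq0 : 0 < q := by linarith
  obtain ⟨C, hC, h⟩ := exists_le_of_homogeneous (W := E × E) hq0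
    (X := fun z => ‖z.1 - z.2‖ ^ q)
    (Y := fun z => (‖z.1‖ ^ q + ‖z.2‖ ^ q) / 2 - ‖(2⁻¹ : ℝ) • (z.1 + z.2)‖ ^ q)
    ((continuous_norm_rpow hq0.le).comp (continuous_fst.sub continuous_snd))
    (((((continuous_norm_rpow hq0.le).comp continuous_fst).add
      ((continuous_norm_rpow hq0.le).comp continuous_snd)).div_const 2).sub
      ((continuous_norm_rpow hq0.le).comp ((continuous_fst.add continuous_snd).const_smul _)))
    (fun t ht z => by
      simp only [Prod.smul_fst, Prod.smul_snd]
      rw [← smul_sub, norm_smul_rpow ht])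
    (fun t ht z => by
      simp only [Prod.smul_fst, Prod.smul_snd]
      rw [← smul_add, smul_comm, norm_smul_rpow ht, norm_smul_rpow ht, norm_smul_rpow ht]
      ring)
    (fun z => by
      have := norm_rpow_convex hq.le z.1 z.2 (s := 2⁻¹) (t := 2⁻¹) (by norm_num) (by norm_num)
        (by norm_num)
      rw [← smul_add] at this
      linarith)
    -- The convexity deficit vanishes only on the diagonal, where `‖a - b‖` vanishes too. This
    -- replaces Clarkson's inequalities and treats all `1 < q` alike.
    (fun z hz => by
      by_cases hzz : z.1 = z.2
      · simp [hzz, Real.zero_rpow hq0.ne']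
      · have := norm_rpow_strictConvex hq hzz (s := 2⁻¹) (t := 2⁻¹) (by norm_num) (by norm_num)
          (by norm_num)
        rw [← smul_add] at this
        linarith) hη
  refine ⟨C, hC, fun a b => (h (a, b)).trans ?_⟩
  gcongr
  exact norm_prod_rpow_le q (a, b)

end HomogeneousEstimates

/-! ### Integrated versions: continuity of `|g|^p` and uniform convexity of `L^p` -/

section LpEstimates

variable {α : Type*} [MeasurableSpace α] {μ : Measure α} {p : ℝ≥0∞} [Fact (1 ≤ p)]

/-- The function `|g|^p ∈ L^1` associated with `g ∈ L^p`. -/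
def absPow (hp_top : p ≠ ⊤) (g : Lp ℝ p μ) : Lp ℝ 1 μ :=
  (memLp_one_iff_integrable.2 (integrable_norm_rpow_lp hp_top g)).toLp _

lemma absPow_ae (hp_top : p ≠ ⊤) (g : Lp ℝ p μ) :
    absPow hp_top g =ᵐ[μ] fun x => ‖g x‖ ^ p.toReal :=
  (memLp_one_iff_integrable.2 (integrable_norm_rpow_lp hp_top g)).coeFn_toLp

lemma norm_absPow (hp_top : p ≠ ⊤) (g : Lp ℝ p μ) : ‖absPow hp_top g‖ = ‖g‖ ^ p.toReal := by
  rw [L1.norm_eq_integral_norm, norm_rpow_lp hp_top]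
  refine integral_congr_ae ?_
  filter_upwards [absPow_ae hp_top g] with x hx
  rw [hx, Real.norm_of_nonneg (by positivity)]

lemma norm_sub_rpow_eq_integral {E : Type*} [NormedAddCommGroup E] (hp_top : p ≠ ⊤)
    (f g : Lp E p μ) : ‖f - g‖ ^ p.toReal = ∫ x, ‖f x - g x‖ ^ p.toReal ∂μ := by
  rw [norm_rpow_lp hp_top]
  refine integral_congr_ae ?_
  filter_upwards [Lp.coeFn_sub f g] with x hx
  rw [hx, Pi.sub_apply]

lemma integrable_norm_sub_rpow {E : Type*} [NormedAddCommGroup E] (hp_top : p ≠ ⊤)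
    (f g : Lp E p μ) : Integrable (fun x => ‖f x - g x‖ ^ p.toReal) μ := by
  refine (integrable_norm_rpow_lp hp_top (f - g)).congr ?_
  filter_upwards [Lp.coeFn_sub f g] with x hx
  rw [hx, Pi.sub_apply]

lemma toReal_pos_of_one_le (hp_top : p ≠ ⊤) : 0 < p.toReal :=
  ENNReal.toReal_pos (zero_lt_one.trans_le Fact.out).ne' hp_top

lemma continuous_absPow (hp_top : p ≠ ⊤) : Continuous (absPow (μ := μ) hp_top) := by
  have hq := toReal_pos_of_one_le hp_top
  rw [continuous_iff_continuousAt]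
  intro g
  rw [ContinuousAt, tendsto_iff_norm_sub_tendsto_zero, Metric.tendsto_nhds]
  intro δ hδ
  -- With this `η` the first error term at `f = g`, which is `2 η ‖g‖ ^ p`, is below `δ`; the `+ 1`
  -- covers `g = 0`.
  obtain ⟨C, hC, h⟩ := exists_abs_rpow_sub_le (E := ℝ) hq
    (η := δ / 2 / (2 * ‖g‖ ^ p.toReal + 1)) (by positivity)
  set η := δ / 2 / (2 * ‖g‖ ^ p.toReal + 1) with hη
  have hlim : Tendsto (fun f : Lp ℝ p μ => η * (‖f‖ ^ p.toReal + ‖g‖ ^ p.toReal) +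
      C * ‖f - g‖ ^ p.toReal) (𝓝 g) (𝓝 (η * (‖g‖ ^ p.toReal + ‖g‖ ^ p.toReal) +
      C * ‖g - g‖ ^ p.toReal)) := by
    refine Continuous.tendsto ?_ g
    have h1 := continuous_norm_rpow (E := Lp ℝ p μ) hq.le
    exact (continuous_const.mul (h1.add continuous_const)).add
      (continuous_const.mul (h1.comp (continuous_id.sub continuous_const)))
  have hlt : η * (‖g‖ ^ p.toReal + ‖g‖ ^ p.toReal) + C * ‖g - g‖ ^ p.toReal < δ := by
    rw [sub_self, norm_zero, Real.zero_rpow hq.ne', mul_zero, add_zero, hη, ← two_mul]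
    have hg := Real.rpow_nonneg (norm_nonneg g) p.toReal
    rw [div_mul_eq_mul_div, div_lt_iff₀ (by positivity)]
    nlinarith
  filter_upwards [hlim.eventually_lt_const hlt] with f hf
  rw [dist_zero_right, norm_norm]
  refine lt_of_le_of_lt ?_ hf
  rw [L1.norm_eq_integral_norm]
  have i1 := integrable_norm_rpow_lp hp_top f
  have i2 := integrable_norm_rpow_lp hp_top g
  have i12 : Integrable (fun x => ‖f x‖ ^ p.toReal + ‖g x‖ ^ p.toReal) μ := i1.add i2
  have i3 := integrable_norm_sub_rpow hp_top f g
  calc ∫ x, ‖(absPow hp_top f - absPow hp_top g) x‖ ∂μ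
      = ∫ x, |‖f x‖ ^ p.toReal - ‖g x‖ ^ p.toReal| ∂μ := by
        refine integral_congr_ae ?_
        filter_upwards [absPow_ae hp_top f, absPow_ae hp_top g,
          Lp.coeFn_sub (absPow hp_top f) (absPow hp_top g)] with x h1 h2 h3
        rw [h3, Pi.sub_apply, h1, h2, Real.norm_eq_abs]
    _ ≤ ∫ x, (η * (‖f x‖ ^ p.toReal + ‖g x‖ ^ p.toReal) + C * ‖f x - g x‖ ^ p.toReal) ∂μ := by
        exact integral_mono (i1.sub i2).abs ((i12.const_mul η).add (i3.const_mul C)) fun x => h _ _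
    _ = _ := by
        rw [integral_add (i12.const_mul η) (i3.const_mul C), integral_const_mul,
          integral_const_mul, integral_add i1 i2, norm_rpow_lp hp_top, norm_rpow_lp hp_top,
          norm_sub_rpow_eq_integral hp_top]

/-- Uniform convexity of the `p`-th power of the `L^p` norm. -/
lemma exists_norm_sub_rpow_lp_le {E : Type*} [NormedAddCommGroup E] [NormedSpace ℝ E]
    [ProperSpace E] [StrictConvexSpace ℝ E] (hp : 1 < p) (hp_top : p ≠ ⊤) {η : ℝ} (hη : 0 < η) :
    ∃ C, 0 ≤ C ∧ ∀ f g : Lp E p μ, ‖f - g‖ ^ p.toReal ≤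
      η * (‖f‖ ^ p.toReal + ‖g‖ ^ p.toReal) +
      C * ((‖f‖ ^ p.toReal + ‖g‖ ^ p.toReal) / 2 - ‖(2⁻¹ : ℝ) • (f + g)‖ ^ p.toReal) := by
  obtain ⟨C, hC, h⟩ := exists_norm_sub_rpow_le (E := E) (one_lt_toReal hp hp_top) hη
  refine ⟨C, hC, fun f g => ?_⟩
  have i1 := integrable_norm_rpow_lp hp_top f
  have i2 := integrable_norm_rpow_lp hp_top g
  have i12 : Integrable (fun x => ‖f x‖ ^ p.toReal + ‖g x‖ ^ p.toReal) μ := i1.add i2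
  have e3 : (fun x => ‖((2⁻¹ : ℝ) • (f + g)) x‖ ^ p.toReal) =ᵐ[μ]
      fun x => ‖(2⁻¹ : ℝ) • (f x + g x)‖ ^ p.toReal := by
    filter_upwards [Lp.coeFn_smul (2⁻¹ : ℝ) (f + g), Lp.coeFn_add f g] with x h1 h2
    rw [h1, Pi.smul_apply, h2, Pi.add_apply]
  have i3 : Integrable (fun x => ‖(2⁻¹ : ℝ) • (f x + g x)‖ ^ p.toReal) μ :=
    (integrable_norm_rpow_lp hp_top _).congr e3
  have e4 : ‖(2⁻¹ : ℝ) • (f + g)‖ ^ p.toReal =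
      ∫ x, ‖(2⁻¹ : ℝ) • (f x + g x)‖ ^ p.toReal ∂μ := by
    rw [norm_rpow_lp hp_top]; exact integral_congr_ae e3
  have i4 : Integrable (fun x => (‖f x‖ ^ p.toReal + ‖g x‖ ^ p.toReal) / 2 -
      ‖(2⁻¹ : ℝ) • (f x + g x)‖ ^ p.toReal) μ := (i12.div_const 2).sub i3
  calc ‖f - g‖ ^ p.toReal = ∫ x, ‖f x - g x‖ ^ p.toReal ∂μ := norm_sub_rpow_eq_integral hp_top _ _
    _ ≤ ∫ x, (η * (‖f x‖ ^ p.toReal + ‖g x‖ ^ p.toReal) +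
        C * ((‖f x‖ ^ p.toReal + ‖g x‖ ^ p.toReal) / 2 -
          ‖(2⁻¹ : ℝ) • (f x + g x)‖ ^ p.toReal)) ∂μ :=
      integral_mono (integrable_norm_sub_rpow hp_top f g)
        ((i12.const_mul η).add (i4.const_mul C)) fun x => h _ _
    _ = _ := by
      rw [integral_add (i12.const_mul η) (i4.const_mul C), integral_const_mul,
        integral_const_mul, integral_add i1 i2,
        integral_sub (f := fun x => (‖f x‖ ^ p.toReal + ‖g x‖ ^ p.toReal) / 2)
          (i12.div_const 2) i3, integral_div, integral_add i1 i2, e4,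
        norm_rpow_lp hp_top f, norm_rpow_lp hp_top g]

lemma lp_deficit_nonneg {E : Type*} [NormedAddCommGroup E] [NormedSpace ℝ E] {q : ℝ} (hq : 1 ≤ q)
    (f g : E) : 0 ≤ (‖f‖ ^ q + ‖g‖ ^ q) / 2 - ‖(2⁻¹ : ℝ) • (f + g)‖ ^ q := by
  have := norm_rpow_convex hq f g (s := 2⁻¹) (t := 2⁻¹) (by norm_num) (by norm_num) (by norm_num)
  rw [← smul_add] at this
  linarith

end LpEstimates

/-! ### The boundary term, continuity of the eigenvalue, convergence of minimizers -/

section Energy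

variable {m : ℕ} {Ω : Set (Eucl m)} {p : ℝ≥0∞} [Fact (1 ≤ p)]

/-- Uniform convexity of the Sobolev norm. -/
lemma exists_norm_sub_rpow_sobolev_le (hp : 1 < p) (hp_top : p ≠ ⊤) {η : ℝ} (hη : 0 < η) :
    ∃ C, 0 ≤ C ∧ ∀ u v : Sobolev Ω p, ‖u - v‖ ^ p.toReal ≤
      η * (‖u‖ ^ p.toReal + ‖v‖ ^ p.toReal) +
      C * ((‖u‖ ^ p.toReal + ‖v‖ ^ p.toReal) / 2 - ‖(2⁻¹ : ℝ) • (u + v)‖ ^ p.toReal) := by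
  obtain ⟨C₁, hC₁, h₁⟩ := exists_norm_sub_rpow_lp_le (E := ℝ) (μ := interiorMeasure Ω) hp hp_top hη
  obtain ⟨C₂, hC₂, h₂⟩ := exists_norm_sub_rpow_lp_le (E := Eucl m) (μ := interiorMeasure Ω)
    hp hp_top hη
  refine ⟨max C₁ C₂, hC₁.trans (le_max_left _ _), fun u v => ?_⟩
  have hq := (one_lt_toReal hp hp_top).le
  -- Nonnegativity of the two deficits allows both constants to be enlarged to their maximum.
  have d1 := lp_deficit_nonneg hq (fn u) (fn v)
  have d2 := lp_deficit_nonneg hq (grad u) (grad v)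
  have e1 := (h₁ (fn u) (fn v)).trans
    (add_le_add_right (mul_le_mul_of_nonneg_right (le_max_left C₁ C₂) d1) _)
  have e2 := (h₂ (grad u) (grad v)).trans
    (add_le_add_right (mul_le_mul_of_nonneg_right (le_max_right C₁ C₂) d2) _)
  simp only [norm_rpow_sobolev hp_top, fn_sub, grad_sub, fn_smul, grad_smul, fn_add, grad_add]
  linarith

/-- The boundary part of the energy. -/
def bdryTerm (φ : Lp ℝ ∞ (surfaceMeasure Ω)) (g : Lp ℝ p (surfaceMeasure Ω)) : ℝ :=
  ∫ x, φ x * |g x| ^ p.toReal ∂(surfaceMeasure Ω)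

lemma energy_eq (hp_top : p ≠ ⊤) (σ : ℝ) (φ : Lp ℝ ∞ (surfaceMeasure Ω)) (u : Sobolev Ω p)
    (g : Lp ℝ p (surfaceMeasure Ω)) :
    energy σ φ u g = ‖u‖ ^ p.toReal + σ * bdryTerm φ g := by
  rw [energy, norm_rpow_sobolev_eq_integral hp_top, bdryTerm]

/-- The functional on `L^1(∂Ω)` defined by an element of `L^∞(∂Ω)`. -/
lemma IsBoundedSmoothDomain.exists_clm_pairing (hΩ : IsBoundedSmoothDomain Ω)
    (φ : Lp ℝ ∞ (surfaceMeasure Ω)) :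
    ∃ T : Lp ℝ 1 (surfaceMeasure Ω) →L[ℝ] ℝ, ∀ f, T f = ∫ x, φ x * f x ∂(surfaceMeasure Ω) := by
  have := hΩ.isFiniteMeasure_surfaceMeasure
  have hb : ∀ᵐ x ∂(surfaceMeasure Ω), ‖φ x‖ ≤ ‖φ‖ := by
    filter_upwards [ae_le_eLpNormEssSup (f := φ) (μ := surfaceMeasure Ω)] with x hx
    rw [Lp.norm_def, eLpNorm_exponent_top, ← toReal_enorm]
    refine ENNReal.toReal_mono ?_ hx
    rw [← eLpNorm_exponent_top]
    exact Lp.eLpNorm_ne_top φ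
  obtain ⟨T, hT⟩ := exists_clm_integral_lp_mul (p := 1) (Lp.aestronglyMeasurable φ) hb
  exact ⟨T, fun f => (hT f).trans (integral_congr_ae (Eventually.of_forall fun x => mul_comm _ _))⟩

lemma bdryTerm_eq (hp_top : p ≠ ⊤) (φ : Lp ℝ ∞ (surfaceMeasure Ω))
    (g : Lp ℝ p (surfaceMeasure Ω)) :
    bdryTerm φ g = ∫ x, φ x * absPow hp_top g x ∂(surfaceMeasure Ω) := by
  refine integral_congr_ae ?_
  filter_upwards [absPow_ae hp_top g] with x hx
  rw [hx, Real.norm_eq_abs]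

lemma continuous_bdryTerm (hΩ : IsBoundedSmoothDomain Ω) (hp_top : p ≠ ⊤)
    (φ : Lp ℝ ∞ (surfaceMeasure Ω)) :
    Continuous fun g : Lp ℝ p (surfaceMeasure Ω) => bdryTerm φ g := by
  obtain ⟨T, hT⟩ := hΩ.exists_clm_pairing φ
  refine (T.continuous.comp (continuous_absPow hp_top)).congr fun g => ?_
  rw [Function.comp_apply, hT, bdryTerm_eq hp_top]

/-- Convergent real sequences are bounded, so the weights are pointwise bounded functionals on the
Banach space `L^1(∂Ω)` and Banach–Steinhaus applies. -/
lemma WeakStarTendsto.exists_bound (hΩ : IsBoundedSmoothDomain Ω) (hp_top : p ≠ ⊤)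
    {φs : ℕ → Lp ℝ ∞ (surfaceMeasure Ω)} {φ : Lp ℝ ∞ (surfaceMeasure Ω)}
    (hφ : WeakStarTendsto φs φ) : ∃ M, 0 ≤ M ∧
      (∀ j, ∀ g : Lp ℝ p (surfaceMeasure Ω), |bdryTerm (φs j) g| ≤ M * ‖g‖ ^ p.toReal) ∧
      ∀ j, ∀ f : Lp ℝ 1 (surfaceMeasure Ω),
        |∫ x, φs j x * f x ∂(surfaceMeasure Ω)| ≤ M * ‖f‖ := by
  choose T hT using fun j => hΩ.exists_clm_pairing (φs j)
  obtain ⟨M, hM⟩ := banach_steinhaus (g := T) fun f => by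
    obtain ⟨C, hC⟩ := (hφ f).norm.bddAbove_range
    exact ⟨C, fun j => by rw [hT]; exact hC ⟨j, rfl⟩⟩
  have h2 : ∀ j, ∀ f : Lp ℝ 1 (surfaceMeasure Ω),
      |∫ x, φs j x * f x ∂(surfaceMeasure Ω)| ≤ M * ‖f‖ := fun j f => by
    rw [← hT, ← Real.norm_eq_abs]
    exact (T j).le_of_opNorm_le (hM j) f
  refine ⟨M, (norm_nonneg _).trans (hM 0), fun j g => ?_, h2⟩
  rw [bdryTerm_eq hp_top, ← norm_absPow hp_top]
  exact h2 j _

/-- Split into `∫ φ_j (|g_j|^p - |g|^p)`, controlled by the uniform bound and strong `L^1`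
convergence, and `∫ (φ_j - φ) |g|^p`, controlled by weak-* convergence. -/
lemma WeakStarTendsto.tendsto_bdryTerm (hΩ : IsBoundedSmoothDomain Ω) (hp_top : p ≠ ⊤)
    {φs : ℕ → Lp ℝ ∞ (surfaceMeasure Ω)} {φ : Lp ℝ ∞ (surfaceMeasure Ω)}
    (hφ : WeakStarTendsto φs φ) {gs : ℕ → Lp ℝ p (surfaceMeasure Ω)}
    {g : Lp ℝ p (surfaceMeasure Ω)} (hg : Tendsto gs atTop (𝓝 g)) :
    Tendsto (fun j => bdryTerm (φs j) (gs j)) atTop (𝓝 (bdryTerm φ g)) := by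
  obtain ⟨M, hM0, -, hM⟩ := hφ.exists_bound hΩ hp_top
  choose T hT using fun j => hΩ.exists_clm_pairing (φs j)
  have h1 : Tendsto (fun j => ‖absPow hp_top (gs j) - absPow hp_top g‖) atTop (𝓝 0) :=
    tendsto_iff_norm_sub_tendsto_zero.1 (((continuous_absPow hp_top).tendsto g).comp hg)
  have h2 : Tendsto (fun j => bdryTerm (φs j) (gs j) - bdryTerm (φs j) g) atTop (𝓝 0) := by
    refine squeeze_zero_norm (fun j => ?_) (by simpa using h1.const_mul M)
    rw [bdryTerm_eq hp_top, bdryTerm_eq hp_top, ← hT, ← hT, ← map_sub, hT]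
    exact hM j _
  have h3 : Tendsto (fun j => bdryTerm (φs j) g) atTop (𝓝 (bdryTerm φ g)) := by
    simp_rw [bdryTerm_eq hp_top]
    exact hφ _
  simpa using h2.add h3

lemma WeakStarTendsto.comp {φs : ℕ → Lp ℝ ∞ (surfaceMeasure Ω)} {φ : Lp ℝ ∞ (surfaceMeasure Ω)}
    (hφ : WeakStarTendsto φs φ) {κ : ℕ → ℕ} (hκ : Tendsto κ atTop atTop) :
    WeakStarTendsto (fun j => φs (κ j)) φ := fun f => (hφ f).comp hκ

lemma weakStarTendsto_const (φ : Lp ℝ ∞ (surfaceMeasure Ω)) : WeakStarTendsto (fun _ => φ) φ :=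
  fun _ => tendsto_const_nhds

/-- On the constraint `‖g‖ = 1` the boundary term is bounded by the norm of `φ` as a functional.
Without this bound the real `sInf` would be a default value. -/
lemma bddBelow_energy (hΩ : IsBoundedSmoothDomain Ω) (hp_top : p ≠ ⊤) {σ : ℝ} (hσ : 0 < σ)
    (φ : Lp ℝ ∞ (surfaceMeasure Ω)) :
    BddBelow {t : ℝ | ∃ (u : Sobolev Ω p) (g : Lp ℝ p (surfaceMeasure Ω)),
      HasTrace u g ∧ ‖g‖ = 1 ∧ t = energy σ φ u g} := by
  obtain ⟨M, hM0, hM, -⟩ := (weakStarTendsto_const φ).exists_bound hΩ hp_top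
  refine ⟨-(σ * M), ?_⟩
  rintro _ ⟨u, g, -, hg, rfl⟩
  have h1 := hM 0 g
  rw [hg, Real.one_rpow, mul_one, abs_le] at h1
  rw [energy_eq hp_top]
  have := mul_le_mul_of_nonneg_left h1.1 hσ.le
  have := Real.rpow_nonneg (norm_nonneg u) p.toReal
  linarith

lemma bdryTerm_smul {p : ℝ≥0∞} (φ : Lp ℝ ∞ (surfaceMeasure Ω))
    (g : Lp ℝ p (surfaceMeasure Ω)) {c : ℝ} (hc : 0 ≤ c) :
    bdryTerm φ (c • g) = c ^ p.toReal * bdryTerm φ g := by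
  rw [bdryTerm, bdryTerm, ← integral_const_mul]
  refine integral_congr_ae ?_
  filter_upwards [Lp.coeFn_smul c g] with x hx
  rw [hx, Pi.smul_apply, smul_eq_mul, abs_mul, abs_of_nonneg hc,
    Real.mul_rpow hc (abs_nonneg _)]
  ring

lemma firstEigenvalue_le (hΩ : IsBoundedSmoothDomain Ω) (hp_top : p ≠ ⊤) {σ : ℝ} (hσ : 0 < σ)
    (φ : Lp ℝ ∞ (surfaceMeasure Ω)) {u : Sobolev Ω p} {g : Lp ℝ p (surfaceMeasure Ω)}
    (hu : HasTrace u g) (hg : ‖g‖ = 1) : firstEigenvalue p σ φ ≤ energy σ φ u g :=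
  csInf_le (bddBelow_energy hΩ hp_top hσ φ) ⟨u, g, hu, hg, rfl⟩

/-- The variational inequality for the first eigenvalue, without normalization. -/
lemma firstEigenvalue_mul_le (hΩ : IsBoundedSmoothDomain Ω) (hp_top : p ≠ ⊤) {σ : ℝ} (hσ : 0 < σ)
    (φ : Lp ℝ ∞ (surfaceMeasure Ω)) {u : Sobolev Ω p} {g : Lp ℝ p (surfaceMeasure Ω)}
    (hu : HasTrace u g) :
    firstEigenvalue p σ φ * ‖g‖ ^ p.toReal ≤ ‖u‖ ^ p.toReal + σ * bdryTerm φ g := by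
  have hq := toReal_pos_of_one_le hp_top
  rcases eq_or_ne g 0 with rfl | hg
  · have h0 : bdryTerm φ (0 : Lp ℝ p (surfaceMeasure Ω)) = 0 := by
      have := bdryTerm_smul φ (0 : Lp ℝ p (surfaceMeasure Ω)) (c := 0) le_rfl
      rwa [smul_zero, Real.zero_rpow hq.ne', zero_mul] at this
    rw [norm_zero, Real.zero_rpow hq.ne', h0]
    have := Real.rpow_nonneg (norm_nonneg u) p.toReal
    linarith
  · have hn : 0 < ‖g‖ := norm_pos_iff.2 hg
    have h1 := firstEigenvalue_le hΩ hp_top hσ φ (hu.smul hΩ ‖g‖⁻¹) (by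
      rw [norm_smul, norm_inv, norm_norm, inv_mul_cancel₀ hn.ne'])
    rw [energy_eq hp_top, bdryTerm_smul _ _ (by positivity), norm_smul_rpow (inv_nonneg.2 hn.le) u,
      Real.inv_rpow hn.le] at h1
    have hpos : 0 < ‖g‖ ^ p.toReal := by positivity
    calc _ ≤ ((‖g‖ ^ p.toReal)⁻¹ * ‖u‖ ^ p.toReal +
          σ * ((‖g‖ ^ p.toReal)⁻¹ * bdryTerm φ g)) * ‖g‖ ^ p.toReal := by gcongr
      _ = _ := by field_simp

/-- Bounded energy gives convergence of the traces along a subsequence. -/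
lemma exists_subseq_tendsto_of_energy_le (hΩ : IsBoundedSmoothDomain Ω) (hp : 1 < p)
    (hp_top : p ≠ ⊤) {σ : ℝ} (hσ : 0 < σ) {φs : ℕ → Lp ℝ ∞ (surfaceMeasure Ω)}
    {φ : Lp ℝ ∞ (surfaceMeasure Ω)} (hφ : WeakStarTendsto φs φ) {us : ℕ → Sobolev Ω p}
    {gs : ℕ → Lp ℝ p (surfaceMeasure Ω)} (hu : ∀ j, HasTrace (us j) (gs j))
    (hg : ∀ j, ‖gs j‖ = 1) {B : ℝ} (hB : ∀ j, energy σ (φs j) (us j) (gs j) ≤ B) :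
    ∃ (g : Lp ℝ p (surfaceMeasure Ω)) (κ : ℕ → ℕ), StrictMono κ ∧
      Tendsto (fun j => gs (κ j)) atTop (𝓝 g) := by
  have hq := toReal_pos_of_one_le hp_top
  obtain ⟨M, hM0, hM, -⟩ := hφ.exists_bound hΩ hp_top
  refine HasTrace.exists_subseq_tendsto hΩ hp hp_top hu (M := (max (B + σ * M) 0) ^ (p.toReal)⁻¹)
    fun j => ?_
  rw [Real.le_rpow_inv_iff_of_pos (norm_nonneg _) (le_max_right _ _) hq]
  refine le_trans ?_ (le_max_left _ _)
  have h1 := hB j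
  have h2 := hM j (gs j)
  rw [hg, Real.one_rpow, mul_one, abs_le] at h2
  rw [energy_eq hp_top] at h1
  have := mul_le_mul_of_nonneg_left h2.1 hσ.le
  linarith

/-- Continuity of the first eigenvalue along weak-* convergent weights. -/
theorem tendsto_firstEigenvalue (hΩ : IsBoundedSmoothDomain Ω) (hp : 1 < p) (hp_top : p ≠ ⊤)
    {σ : ℝ} (hσ : 0 < σ) {φs : ℕ → Lp ℝ ∞ (surfaceMeasure Ω)} {φ : Lp ℝ ∞ (surfaceMeasure Ω)}
    (hφ : WeakStarTendsto φs φ) :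
    Tendsto (fun j => firstEigenvalue p σ (φs j)) atTop (𝓝 (firstEigenvalue p σ φ)) := by
  -- If nothing were admissible, every eigenvalue would be `sInf ∅ = 0` and the limit trivial; this
  -- spares the construction of a competitor.
  by_cases hne : ∃ (u : Sobolev Ω p) (g : Lp ℝ p (surfaceMeasure Ω)), HasTrace u g ∧ ‖g‖ = 1
  swap
  · have h0 : ∀ φ : Lp ℝ ∞ (surfaceMeasure Ω), firstEigenvalue p σ φ = 0 := by
      intro φ
      rw [firstEigenvalue, ← Real.sInf_empty]
      congr 1
      refine eq_empty_iff_forall_notMem.2 ?_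
      rintro _ ⟨u, g, hu, hg, -⟩
      exact hne ⟨u, g, hu, hg⟩
    simp_rw [h0]
    exact tendsto_const_nhds
  have hset : ∀ φ : Lp ℝ ∞ (surfaceMeasure Ω), {t : ℝ | ∃ (u : Sobolev Ω p)
      (g : Lp ℝ p (surfaceMeasure Ω)), HasTrace u g ∧ ‖g‖ = 1 ∧ t = energy σ φ u g}.Nonempty := by
    intro φ
    obtain ⟨u, g, hu, hg⟩ := hne
    exact ⟨_, u, g, hu, hg, rfl⟩
  have hnear : ∀ (φ : Lp ℝ ∞ (surfaceMeasure Ω)) {δ : ℝ}, 0 < δ → ∃ (u : Sobolev Ω p)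
      (g : Lp ℝ p (surfaceMeasure Ω)), HasTrace u g ∧ ‖g‖ = 1 ∧
        energy σ φ u g < firstEigenvalue p σ φ + δ := by
    intro φ δ hδ
    obtain ⟨_, ⟨u, g, hu, hg, rfl⟩, hlt⟩ := exists_lt_of_csInf_lt (hset φ)
      (lt_add_of_pos_right (firstEigenvalue p σ φ) hδ)
    exact ⟨u, g, hu, hg, hlt⟩
  have henergy : ∀ (u : Sobolev Ω p) (g : Lp ℝ p (surfaceMeasure Ω)),
      Tendsto (fun j => energy σ (φs j) u g) atTop (𝓝 (energy σ φ u g)) := by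
    intro u g
    simp_rw [energy_eq hp_top]
    exact ((hφ.tendsto_bdryTerm hΩ hp_top tendsto_const_nhds).const_mul σ).const_add _
  have hupper : ∀ a, firstEigenvalue p σ φ < a → ∀ᶠ j in atTop, firstEigenvalue p σ (φs j) < a := by
    intro a ha
    obtain ⟨u, g, hu, hg, hlt⟩ := hnear φ (sub_pos.2 ha)
    rw [add_sub_cancel] at hlt
    filter_upwards [(henergy u g).eventually_lt_const hlt] with j hj
    exact (firstEigenvalue_le hΩ hp_top hσ _ hu hg).trans_lt hj
  -- The lower bound needs convergent traces, hence a subsequence of an arbitrary subsequence. The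
  -- fixed pair `u₀, g₀` bounds the eigenvalues from above, hence the energies of the
  -- near-minimizers.
  refine tendsto_of_subseq_tendsto fun ns hns => ?_
  have hφ' := hφ.comp hns
  obtain ⟨u₀, g₀, hu₀, hg₀⟩ := hne
  obtain ⟨B, hB⟩ := ((henergy u₀ g₀).comp hns).bddAbove_range
  choose us gs hu hg hlt using fun j => hnear (φs (ns j)) (δ := 1 / ((j : ℝ) + 1)) (by positivity)
  obtain ⟨g, κ, hκ, hκg⟩ := exists_subseq_tendsto_of_energy_le hΩ hp hp_top hσ hφ' hu hg (B := B + 1)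
    fun j => by
      have h1 : firstEigenvalue p σ (φs (ns j)) ≤ B :=
        (firstEigenvalue_le hΩ hp_top hσ _ hu₀ hg₀).trans (hB ⟨j, rfl⟩)
      have h2 : 1 / ((j : ℝ) + 1) ≤ 1 := by
        rw [div_le_one (by positivity)]
        linarith [(Nat.cast_nonneg j : (0 : ℝ) ≤ j)]
      linarith [hlt j]
  refine ⟨κ, tendsto_order.2 ⟨fun a ha => ?_, fun a ha =>
    (hns.comp hκ.tendsto_atTop).eventually (hupper a ha)⟩⟩
  -- The near-minimizers are tested against `φ`. The energies for `φ` and for `φ_j` differ only in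
  -- the boundary term, and both boundary terms tend to `bdryTerm φ g`.
  have t1 := (hφ'.comp hκ.tendsto_atTop).tendsto_bdryTerm hΩ hp_top hκg
  have t2 := ((continuous_bdryTerm hΩ hp_top φ).tendsto g).comp hκg
  have t3 : Tendsto (fun j => 1 / (((κ j : ℕ) : ℝ) + 1)) atTop (𝓝 0) :=
    tendsto_one_div_add_atTop_nhds_zero_nat.comp hκ.tendsto_atTop
  have t4 : Tendsto (fun j => 1 / (((κ j : ℕ) : ℝ) + 1) +
      σ * (bdryTerm φ (gs (κ j)) - bdryTerm (φs (ns (κ j))) (gs (κ j)))) atTop (𝓝 0) := by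
    simpa using t3.add ((t2.sub t1).const_mul σ)
  filter_upwards [t4.eventually_lt_const (sub_pos.2 ha)] with j hj
  have h1 := firstEigenvalue_le hΩ hp_top hσ φ (hu (κ j)) (hg (κ j))
  have h2 := hlt (κ j)
  rw [energy_eq hp_top] at h1 h2
  linarith

/-- Minimizers for weak-* convergent weights converge strongly, along a subsequence, to a
minimizer. -/
theorem exists_subseq_tendsto_minimizer (hΩ : IsBoundedSmoothDomain Ω) (hp : 1 < p)
    (hp_top : p ≠ ⊤) {σ : ℝ} (hσ : 0 < σ) {φs : ℕ → Lp ℝ ∞ (surfaceMeasure Ω)}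
    {φ : Lp ℝ ∞ (surfaceMeasure Ω)} (hφ : WeakStarTendsto φs φ) {us : ℕ → Sobolev Ω p}
    {gs : ℕ → Lp ℝ p (surfaceMeasure Ω)} (hu : ∀ j, HasTrace (us j) (gs j))
    (hg : ∀ j, ‖gs j‖ = 1)
    (hmin : ∀ j, energy σ (φs j) (us j) (gs j) = firstEigenvalue p σ (φs j)) :
    ∃ (w : Sobolev Ω p) (g : Lp ℝ p (surfaceMeasure Ω)) (κ : ℕ → ℕ), StrictMono κ ∧
      Tendsto (fun j => us (κ j)) atTop (𝓝 w) ∧ HasTrace w g ∧ ‖g‖ = 1 ∧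
      energy σ φ w g = firstEigenvalue p σ φ := by
  have hq := toReal_pos_of_one_le hp_top
  have := hΩ.completeSpace_sobolev (p := p)
  have hev := tendsto_firstEigenvalue hΩ hp hp_top hσ hφ
  obtain ⟨B, hB⟩ := hev.bddAbove_range
  obtain ⟨g, κ, hκ, hκg⟩ := exists_subseq_tendsto_of_energy_le hΩ hp hp_top hσ hφ hu hg (B := B)
    fun j => (hmin j).le.trans (hB ⟨j, rfl⟩)
  have tb := (hφ.comp hκ.tendsto_atTop).tendsto_bdryTerm hΩ hp_top hκg
  have tn : Tendsto (fun j => ‖us (κ j)‖ ^ p.toReal) atTop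
      (𝓝 (firstEigenvalue p σ φ - σ * bdryTerm φ g)) := by
    refine ((hev.comp hκ.tendsto_atTop).sub (tb.const_mul σ)).congr fun j => ?_
    rw [Function.comp_apply, ← hmin, energy_eq hp_top]
    ring
  set A := firstEigenvalue p σ φ - σ * bdryTerm φ g with hA
  have hgn : ‖g‖ = 1 := tendsto_nhds_unique hκg.norm (by simp_rw [hg]; exact tendsto_const_nhds)
  have tfst : Tendsto (fun w : ℕ × ℕ => w.1) atTop atTop := by
    rw [← prod_atTop_atTop_eq]; exact tendsto_fst
  have tsnd : Tendsto (fun w : ℕ × ℕ => w.2) atTop atTop := by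
    rw [← prod_atTop_atTop_eq]; exact tendsto_snd
  have tmid : Tendsto (fun w : ℕ × ℕ => (2⁻¹ : ℝ) • (gs (κ w.1) + gs (κ w.2))) atTop (𝓝 g) := by
    have h1 := ((hκg.comp tfst).add (hκg.comp tsnd)).const_smul (2⁻¹ : ℝ)
    have h2 : (2⁻¹ : ℝ) • (g + g) = g := by
      rw [← two_smul ℝ g, smul_smul]; norm_num
    rwa [h2] at h1
  -- An upper bound for the convexity deficit that involves only norms and traces: the variational
  -- inequality bounds the norm of the midpoint from below by `λ ‖·‖^p - σ bdryTerm` of its trace.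
  -- In the limit it equals `A - A = 0`.
  have tdef : Tendsto (fun w : ℕ × ℕ => (‖us (κ w.1)‖ ^ p.toReal + ‖us (κ w.2)‖ ^ p.toReal) / 2 -
      (firstEigenvalue p σ φ * ‖(2⁻¹ : ℝ) • (gs (κ w.1) + gs (κ w.2))‖ ^ p.toReal -
        σ * bdryTerm φ ((2⁻¹ : ℝ) • (gs (κ w.1) + gs (κ w.2))))) atTop (𝓝 0) := by
    have h1 := ((tn.comp tfst).add (tn.comp tsnd)).div_const 2
    have h2 := (((continuous_norm_rpow (E := Lp ℝ p (surfaceMeasure Ω)) hq.le).tendsto g).comp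
      tmid).const_mul (firstEigenvalue p σ φ)
    have h3 := (((continuous_bdryTerm hΩ hp_top φ).tendsto g).comp tmid).const_mul σ
    have h4 := h1.sub (h2.sub h3)
    rw [hgn, Real.one_rpow, mul_one] at h4
    have h5 : (A + A) / 2 - (firstEigenvalue p σ φ - σ * bdryTerm φ g) = 0 := by
      rw [hA]; ring
    rwa [h5] at h4
  have hcauchy : CauchySeq fun j => us (κ j) := by
    rw [cauchySeq_iff_tendsto_dist_atTop_0, Metric.tendsto_nhds]
    intro δ hδ
    obtain ⟨C, hC, hconv⟩ := exists_norm_sub_rpow_sobolev_le (Ω := Ω) hp hp_top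
      (η := δ ^ p.toReal / 2 / (2 * |A| + 1)) (by positivity)
    set η := δ ^ p.toReal / 2 / (2 * |A| + 1) with hη
    have t1 := (((tn.comp tfst).add (tn.comp tsnd)).const_mul η).add (tdef.const_mul C)
    have hlt : η * (A + A) + C * 0 < δ ^ p.toReal := by
      have hδq : 0 < δ ^ p.toReal := by positivity
      rw [mul_zero, add_zero, hη, div_mul_eq_mul_div, div_lt_iff₀ (by positivity)]
      nlinarith [le_abs_self A, abs_nonneg A]
    filter_upwards [t1.eventually_lt_const hlt] with w hw
    rw [dist_zero_right, Real.norm_of_nonneg dist_nonneg, dist_eq_norm,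
      ← Real.rpow_lt_rpow_iff (norm_nonneg _) hδ.le hq]
    refine lt_of_le_of_lt ((hconv _ _).trans ?_) hw
    have h6 := firstEigenvalue_mul_le hΩ hp_top hσ φ
      (((hu (κ w.1)).add hΩ (hu (κ w.2))).smul hΩ (2⁻¹ : ℝ))
    simp only [Function.comp_apply]
    gcongr
    linarith
  obtain ⟨w, hw⟩ := cauchySeq_tendsto_of_complete hcauchy
  refine ⟨w, g, κ, hκ, hw, HasTrace.of_tendsto hΩ (fun j => hu (κ j)) hw hκg, hgn, ?_⟩
  have h7 : ‖w‖ ^ p.toReal = A := tendsto_nhds_unique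
    (((continuous_norm_rpow hq.le).tendsto w).comp hw) tn
  rw [energy_eq hp_top, h7, hA]
  ring

end Energy

/-! ### Chain and product rules for Sobolev functions with traces -/

section ChainRule

variable {m : ℕ} {Ω : Set (Eucl m)} {p : ℝ≥0∞} [Fact (1 ≤ p)]

/-- Some approximant is at finite `L^p` distance from the limit. This lets limits be given as
formulas whose integrability is not known beforehand. -/
lemma memLp_of_tendsto_eLpNorm {α E : Type*} [MeasurableSpace α] [NormedAddCommGroup E]
    {μ : Measure α} {p : ℝ≥0∞} {θ : ℕ → α → E} {V : α → E} (hθ : ∀ k, MemLp (θ k) p μ)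
    (hV : AEStronglyMeasurable V μ)
    (h : Tendsto (fun k => eLpNorm (fun x => θ k x - V x) p μ) atTop (𝓝 0)) : MemLp V p μ := by
  obtain ⟨k, hk⟩ := (h.eventually_lt_const zero_lt_one).exists
  have h1 : MemLp (fun x => θ k x - V x) p μ :=
    ⟨(hθ k).1.sub hV, hk.trans ENNReal.one_lt_top⟩
  have h2 := (hθ k).sub h1
  convert h2 using 1
  ext x
  simp

/-- A limit of `C^1` functions in the Sobolev norm and in `L^p(∂Ω)` defines a Sobolev function
with a trace. -/
lemma exists_hasTrace_of_approx (hΩ : IsBoundedSmoothDomain Ω) {θ : ℕ → Eucl m → ℝ}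
    (hθ : ∀ k, ContDiff ℝ 1 (θ k)) {V K : Eucl m → ℝ} {G : Eucl m → Eucl m}
    (hV : AEStronglyMeasurable V (interiorMeasure Ω))
    (hG : AEStronglyMeasurable G (interiorMeasure Ω))
    (hK : AEStronglyMeasurable K (surfaceMeasure Ω))
    (h1 : Tendsto (fun k => eLpNorm (fun x => θ k x - V x) p (interiorMeasure Ω)) atTop (𝓝 0))
    (h2 : Tendsto (fun k => eLpNorm (fun x => gradient (θ k) x - G x) p (interiorMeasure Ω))
      atTop (𝓝 0))
    (h3 : Tendsto (fun k => eLpNorm (fun x => θ k x - K x) p (surfaceMeasure Ω)) atTop (𝓝 0)) :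
    ∃ (v : Sobolev Ω p) (k : Lp ℝ p (surfaceMeasure Ω)), HasTrace v k ∧
      fn v =ᵐ[interiorMeasure Ω] V ∧ grad v =ᵐ[interiorMeasure Ω] G ∧ k =ᵐ[surfaceMeasure Ω] K := by
  have mV := memLp_of_tendsto_eLpNorm (fun k => hΩ.memLp_interior (hθ k).continuous p) hV h1
  have mG := memLp_of_tendsto_eLpNorm
    (fun k => hΩ.memLp_interior (continuous_gradient (hθ k)) p) hG h2
  have mK := memLp_of_tendsto_eLpNorm (fun k => hΩ.memLp_surface (hθ k).continuous p) hK h3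
  have h1' : Tendsto (fun k => eLpNorm (fun x => θ k x - mV.toLp V x) p (interiorMeasure Ω))
      atTop (𝓝 0) := by
    refine h1.congr fun k => eLpNorm_congr_ae ?_
    filter_upwards [mV.coeFn_toLp] with x hx
    rw [hx]
  have h2' : Tendsto (fun k => eLpNorm (fun x => gradient (θ k) x - mG.toLp G x) p
      (interiorMeasure Ω)) atTop (𝓝 0) := by
    refine h2.congr fun k => eLpNorm_congr_ae ?_
    filter_upwards [mG.coeFn_toLp] with x hx
    rw [hx]
  have h3' : Tendsto (fun k => eLpNorm (fun x => θ k x - mK.toLp K x) p (surfaceMeasure Ω))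
      atTop (𝓝 0) := by
    refine h3.congr fun k => eLpNorm_congr_ae ?_
    filter_upwards [mK.coeFn_toLp] with x hx
    rw [hx]
  have t1 := (tendsto_toLp_iff (fun k => hΩ.memLp_interior (hθ k).continuous p) _).2 h1'
  have t2 := (tendsto_toLp_iff
    (fun k => hΩ.memLp_interior (continuous_gradient (hθ k)) p) _).2 h2'
  have hmem : WithLp.toLp p (mV.toLp V, mG.toLp G) ∈ Sobolev Ω p := by
    refine hΩ.isClosed_sobolev.mem_of_tendsto
      (((WithLp.prod_continuous_toLp p _ _).tendsto (mV.toLp V, mG.toLp G)).comp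
        (t1.prodMk_nhds t2)) (Eventually.of_forall fun k => ?_)
    exact (c1Pair hΩ p ⟨θ k, hθ k⟩).1.2
  exact ⟨⟨_, hmem⟩, mK.toLp K, ⟨θ, hθ, h1', h2', h3'⟩, mV.coeFn_toLp, mG.coeFn_toLp,
    mK.coeFn_toLp⟩

/-- Bounded, almost everywhere convergent coefficients preserve `L^p` convergence. -/
lemma tendsto_eLpNorm_smul {α E : Type*} [MeasurableSpace α] [NormedAddCommGroup E]
    [NormedSpace ℝ E] {μ : Measure α} (hp_top : p ≠ ⊤) {c : ℕ → α → ℝ} {c₀ : α → ℝ}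
    {G : ℕ → α → E} {G₀ : α → E} {L : ℝ} (hc : ∀ k, AEStronglyMeasurable (c k) μ)
    (hc₀ : AEStronglyMeasurable c₀ μ) (hL : ∀ k x, |c k x| ≤ L) (hL₀ : ∀ x, |c₀ x| ≤ L)
    (hlim : ∀ᵐ x ∂μ, Tendsto (fun k => c k x) atTop (𝓝 (c₀ x)))
    (hG : ∀ k, AEStronglyMeasurable (G k) μ) (hG₀ : MemLp G₀ p μ)
    (h : Tendsto (fun k => eLpNorm (fun x => G k x - G₀ x) p μ) atTop (𝓝 0)) :
    Tendsto (fun k => eLpNorm (fun x => c k x • G k x - c₀ x • G₀ x) p μ) atTop (𝓝 0) := by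
  have hp0 : p ≠ 0 := (zero_lt_one.trans_le Fact.out).ne'
  have hq := toReal_pos_of_one_le hp_top
  have t1 : Tendsto (fun k => eLpNorm (fun x => (c k x - c₀ x) • G₀ x) p μ) atTop (𝓝 0) := by
    have h0 : Tendsto (fun k => ∫⁻ x, ‖(c k x - c₀ x) • G₀ x‖ₑ ^ p.toReal ∂μ) atTop
        (𝓝 (∫⁻ _, 0 ∂μ)) := by
      refine tendsto_lintegral_of_dominated_convergence'
        (fun x => (ENNReal.ofReal (2 * L) * ‖G₀ x‖ₑ) ^ p.toReal) (fun k => ?_) (fun k => ?_) ?_ ?_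
      · exact (((hc k).sub hc₀).smul hG₀.1).enorm.pow_const _
      · refine Eventually.of_forall fun x => ?_
        change ‖(c k x - c₀ x) • G₀ x‖ₑ ^ p.toReal ≤ (ENNReal.ofReal (2 * L) * ‖G₀ x‖ₑ) ^ p.toReal
        rw [enorm_smul]
        gcongr
        rw [← ofReal_norm]
        refine ENNReal.ofReal_le_ofReal ((norm_sub_le _ _).trans ?_)
        have := hL k x
        have := hL₀ x
        rw [Real.norm_eq_abs, Real.norm_eq_abs]
        linarith
      · simp_rw [ENNReal.mul_rpow_of_nonneg _ _ hq.le]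
        rw [lintegral_const_mul' _ _ (ENNReal.rpow_ne_top_of_nonneg hq.le ENNReal.ofReal_ne_top)]
        refine ENNReal.mul_ne_top (ENNReal.rpow_ne_top_of_nonneg hq.le ENNReal.ofReal_ne_top) ?_
        exact (lintegral_rpow_enorm_lt_top_of_eLpNorm_lt_top hp0 hp_top hG₀.2).ne
      · filter_upwards [hlim] with x hx
        have h1 : Tendsto (fun k => (c k x - c₀ x) • G₀ x) atTop (𝓝 0) := by
          have := (hx.sub_const (c₀ x)).smul_const (G₀ x)
          rwa [sub_self, zero_smul] at this
        have h2 := (ENNReal.continuous_rpow_const (y := p.toReal)).tendsto 0 |>.comp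
          (by simpa using h1.enorm)
        rwa [ENNReal.zero_rpow_of_pos hq] at h2
    rw [lintegral_zero] at h0
    have h3 := (ENNReal.continuous_rpow_const (y := 1 / p.toReal)).tendsto 0 |>.comp h0
    rw [ENNReal.zero_rpow_of_pos (by positivity)] at h3
    exact h3.congr fun k => (eLpNorm_eq_lintegral_rpow_enorm_toReal hp0 hp_top).symm
  have t2 : Tendsto (fun k => ENNReal.ofReal L * eLpNorm (fun x => G k x - G₀ x) p μ) atTop
      (𝓝 0) := by
    simpa using ENNReal.Tendsto.const_mul h (Or.inr ENNReal.ofReal_ne_top)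
  refine tendsto_of_tendsto_of_tendsto_of_le_of_le tendsto_const_nhds
    (by simpa using t2.add t1) (fun k => zero_le) fun k => ?_
  -- The first part uses boundedness of the coefficients and convergence of `G k`; the second is
  -- handled by dominated convergence with `G₀` fixed.
  have e : (fun x => c k x • G k x - c₀ x • G₀ x) =
      (fun x => c k x • (G k x - G₀ x)) + fun x => (c k x - c₀ x) • G₀ x := by
    ext1 x
    simp only [Pi.add_apply, smul_sub, sub_smul]
    abel
  rw [e]
  refine (eLpNorm_add_le ((hc k).smul ((hG k).sub hG₀.1)) (((hc k).sub hc₀).smul hG₀.1)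
    Fact.out).trans (add_le_add ?_ le_rfl)
  refine eLpNorm_le_mul_eLpNorm_of_ae_le_mul (Eventually.of_forall fun x => ?_) p
  change ‖c k x • (G k x - G₀ x)‖ ≤ _
  rw [norm_smul]
  gcongr
  exact hL k x

lemma abs_sub_le_of_partials {F F₁ F₂ : ℝ × ℝ → ℝ} {L : ℝ}
    (hF : ∀ z, HasFDerivAt F (F₁ z • ContinuousLinearMap.fst ℝ ℝ ℝ +
      F₂ z • ContinuousLinearMap.snd ℝ ℝ ℝ) z)
    (hL₁ : ∀ z, |F₁ z| ≤ L) (hL₂ : ∀ z, |F₂ z| ≤ L) (z z' : ℝ × ℝ) :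
    |F z - F z'| ≤ 2 * L * (|z.1 - z'.1| + |z.2 - z'.2|) := by
  have hL0 : 0 ≤ L := (abs_nonneg _).trans (hL₁ 0)
  have h := convex_univ.norm_image_sub_le_of_norm_hasFDerivWithin_le (C := 2 * L)
    (fun z _ => (hF z).hasFDerivWithinAt) (fun w _ => ?_) (mem_univ z') (mem_univ z)
  · refine h.trans ?_
    gcongr
    rw [Prod.norm_def]
    exact max_le_add_of_nonneg (norm_nonneg _) (norm_nonneg _)
  · refine (norm_add_le _ _).trans ?_
    rw [norm_smul, norm_smul, Real.norm_eq_abs, Real.norm_eq_abs]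
    have h1 := mul_le_mul (hL₁ w) (ContinuousLinearMap.norm_fst_le ℝ ℝ ℝ) (norm_nonneg _) hL0
    have h2 := mul_le_mul (hL₂ w) (ContinuousLinearMap.norm_snd_le ℝ ℝ ℝ) (norm_nonneg _) hL0
    linarith

/-- Chain rule in `W^{1,p}(Ω)` for a `C^1` function of two variables with bounded partial
derivatives. -/
theorem HasTrace.exists_comp (hΩ : IsBoundedSmoothDomain Ω) (hp_top : p ≠ ⊤)
    {F F₁ F₂ : ℝ × ℝ → ℝ} {L : ℝ}
    (hF : ∀ z, HasFDerivAt F (F₁ z • ContinuousLinearMap.fst ℝ ℝ ℝ +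
      F₂ z • ContinuousLinearMap.snd ℝ ℝ ℝ) z)
    (hF₁ : Continuous F₁) (hF₂ : Continuous F₂)
    (hL₁ : ∀ z, |F₁ z| ≤ L) (hL₂ : ∀ z, |F₂ z| ≤ L)
    {u w : Sobolev Ω p} {g h : Lp ℝ p (surfaceMeasure Ω)} (hu : HasTrace u g) (hw : HasTrace w h) :
    ∃ (v : Sobolev Ω p) (k : Lp ℝ p (surfaceMeasure Ω)), HasTrace v k ∧
      (∀ᵐ x ∂(interiorMeasure Ω), fn v x = F (fn u x, fn w x)) ∧
      (∀ᵐ x ∂(interiorMeasure Ω), grad v x =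
        F₁ (fn u x, fn w x) • grad u x + F₂ (fn u x, fn w x) • grad w x) ∧
      ∀ᵐ x ∂(surfaceMeasure Ω), k x = F (g x, h x) := by
  have hL0 : 0 ≤ L := (abs_nonneg _).trans (hL₁ 0)
  obtain ⟨ψ, hψ, a1, a2, a3⟩ := hu
  obtain ⟨χ, hχ, b1, b2, b3⟩ := hw
  have hFc : Continuous F := continuous_iff_continuousAt.2 fun z => (hF z).continuousAt
  have hF1 : ContDiff ℝ 1 F := by
    rw [contDiff_one_iff_hasFDerivAt]
    exact ⟨_, by fun_prop, hF⟩
  -- The partial derivatives of `F` are merely continuous, so their convergence along the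
  -- approximants is only almost everywhere. Two successive extractions make both approximating
  -- sequences converge pointwise.
  have hψae : ∃ ns : ℕ → ℕ, StrictMono ns ∧ ∀ᵐ x ∂(interiorMeasure Ω),
      Tendsto (fun i => ψ (ns i) x) atTop (𝓝 (fn u x)) :=
    (tendstoInMeasure_of_tendsto_eLpNorm (zero_lt_one.trans_le Fact.out).ne'
      (fun k => (hψ k).continuous.aestronglyMeasurable) (Lp.aestronglyMeasurable _)
      a1).exists_seq_tendsto_ae
  obtain ⟨ns, hns, hψae⟩ := hψae
  have hχae : ∃ ms : ℕ → ℕ, StrictMono ms ∧ ∀ᵐ x ∂(interiorMeasure Ω),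
      Tendsto (fun i => χ (ns (ms i)) x) atTop (𝓝 (fn w x)) :=
    (tendstoInMeasure_of_tendsto_eLpNorm (zero_lt_one.trans_le Fact.out).ne'
      (fun k => (hχ (ns k)).continuous.aestronglyMeasurable) (Lp.aestronglyMeasurable _)
      (b1.comp hns.tendsto_atTop)).exists_seq_tendsto_ae
  obtain ⟨ms, hms, hχae⟩ := hχae
  set κ : ℕ → ℕ := fun i => ns (ms i) with hκ
  have hκt : Tendsto κ atTop atTop := hns.tendsto_atTop.comp hms.tendsto_atTop
  have hψae' : ∀ᵐ x ∂(interiorMeasure Ω), Tendsto (fun i => ψ (κ i) x) atTop (𝓝 (fn u x)) :=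
    hψae.mono fun x hx => hx.comp hms.tendsto_atTop
  have hθ : ∀ k, ContDiff ℝ 1 fun x => F (ψ (κ k) x, χ (κ k) x) := fun k =>
    hF1.comp ((hψ _).prodMk (hχ _))
  have mu := Lp.aestronglyMeasurable (fn u)
  have mw := Lp.aestronglyMeasurable (fn w)
  have mgu := Lp.aestronglyMeasurable (grad u)
  have mgw := Lp.aestronglyMeasurable (grad w)
  have mp := mu.prodMk mw
  have lip : ∀ {μ : Measure (Eucl m)} {f₁ f₂ : Eucl m → ℝ} (_ : AEStronglyMeasurable f₁ μ)
      (_ : AEStronglyMeasurable f₂ μ)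
      (_ : Tendsto (fun k => eLpNorm (fun x => ψ k x - f₁ x) p μ) atTop (𝓝 0))
      (_ : Tendsto (fun k => eLpNorm (fun x => χ k x - f₂ x) p μ) atTop (𝓝 0)),
      Tendsto (fun k => eLpNorm (fun x => F (ψ (κ k) x, χ (κ k) x) - F (f₁ x, f₂ x)) p μ)
        atTop (𝓝 0) := by
    intro μ f₁ f₂ m1 m2 c1 c2
    have t : Tendsto (fun k => ENNReal.ofReal (2 * L) *
        (eLpNorm (fun x => ψ (κ k) x - f₁ x) p μ + eLpNorm (fun x => χ (κ k) x - f₂ x) p μ))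
        atTop (𝓝 0) := by
      have := ENNReal.Tendsto.const_mul ((c1.comp hκt).add (c2.comp hκt))
        (Or.inr (ENNReal.ofReal_ne_top (r := 2 * L)))
      rwa [add_zero, mul_zero] at this
    refine tendsto_of_tendsto_of_tendsto_of_le_of_le tendsto_const_nhds t (fun k => zero_le)
      fun k => ?_
    have m1' : AEStronglyMeasurable (fun x => ‖ψ (κ k) x - f₁ x‖) μ :=
      ((hψ _).continuous.aestronglyMeasurable.sub m1).norm
    have m2' : AEStronglyMeasurable (fun x => ‖χ (κ k) x - f₂ x‖) μ :=
      ((hχ _).continuous.aestronglyMeasurable.sub m2).norm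
    calc _ ≤ ENNReal.ofReal (2 * L) * eLpNorm ((fun x => ‖ψ (κ k) x - f₁ x‖) +
          fun x => ‖χ (κ k) x - f₂ x‖) p μ := by
          refine eLpNorm_le_mul_eLpNorm_of_ae_le_mul (Eventually.of_forall fun x => ?_) p
          rw [Pi.add_apply, Real.norm_of_nonneg (add_nonneg (norm_nonneg _) (norm_nonneg _))]
          exact abs_sub_le_of_partials hF hL₁ hL₂ _ _
      _ ≤ _ := by
          gcongr
          refine (eLpNorm_add_le m1' m2' Fact.out).trans ?_
          rw [eLpNorm_norm, eLpNorm_norm]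
  have hgrad : ∀ k x, gradient (fun x => F (ψ (κ k) x, χ (κ k) x)) x =
      F₁ (ψ (κ k) x, χ (κ k) x) • gradient (ψ (κ k)) x +
        F₂ (ψ (κ k) x, χ (κ k) x) • gradient (χ (κ k)) x := by
    intro k x
    refine HasGradientAt.gradient ?_
    rw [hasGradientAt_iff_hasFDerivAt]
    have d1 := ((hψ (κ k)).differentiable one_ne_zero x).hasFDerivAt
    have d2 := ((hχ (κ k)).differentiable one_ne_zero x).hasFDerivAt
    have d3 := (hF (ψ (κ k) x, χ (κ k) x)).comp x (d1.prodMk d2)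
    refine d3.congr_fderiv ?_
    ext v
    simp [gradient]
  have glim : Tendsto (fun k => eLpNorm (fun x => gradient (fun x => F (ψ (κ k) x, χ (κ k) x)) x -
      (F₁ (fn u x, fn w x) • grad u x + F₂ (fn u x, fn w x) • grad w x)) p (interiorMeasure Ω))
      atTop (𝓝 0) := by
    have mψ : ∀ k, Continuous fun x => (ψ (κ k) x, χ (κ k) x) := fun k =>
      (hψ _).continuous.prodMk (hχ _).continuous
    have lim : ∀ {Φ : ℝ × ℝ → ℝ}, Continuous Φ → ∀ᵐ x ∂(interiorMeasure Ω),
        Tendsto (fun k => Φ (ψ (κ k) x, χ (κ k) x)) atTop (𝓝 (Φ (fn u x, fn w x))) := by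
      intro Φ hΦ
      filter_upwards [hψae', hχae] with x h1 h2
      exact (hΦ.tendsto _).comp (h1.prodMk_nhds h2)
    have s1 := tendsto_eLpNorm_smul hp_top
      (fun k => (hF₁.comp (mψ k)).aestronglyMeasurable) (hF₁.comp_aestronglyMeasurable mp)
      (fun k x => hL₁ _) (fun x => hL₁ _) (lim hF₁)
      (fun k => (continuous_gradient (hψ (κ k))).aestronglyMeasurable) (Lp.memLp (grad u))
      (a2.comp hκt)
    have s2 := tendsto_eLpNorm_smul hp_top
      (fun k => (hF₂.comp (mψ k)).aestronglyMeasurable) (hF₂.comp_aestronglyMeasurable mp)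
      (fun k x => hL₂ _) (fun x => hL₂ _) (lim hF₂)
      (fun k => (continuous_gradient (hχ (κ k))).aestronglyMeasurable) (Lp.memLp (grad w))
      (b2.comp hκt)
    refine tendsto_of_tendsto_of_tendsto_of_le_of_le tendsto_const_nhds
      (by simpa using s1.add s2) (fun k => zero_le) fun k => ?_
    have m1 : AEStronglyMeasurable (fun x => F₁ (ψ (κ k) x, χ (κ k) x) • gradient (ψ (κ k)) x -
        F₁ (fn u x, fn w x) • grad u x) (interiorMeasure Ω) :=
      ((hF₁.comp (mψ k)).smul (continuous_gradient (hψ (κ k)))).aestronglyMeasurable.sub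
        ((hF₁.comp_aestronglyMeasurable mp).smul mgu)
    have m2 : AEStronglyMeasurable (fun x => F₂ (ψ (κ k) x, χ (κ k) x) • gradient (χ (κ k)) x -
        F₂ (fn u x, fn w x) • grad w x) (interiorMeasure Ω) :=
      ((hF₂.comp (mψ k)).smul (continuous_gradient (hχ (κ k)))).aestronglyMeasurable.sub
        ((hF₂.comp_aestronglyMeasurable mp).smul mgw)
    refine le_trans (le_of_eq ?_) (eLpNorm_add_le m1 m2 Fact.out)
    congr 1
    ext1 x
    rw [hgrad, Pi.add_apply]
    abel
  exact exists_hasTrace_of_approx hΩ hθ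
    (V := fun x => F (fn u x, fn w x))
    (G := fun x => F₁ (fn u x, fn w x) • grad u x + F₂ (fn u x, fn w x) • grad w x)
    (K := fun x => F (g x, h x)) (p := p)
    (hFc.comp_aestronglyMeasurable mp)
    (((hF₁.comp_aestronglyMeasurable mp).smul mgu).add ((hF₂.comp_aestronglyMeasurable mp).smul mgw))
    (hFc.comp_aestronglyMeasurable
      ((Lp.aestronglyMeasurable g).prodMk (Lp.aestronglyMeasurable h)))
    (lip mu mw a1 b1) glim (lip (Lp.aestronglyMeasurable g) (Lp.aestronglyMeasurable h) a3 b3)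

/-- Product of a Sobolev function with a `C^1` function. -/
theorem HasTrace.exists_mul (hΩ : IsBoundedSmoothDomain Ω) {ζ : Eucl m → ℝ} (hζ : ContDiff ℝ 1 ζ)
    {u : Sobolev Ω p} {g : Lp ℝ p (surfaceMeasure Ω)} (hu : HasTrace u g) :
    ∃ (v : Sobolev Ω p) (k : Lp ℝ p (surfaceMeasure Ω)), HasTrace v k ∧
      (∀ᵐ x ∂(interiorMeasure Ω), fn v x = ζ x * fn u x) ∧
      (∀ᵐ x ∂(interiorMeasure Ω), grad v x = ζ x • grad u x + fn u x • gradient ζ x) ∧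
      ∀ᵐ x ∂(surfaceMeasure Ω), k x = ζ x * g x := by
  obtain ⟨ψ, hψ, a1, a2, a3⟩ := hu
  obtain ⟨C, hC, hCζ⟩ := hΩ.exists_bound hζ.continuous
  obtain ⟨D, hD, hDζ⟩ := hΩ.exists_bound (continuous_gradient hζ)
  have mζ : ∀ {μ : Measure (Eucl m)}, AEStronglyMeasurable ζ μ :=
    hζ.continuous.aestronglyMeasurable
  have mu := Lp.aestronglyMeasurable (fn u)
  have mgu := Lp.aestronglyMeasurable (grad u)
  have hgrad : ∀ k x, gradient (fun x => ζ x * ψ k x) x =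
      ζ x • gradient (ψ k) x + ψ k x • gradient ζ x := by
    intro k x
    refine HasGradientAt.gradient ?_
    rw [hasGradientAt_iff_hasFDerivAt]
    have d1 := ((hψ k).differentiable one_ne_zero x).hasFDerivAt
    have d2 := (hζ.differentiable one_ne_zero x).hasFDerivAt
    refine (d2.mul d1).congr_fderiv ?_
    ext v
    simp [gradient]
  have lim : ∀ (B : ℝ) {a : ℕ → ℝ≥0∞}, Tendsto a atTop (𝓝 0) →
      Tendsto (fun k => ENNReal.ofReal B * a k) atTop (𝓝 0) := fun B a ha => by
    simpa using ENNReal.Tendsto.const_mul ha (Or.inr (ENNReal.ofReal_ne_top (r := B)))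
  refine exists_hasTrace_of_approx hΩ (θ := fun k x => ζ x * ψ k x) (fun k => hζ.mul (hψ k))
    (V := fun x => ζ x * fn u x) (G := fun x => ζ x • grad u x + fn u x • gradient ζ x)
    (K := fun x => ζ x * g x) (mζ.mul mu)
    ((mζ.smul mgu).add (mu.smul (continuous_gradient hζ).aestronglyMeasurable))
    (mζ.mul (Lp.aestronglyMeasurable g)) ?_ ?_ ?_
  · refine tendsto_of_tendsto_of_tendsto_of_le_of_le tendsto_const_nhds (lim C a1)
      (fun k => zero_le) fun k => ?_
    refine eLpNorm_le_mul_eLpNorm_of_ae_le_mul ?_ p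
    filter_upwards [hΩ.ae_interior_closure] with x hx
    rw [← mul_sub, norm_mul]
    gcongr
    exact hCζ x hx
  · refine tendsto_of_tendsto_of_tendsto_of_le_of_le tendsto_const_nhds
      (by simpa using (lim C a2).add (lim D a1)) (fun k => zero_le) fun k => ?_
    have e : (fun x => gradient (fun x => ζ x * ψ k x) x - (ζ x • grad u x + fn u x • gradient ζ x))
        = (fun x => ζ x • (gradient (ψ k) x - grad u x)) +
          fun x => (ψ k x - fn u x) • gradient ζ x := by
      ext1 x
      rw [hgrad, Pi.add_apply, smul_sub, sub_smul]
      abel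
    rw [e]
    refine (eLpNorm_add_le (mζ.smul ((continuous_gradient (hψ k)).aestronglyMeasurable.sub mgu))
      (((hψ k).continuous.aestronglyMeasurable.sub mu).smul
        (continuous_gradient hζ).aestronglyMeasurable) Fact.out).trans ?_
    refine add_le_add (eLpNorm_le_mul_eLpNorm_of_ae_le_mul ?_ p)
      (eLpNorm_le_mul_eLpNorm_of_ae_le_mul ?_ p)
    · filter_upwards [hΩ.ae_interior_closure] with x hx
      change ‖ζ x • (gradient (ψ k) x - grad u x)‖ ≤ _
      rw [norm_smul]
      gcongr
      exact hCζ x hx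
    · filter_upwards [hΩ.ae_interior_closure] with x hx
      change ‖(ψ k x - fn u x) • gradient ζ x‖ ≤ _
      rw [norm_smul, mul_comm]
      gcongr
      exact hDζ x hx
  · refine tendsto_of_tendsto_of_tendsto_of_le_of_le tendsto_const_nhds (lim C a3)
      (fun k => zero_le) fun k => ?_
    refine eLpNorm_le_mul_eLpNorm_of_ae_le_mul ?_ p
    filter_upwards [ae_surface_closure (Ω := Ω)] with x hx
    rw [← mul_sub, norm_mul]
    gcongr
    exact hCζ x hx

end ChainRule

/-! ### Smoothing the absolute value -/

section Regularization

/-- A smooth regularization of the absolute value. -/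
def reg (ε a : ℝ) : ℝ := √(a ^ 2 + ε ^ 2)

lemma reg_pos {ε : ℝ} (hε : 0 < ε) (a : ℝ) : 0 < reg ε a := Real.sqrt_pos.2 (by positivity)

lemma reg_sq (ε a : ℝ) : reg ε a ^ 2 = a ^ 2 + ε ^ 2 := Real.sq_sqrt (by positivity)

lemma abs_le_reg (ε a : ℝ) : |a| ≤ reg ε a := by
  rw [reg, ← Real.sqrt_sq_eq_abs]
  exact Real.sqrt_le_sqrt (by linarith [sq_nonneg ε])

lemma le_reg (ε a : ℝ) : ε ≤ reg ε a := by
  refine (le_abs_self ε).trans ?_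
  rw [reg, ← Real.sqrt_sq_eq_abs]
  exact Real.sqrt_le_sqrt (by linarith [sq_nonneg a])

lemma reg_le {ε : ℝ} (hε : 0 ≤ ε) (a : ℝ) : reg ε a ≤ |a| + ε := by
  rw [reg, Real.sqrt_le_left (by positivity)]
  nlinarith [sq_abs a, mul_nonneg (abs_nonneg a) hε]

lemma continuous_reg (ε : ℝ) : Continuous (reg ε) := by unfold reg; fun_prop

lemma hasDerivAt_reg {ε : ℝ} (hε : 0 < ε) (a : ℝ) : HasDerivAt (reg ε) (a / reg ε a) a := by
  have h1 : HasDerivAt (fun a : ℝ => a ^ 2 + ε ^ 2) (2 * a) a := by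
    simpa using (hasDerivAt_pow 2 a).add_const (ε ^ 2)
  refine (h1.sqrt (by positivity)).congr_deriv ?_
  rw [mul_div_mul_left _ _ two_ne_zero]
  rfl

lemma tendsto_reg (a : ℝ) : Tendsto (fun n : ℕ => reg (1 / ((n : ℝ) + 1)) a) atTop (𝓝 |a|) := by
  have h : Continuous fun ε : ℝ => reg ε a := by unfold reg; fun_prop
  have h0 : reg 0 a = |a| := by simp [reg, Real.sqrt_sq_eq_abs]
  rw [← h0]
  exact (h.tendsto 0).comp tendsto_one_div_add_atTop_nhds_zero_nat

/-- The regularizations of an `L^p` function converge in `L^p` to its absolute value. -/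
lemma exists_reg_lp {α : Type*} [MeasurableSpace α] {μ : Measure α} [IsFiniteMeasure μ]
    {p : ℝ≥0∞} [Fact (1 ≤ p)] (f : Lp ℝ p μ) :
    ∃ (r : ℕ → Lp ℝ p μ) (r₀ : Lp ℝ p μ),
      (∀ n, ∀ᵐ x ∂μ, r n x = reg (1 / ((n : ℝ) + 1)) (f x)) ∧ (∀ᵐ x ∂μ, r₀ x = |f x|) ∧
      Tendsto r atTop (𝓝 r₀) := by
  have hm : ∀ n : ℕ, MemLp (fun x => reg (1 / ((n : ℝ) + 1)) (f x)) p μ := by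
    intro n
    have hε : 0 < 1 / ((n : ℝ) + 1) := by positivity
    refine MemLp.mono ((Lp.memLp f).norm.add (memLp_const (1 / ((n : ℝ) + 1))))
      ((continuous_reg _).comp_aestronglyMeasurable (Lp.aestronglyMeasurable f))
      (Eventually.of_forall fun x => ?_)
    rw [Real.norm_of_nonneg (reg_pos hε _).le, Pi.add_apply]
    exact (reg_le hε.le _).trans (Real.le_norm_self _)
  refine ⟨fun n => (hm n).toLp _, (Lp.memLp f).norm.toLp _, fun n => (hm n).coeFn_toLp,
    (Lp.memLp f).norm.coeFn_toLp, ?_⟩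
  rw [tendsto_toLp_iff]
  have t : Tendsto (fun n : ℕ => ENNReal.ofReal (1 / ((n : ℝ) + 1)) *
      eLpNorm (fun _ : α => (1 : ℝ)) p μ) atTop (𝓝 0) := by
    have h1 : Tendsto (fun n : ℕ => ENNReal.ofReal (1 / ((n : ℝ) + 1))) atTop (𝓝 0) := by
      rw [← ENNReal.ofReal_zero]
      exact (ENNReal.continuous_ofReal.tendsto 0).comp tendsto_one_div_add_atTop_nhds_zero_nat
    simpa using ENNReal.Tendsto.mul_const h1 (Or.inr (memLp_const (1 : ℝ)).eLpNorm_ne_top)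
  refine tendsto_of_tendsto_of_tendsto_of_le_of_le tendsto_const_nhds t (fun k => zero_le)
    fun n => ?_
  refine eLpNorm_le_mul_eLpNorm_of_ae_le_mul ?_ p
  filter_upwards [(Lp.memLp f).norm.coeFn_toLp] with x hx
  have hε : 0 < 1 / ((n : ℝ) + 1) := by positivity
  rw [hx, norm_one, mul_one, Real.norm_eq_abs, Real.norm_eq_abs,
    abs_of_nonneg (sub_nonneg.2 (abs_le_reg _ _))]
  linarith [reg_le hε.le (f x)]

end Regularization

/-! ### Hidden convexity of the Dirichlet energy -/

section PowerMean

variable {q : ℝ}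

/-- The coefficient of the gradient of the power mean of two functions. -/
def midCoef (q A B a : ℝ) : ℝ := 2⁻¹ * ((A ^ q + B ^ q) / 2) ^ (1 / q - 1) * (A ^ (q - 2) * a)

/-- This form displays the gradient of the power mean `v` as a convex combination with weights `A^q
/ (A^q + B^q)` and `B^q / (A^q + B^q)`. When `a = A`, the vector being averaged is `v` times the
logarithmic gradient `X / A`. -/
lemma midCoef_eq {A B : ℝ} (a : ℝ) (hA : 0 < A) (hB : 0 ≤ B) :
    midCoef q A B a = A ^ q / (A ^ q + B ^ q) *
      (((A ^ q + B ^ q) / 2) ^ (1 / q) * (a / A ^ 2)) := by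
  have hAq : 0 < A ^ q := Real.rpow_pos_of_pos hA q
  have hBq : 0 ≤ B ^ q := Real.rpow_nonneg hB q
  rw [midCoef, Real.rpow_sub_one (by positivity), Real.rpow_sub hA, Real.rpow_two]
  field_simp

variable {E : Type*} [NormedAddCommGroup E] [NormedSpace ℝ E]

/-- The weight cancels the factor `S / A ^ q` produced by the `q`-th power. Only `|a| ≤ A` enters,
so the bound survives replacing `|a|` by its regularization `A = reg ε a`. -/
lemma mul_norm_smul_rpow_le (hq : 1 < q) {A S a : ℝ} (hA : 0 < A) (hS : 0 < S) (ha : |a| ≤ A)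
    (X : E) : A ^ q / (2 * S) * ‖(S ^ (1 / q) * (a / A ^ 2)) • X‖ ^ q ≤ ‖X‖ ^ q / 2 := by
  have hq0 : 0 < q := by linarith
  have hAq : 0 < A ^ q := Real.rpow_pos_of_pos hA q
  have h1 : ‖(S ^ (1 / q) * (a / A ^ 2)) • X‖ ≤ S ^ (1 / q) * A⁻¹ * ‖X‖ := by
    rw [norm_smul, norm_mul, Real.norm_of_nonneg (Real.rpow_nonneg hS.le _), norm_div, norm_pow,
      Real.norm_eq_abs, Real.norm_of_nonneg hA.le]
    gcongr
    rw [div_le_iff₀ (by positivity)]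
    calc |a| ≤ A := ha
      _ = A⁻¹ * A ^ 2 := by field_simp
  calc _ ≤ A ^ q / (2 * S) * (S ^ (1 / q) * A⁻¹ * ‖X‖) ^ q := by gcongr
    _ = A ^ q / (2 * S) * (S * (A ^ q)⁻¹ * ‖X‖ ^ q) := by
      rw [Real.mul_rpow (by positivity) (norm_nonneg _), Real.mul_rpow (by positivity)
        (by positivity), ← Real.rpow_mul hS.le, one_div, inv_mul_cancel₀ hq0.ne', Real.rpow_one,
        Real.inv_rpow hA.le]
    _ = ‖X‖ ^ q / 2 := by field_simp

/-- Hidden convexity of the Dirichlet energy, pointwise. -/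
lemma norm_midCoef_rpow_le (hq : 1 < q) {A B a b : ℝ} (hA : 0 < A) (hB : 0 < B) (ha : |a| ≤ A)
    (hb : |b| ≤ B) (X Y : E) :
    ‖midCoef q A B a • X + midCoef q B A b • Y‖ ^ q ≤ (‖X‖ ^ q + ‖Y‖ ^ q) / 2 := by
  have hAq : 0 < A ^ q := Real.rpow_pos_of_pos hA q
  have hBq : 0 < B ^ q := Real.rpow_pos_of_pos hB q
  rw [midCoef_eq a hA hB.le, midCoef_eq b hB hA.le, add_comm (B ^ q), mul_smul, mul_smul _ _ Y]
  have hS : 0 < (A ^ q + B ^ q) / 2 := by positivity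
  have h1 := mul_norm_smul_rpow_le hq hA hS ha X
  have h2 := mul_norm_smul_rpow_le hq hB hS hb Y
  rw [mul_div_cancel₀ _ (two_ne_zero' ℝ)] at h1 h2
  refine (norm_rpow_convex hq.le _ _ (by positivity) (by positivity) ?_).trans ?_
  · field_simp
  · linarith

/-- Equality case of the hidden convexity. -/
lemma smul_eq_smul_of_le_norm_midCoef [StrictConvexSpace ℝ E] (hq : 1 < q) {a b : ℝ} (ha : 0 < a)
    (hb : 0 ≤ b) {X Y : E}
    (h : (‖X‖ ^ q + ‖Y‖ ^ q) / 2 ≤ ‖midCoef q a b a • X + midCoef q b a b • Y‖ ^ q) :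
    a • Y = b • X := by
  have hq0 : 0 < q := by linarith
  have haq : 0 < a ^ q := Real.rpow_pos_of_pos ha q
  rcases hb.eq_or_lt with rfl | hb
  -- When `b = 0` all the weight lies on `X`, whose term is at most `‖X‖ ^ q / 2`; the hypothesis
  -- then forces `Y = 0`.
  · have h0 : midCoef q 0 a 0 = 0 := by simp [midCoef]
    rw [h0, zero_smul, add_zero, midCoef_eq a ha le_rfl, Real.zero_rpow hq0.ne', add_zero,
      div_self haq.ne', one_mul] at h
    have hS : 0 < a ^ q / 2 := by positivity
    have h1 := mul_norm_smul_rpow_le hq ha hS (abs_of_pos ha).le X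
    rw [mul_div_cancel₀ _ (two_ne_zero' ℝ), div_self haq.ne', one_mul] at h1
    have h2 : ‖Y‖ ^ q = 0 := le_antisymm (by linarith) (Real.rpow_nonneg (norm_nonneg _) _)
    rw [Real.rpow_eq_zero (norm_nonneg _) hq0.ne', norm_eq_zero] at h2
    simp [h2]
  · have hbq : 0 < b ^ q := Real.rpow_pos_of_pos hb q
    have hS : 0 < (a ^ q + b ^ q) / 2 := by positivity
    have h1 := mul_norm_smul_rpow_le hq ha hS (abs_of_pos ha).le X
    have h2 := mul_norm_smul_rpow_le hq hb hS (abs_of_pos hb).le Y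
    rw [mul_div_cancel₀ _ (two_ne_zero' ℝ)] at h1 h2
    rw [midCoef_eq a ha hb.le, midCoef_eq b hb ha.le, add_comm (b ^ q), mul_smul, mul_smul _ _ Y] at h
    set S := (a ^ q + b ^ q) / 2 with hSdef
    by_contra hne
    have hXY : (S ^ (1 / q) * (a / a ^ 2)) • X ≠ (S ^ (1 / q) * (b / b ^ 2)) • Y := by
      intro heq
      apply hne
      have hSq : 0 < S ^ (1 / q) := Real.rpow_pos_of_pos hS _
      -- Clearing the common factor turns equality of the averaged vectors into `b • X = a • Y`.
      have h3 := congrArg (fun Z => (S ^ (1 / q))⁻¹ • (a * b) • Z) heq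
      simp only [smul_smul] at h3
      have e1 : (S ^ (1 / q))⁻¹ * (a * b * (S ^ (1 / q) * (a / a ^ 2))) = b := by field_simp
      have e2 : (S ^ (1 / q))⁻¹ * (a * b * (S ^ (1 / q) * (b / b ^ 2))) = a := by field_simp
      rw [e1, e2] at h3
      exact h3.symm
    have h4 := norm_rpow_strictConvex hq hXY (s := a ^ q / (a ^ q + b ^ q))
      (t := b ^ q / (a ^ q + b ^ q)) (by positivity) (by positivity) (by field_simp)
    linarith

lemma continuous_midCoef_reg {X : Type*} [TopologicalSpace X] {ε : ℝ} (hε : 0 < ε) {a b : X → ℝ}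
    (ha : Continuous a) (hb : Continuous b) :
    Continuous fun z => midCoef q (reg ε (a z)) (reg ε (b z)) (a z) := by
  unfold midCoef
  have h1 : Continuous fun z => reg ε (a z) := (continuous_reg ε).comp ha
  have h2 : Continuous fun z => reg ε (b z) := (continuous_reg ε).comp hb
  have p1 : ∀ z, 0 < reg ε (a z) := fun z => reg_pos hε _
  have p2 : ∀ z, 0 < reg ε (b z) := fun z => reg_pos hε _
  refine (continuous_const.mul (Continuous.rpow_const ?_ fun z => Or.inl ?_)).mul
    ((h1.rpow_const fun z => Or.inl (p1 z).ne').mul ha)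
  · exact ((h1.rpow_const fun z => Or.inl (p1 z).ne').add
      (h2.rpow_const fun z => Or.inl (p2 z).ne')).div_const 2
  · have := Real.rpow_pos_of_pos (p1 z) q
    have := Real.rpow_pos_of_pos (p2 z) q
    positivity

/-- Hidden convexity on the line with `X = 1` and `Y = 0`. It supplies the bounded partial
derivatives needed by the chain rule. -/
lemma abs_midCoef_le (hq : 1 < q) {A B a : ℝ} (hA : 0 < A) (hB : 0 < B) (ha : |a| ≤ A) :
    |midCoef q A B a| ≤ 1 := by
  have hq0 : 0 < q := by linarith
  have h := norm_midCoef_rpow_le (E := ℝ) hq hA hB ha (b := 0) (by simpa using hB.le) 1 0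
  simp only [smul_eq_mul, mul_one, mul_zero, add_zero, norm_one, Real.one_rpow, norm_zero,
    Real.zero_rpow hq0.ne', Real.norm_eq_abs] at h
  by_contra hcon
  have := Real.one_lt_rpow (not_le.1 hcon) hq0
  linarith

lemma hasFDerivAt_powerMean (hq : 1 < q) {ε : ℝ} (hε : 0 < ε) (z : ℝ × ℝ) :
    HasFDerivAt (fun z : ℝ × ℝ => ((reg ε z.1 ^ q + reg ε z.2 ^ q) / 2) ^ (1 / q))
      (midCoef q (reg ε z.1) (reg ε z.2) z.1 • ContinuousLinearMap.fst ℝ ℝ ℝ +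
        midCoef q (reg ε z.2) (reg ε z.1) z.2 • ContinuousLinearMap.snd ℝ ℝ ℝ) z := by
  have hd : ∀ a : ℝ, HasDerivAt (fun a => reg ε a ^ q) (q * (reg ε a ^ (q - 2) * a)) a := by
    intro a
    refine ((hasDerivAt_reg hε a).rpow_const (p := q) (Or.inl (reg_pos hε a).ne')).congr_deriv ?_
    have : reg ε a ^ (q - 1) = reg ε a ^ (q - 2) * reg ε a := by
      rw [← Real.rpow_add_one (reg_pos hε a).ne']; congr 1; ring
    rw [this]
    have := reg_pos hε a
    field_simp
  have d1 : HasFDerivAt (fun z : ℝ × ℝ => reg ε z.1 ^ q)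
      ((q * (reg ε z.1 ^ (q - 2) * z.1)) • ContinuousLinearMap.fst ℝ ℝ ℝ) z :=
    HasDerivAt.comp_hasFDerivAt (f := Prod.fst) z (hd z.1) hasFDerivAt_fst
  have d2 : HasFDerivAt (fun z : ℝ × ℝ => reg ε z.2 ^ q)
      ((q * (reg ε z.2 ^ (q - 2) * z.2)) • ContinuousLinearMap.snd ℝ ℝ ℝ) z :=
    HasDerivAt.comp_hasFDerivAt (f := Prod.snd) z (hd z.2) hasFDerivAt_snd
  have p1 := Real.rpow_pos_of_pos (reg_pos hε z.1) q
  have p2 := Real.rpow_pos_of_pos (reg_pos hε z.2) q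
  have hS : 0 < (reg ε z.1 ^ q + reg ε z.2 ^ q) / 2 := by positivity
  have hd3 : HasDerivAt (fun s : ℝ => (s / 2) ^ (1 / q))
      (1 / 2 * (1 / q) * ((reg ε z.1 ^ q + reg ε z.2 ^ q) / 2) ^ (1 / q - 1))
      (reg ε z.1 ^ q + reg ε z.2 ^ q) :=
    ((hasDerivAt_id' _).div_const 2).rpow_const (Or.inl hS.ne')
  have d3 := HasDerivAt.comp_hasFDerivAt (f := fun z : ℝ × ℝ => reg ε z.1 ^ q + reg ε z.2 ^ q)
    z hd3 (d1.add d2)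
  refine d3.congr_fderiv ?_
  rw [smul_add, smul_smul, smul_smul, midCoef, midCoef, add_comm (reg ε z.2 ^ q)]
  congr 2 <;> field_simp

end PowerMean

/-! ### Power means of two minimizers and equality of their energies -/

section Midpoint

variable {m : ℕ} {Ω : Set (Eucl m)} {p : ℝ≥0∞} [Fact (1 ≤ p)]

/-- For `a > 0` every base of a power whose exponent may be negative stays away from zero in the
limit; for `a = 0` the factor `a` kills the coefficient. -/
lemma tendsto_midCoef {q : ℝ} (hq : 1 < q) {a b : ℝ} (ha : 0 ≤ a) (hb : 0 ≤ b) :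
    Tendsto (fun n : ℕ => midCoef q (reg (1 / ((n : ℝ) + 1)) a) (reg (1 / ((n : ℝ) + 1)) b) a) atTop
      (𝓝 (midCoef q a b a)) := by
  rcases ha.eq_or_lt with rfl | ha
  · simp [midCoef]
  · have hq0 : 0 < q := by linarith
    have t1 := tendsto_reg a
    have t2 := tendsto_reg b
    rw [abs_of_pos ha] at t1
    rw [abs_of_nonneg hb] at t2
    have hpos : 0 < (a ^ q + b ^ q) / 2 := by
      have := Real.rpow_pos_of_pos ha q
      have := Real.rpow_nonneg hb q
      positivity
    exact (((((t1.rpow_const (Or.inl ha.ne')).add (t2.rpow_const (Or.inr hq0.le))).div_const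
      2).rpow_const (Or.inl hpos.ne')).const_mul 2⁻¹).mul
      ((t1.rpow_const (Or.inl ha.ne')).mul_const a)

lemma norm_rpow_of_powerMean {α : Type*} [MeasurableSpace α] {μ : Measure α} (hp_top : p ≠ ⊤)
    {f r s : Lp ℝ p μ}
    (h : ∀ᵐ x ∂μ, |f x| ^ p.toReal = (|r x| ^ p.toReal + |s x| ^ p.toReal) / 2) :
    ‖f‖ ^ p.toReal = (‖r‖ ^ p.toReal + ‖s‖ ^ p.toReal) / 2 := by
  rw [norm_rpow_lp hp_top, norm_rpow_lp hp_top, norm_rpow_lp hp_top,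
    ← integral_add (integrable_norm_rpow_lp hp_top r) (integrable_norm_rpow_lp hp_top s),
    ← integral_div]
  exact integral_congr_ae h

lemma bdryTerm_of_powerMean (hΩ : IsBoundedSmoothDomain Ω) (hp_top : p ≠ ⊤)
    (φ : Lp ℝ ∞ (surfaceMeasure Ω)) {f r s : Lp ℝ p (surfaceMeasure Ω)}
    (h : ∀ᵐ x ∂(surfaceMeasure Ω), |f x| ^ p.toReal = (|r x| ^ p.toReal + |s x| ^ p.toReal) / 2) :
    bdryTerm φ f = (bdryTerm φ r + bdryTerm φ s) / 2 := by
  obtain ⟨T, hT⟩ := hΩ.exists_clm_pairing φ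
  have h1 : absPow hp_top f = (2⁻¹ : ℝ) • (absPow hp_top r + absPow hp_top s) := by
    refine Lp.ext ?_
    filter_upwards [h, absPow_ae hp_top f, absPow_ae hp_top r, absPow_ae hp_top s,
      Lp.coeFn_smul (2⁻¹ : ℝ) (absPow hp_top r + absPow hp_top s),
      Lp.coeFn_add (absPow hp_top r) (absPow hp_top s)] with x h0 h1 h2 h3 h4 h5
    rw [h4, Pi.smul_apply, h5, Pi.add_apply, h1, h2, h3, smul_eq_mul]
    simp only [Real.norm_eq_abs]
    rw [h0]
    ring
  rw [bdryTerm_eq hp_top, bdryTerm_eq hp_top, bdryTerm_eq hp_top, ← hT, ← hT, ← hT, h1, map_smul,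
    map_add, smul_eq_mul]
  ring

lemma bdryTerm_congr_abs {p : ℝ≥0∞} (φ : Lp ℝ ∞ (surfaceMeasure Ω)) {f r : Lp ℝ p (surfaceMeasure Ω)}
    (h : ∀ᵐ x ∂(surfaceMeasure Ω), r x = |f x|) : bdryTerm φ r = bdryTerm φ f := by
  refine integral_congr_ae ?_
  filter_upwards [h] with x hx
  rw [hx, abs_abs]

lemma norm_congr_abs {p : ℝ≥0∞} {α : Type*} [MeasurableSpace α] {μ : Measure α} {f r : Lp ℝ p μ}
    (h : ∀ᵐ x ∂μ, r x = |f x|) : ‖r‖ = ‖f‖ := by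
  rw [Lp.norm_def, Lp.norm_def]
  congr 1
  refine eLpNorm_congr_norm_ae ?_
  filter_upwards [h] with x hx
  rw [hx, Real.norm_eq_abs, abs_abs, Real.norm_eq_abs]

/-- The regularized power mean of two Sobolev functions. -/
lemma HasTrace.exists_powerMean (hΩ : IsBoundedSmoothDomain Ω) (hp : 1 < p) (hp_top : p ≠ ⊤)
    {u w : Sobolev Ω p} {g h : Lp ℝ p (surfaceMeasure Ω)} (hu : HasTrace u g) (hw : HasTrace w h)
    {ε : ℝ} (hε : 0 < ε) :
    ∃ (v : Sobolev Ω p) (k : Lp ℝ p (surfaceMeasure Ω)), HasTrace v k ∧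
      (∀ᵐ x ∂(interiorMeasure Ω), |fn v x| ^ p.toReal =
        (|reg ε (fn u x)| ^ p.toReal + |reg ε (fn w x)| ^ p.toReal) / 2) ∧
      (∀ᵐ x ∂(interiorMeasure Ω), grad v x =
        midCoef p.toReal (reg ε (fn u x)) (reg ε (fn w x)) (fn u x) • grad u x +
        midCoef p.toReal (reg ε (fn w x)) (reg ε (fn u x)) (fn w x) • grad w x) ∧
      ∀ᵐ x ∂(surfaceMeasure Ω), |k x| ^ p.toReal =
        (|reg ε (g x)| ^ p.toReal + |reg ε (h x)| ^ p.toReal) / 2 := by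
  have hq := one_lt_toReal hp hp_top
  have hq0 : 0 < p.toReal := by linarith
  have hmean : ∀ a b : ℝ, |((reg ε a ^ p.toReal + reg ε b ^ p.toReal) / 2) ^ (1 / p.toReal)| ^
      p.toReal = (|reg ε a| ^ p.toReal + |reg ε b| ^ p.toReal) / 2 := by
    intro a b
    have p1 := reg_pos hε a
    have p2 := reg_pos hε b
    rw [abs_of_pos p1, abs_of_pos p2, abs_of_nonneg (by positivity),
      ← Real.rpow_mul (by positivity), one_div_mul_cancel hq0.ne', Real.rpow_one]
  have hL : ∀ a b : ℝ, |midCoef p.toReal (reg ε a) (reg ε b) a| ≤ 1 := fun a b =>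
    abs_midCoef_le hq (reg_pos hε _) (reg_pos hε _) (abs_le_reg _ _)
  obtain ⟨v, k, hvk, hv, hgv, hk⟩ := HasTrace.exists_comp hΩ hp_top
    (F := fun z : ℝ × ℝ => ((reg ε z.1 ^ p.toReal + reg ε z.2 ^ p.toReal) / 2) ^ (1 / p.toReal))
    (F₁ := fun z : ℝ × ℝ => midCoef p.toReal (reg ε z.1) (reg ε z.2) z.1)
    (F₂ := fun z : ℝ × ℝ => midCoef p.toReal (reg ε z.2) (reg ε z.1) z.2)
    (fun z => hasFDerivAt_powerMean hq hε z)
    (continuous_midCoef_reg hε continuous_fst continuous_snd)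
    (continuous_midCoef_reg hε continuous_snd continuous_fst)
    (fun z => hL z.1 z.2) (fun z => hL z.2 z.1) hu hw
  refine ⟨v, k, hvk, ?_, hgv, ?_⟩
  · filter_upwards [hv] with x h1
    rw [h1]
    exact hmean _ _
  · filter_upwards [hk] with x h1
    rw [h1]
    exact hmean _ _

/-- The power means of two minimizers have almost the mean Dirichlet energy. -/
lemma exists_powerMean_seq (hΩ : IsBoundedSmoothDomain Ω) (hp : 1 < p) (hp_top : p ≠ ⊤) {σ : ℝ}
    (hσ : 0 < σ) (φ : Lp ℝ ∞ (surfaceMeasure Ω)) {u w : Sobolev Ω p}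
    {g h : Lp ℝ p (surfaceMeasure Ω)} (hu : HasTrace u g) (hw : HasTrace w h) (hg : ‖g‖ = 1)
    (hh : ‖h‖ = 1) (hEu : energy σ φ u g = firstEigenvalue p σ φ)
    (hEw : energy σ φ w h = firstEigenvalue p σ φ) :
    ∃ (v : ℕ → Sobolev Ω p) (D : ℕ → ℝ), Tendsto D atTop (𝓝 0) ∧
      (∀ n : ℕ, ∀ᵐ x ∂(interiorMeasure Ω), grad (v n) x =
        midCoef p.toReal (reg (1 / ((n : ℝ) + 1)) (fn u x)) (reg (1 / ((n : ℝ) + 1)) (fn w x))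
          (fn u x) • grad u x +
        midCoef p.toReal (reg (1 / ((n : ℝ) + 1)) (fn w x)) (reg (1 / ((n : ℝ) + 1)) (fn u x))
          (fn w x) • grad w x) ∧
      ∀ n, (‖grad u‖ ^ p.toReal + ‖grad w‖ ^ p.toReal) / 2 - ‖grad (v n)‖ ^ p.toReal ≤ D n := by
  have hq := one_lt_toReal hp hp_top
  have := hΩ.isFiniteMeasure_interiorMeasure
  have := hΩ.isFiniteMeasure_surfaceMeasure
  have hq0 : 0 < p.toReal := by linarith
  have hε : ∀ n : ℕ, 0 < 1 / ((n : ℝ) + 1) := fun n => by positivity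
  obtain ⟨ru, ru₀, hru, hru₀, tru⟩ := exists_reg_lp (fn u)
  obtain ⟨rw', rw₀, hrw, hrw₀, trw⟩ := exists_reg_lp (fn w)
  obtain ⟨rg, rg₀, hrg, hrg₀, trg⟩ := exists_reg_lp g
  obtain ⟨rh, rh₀, hrh, hrh₀, trh⟩ := exists_reg_lp h
  have cn : ∀ {μ : Measure (Eucl m)} {f : ℕ → Lp ℝ p μ} {f₀ : Lp ℝ p μ}, Tendsto f atTop (𝓝 f₀) →
      Tendsto (fun n => ‖f n‖ ^ p.toReal) atTop (𝓝 (‖f₀‖ ^ p.toReal)) := fun t =>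
    t.norm.rpow_const (Or.inr hq0.le)
  have cb : ∀ {f : ℕ → Lp ℝ p (surfaceMeasure Ω)} {f₀ : Lp ℝ p (surfaceMeasure Ω)},
      Tendsto f atTop (𝓝 f₀) → Tendsto (fun n => bdryTerm φ (f n)) atTop (𝓝 (bdryTerm φ f₀)) :=
    fun t => ((continuous_bdryTerm hΩ hp_top φ).tendsto _).comp t
  -- As the regularizations tend to absolute values, this becomes the mean of the two energies minus
  -- the eigenvalue, which is zero for minimizers. The traces need no sign, since only their
  -- absolute values enter.
  have tD : Tendsto (fun n => (‖grad u‖ ^ p.toReal + ‖grad w‖ ^ p.toReal) / 2 +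
      (‖ru n‖ ^ p.toReal + ‖rw' n‖ ^ p.toReal) / 2 +
      σ * ((bdryTerm φ (rg n) + bdryTerm φ (rh n)) / 2) -
      firstEigenvalue p σ φ * ((‖rg n‖ ^ p.toReal + ‖rh n‖ ^ p.toReal) / 2)) atTop (𝓝 0) := by
    have t1 := ((cn tru).add (cn trw)).div_const 2
    have t2 := (((cb trg).add (cb trh)).div_const 2).const_mul σ
    have t3 := (((cn trg).add (cn trh)).div_const 2).const_mul (firstEigenvalue p σ φ)
    have t := ((t1.const_add ((‖grad u‖ ^ p.toReal + ‖grad w‖ ^ p.toReal) / 2)).add t2).sub t3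
    rw [norm_congr_abs hru₀, norm_congr_abs hrw₀, norm_congr_abs hrg₀, norm_congr_abs hrh₀,
      bdryTerm_congr_abs φ hrg₀, bdryTerm_congr_abs φ hrh₀, hg, hh, Real.one_rpow] at t
    rw [energy_eq hp_top, norm_rpow_sobolev hp_top] at hEu hEw
    have e : (‖grad u‖ ^ p.toReal + ‖grad w‖ ^ p.toReal) / 2 +
        (‖fn u‖ ^ p.toReal + ‖fn w‖ ^ p.toReal) / 2 + σ * ((bdryTerm φ g + bdryTerm φ h) / 2) -
        firstEigenvalue p σ φ * ((1 + 1) / 2) = 0 := by linarith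
    rwa [e] at t
  have key : ∀ n : ℕ, ∃ v : Sobolev Ω p, (∀ᵐ x ∂(interiorMeasure Ω), grad v x =
        midCoef p.toReal (reg (1 / ((n : ℝ) + 1)) (fn u x)) (reg (1 / ((n : ℝ) + 1)) (fn w x))
          (fn u x) • grad u x +
        midCoef p.toReal (reg (1 / ((n : ℝ) + 1)) (fn w x)) (reg (1 / ((n : ℝ) + 1)) (fn u x))
          (fn w x) • grad w x) ∧
      (‖grad u‖ ^ p.toReal + ‖grad w‖ ^ p.toReal) / 2 - ‖grad v‖ ^ p.toReal ≤
      (‖grad u‖ ^ p.toReal + ‖grad w‖ ^ p.toReal) / 2 +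
      (‖ru n‖ ^ p.toReal + ‖rw' n‖ ^ p.toReal) / 2 +
      σ * ((bdryTerm φ (rg n) + bdryTerm φ (rh n)) / 2) -
      firstEigenvalue p σ φ * ((‖rg n‖ ^ p.toReal + ‖rh n‖ ^ p.toReal) / 2) := by
    intro n
    obtain ⟨v, k, hvk, hv, hgv, hk⟩ := hu.exists_powerMean hΩ hp hp_top hw (hε n)
    refine ⟨v, hgv, ?_⟩
    have hvm : ∀ᵐ x ∂(interiorMeasure Ω),
        |fn v x| ^ p.toReal = (|ru n x| ^ p.toReal + |rw' n x| ^ p.toReal) / 2 := by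
      filter_upwards [hv, hru n, hrw n] with x h1 h2 h3
      rw [h1, h2, h3]
    have hkm : ∀ᵐ x ∂(surfaceMeasure Ω),
        |k x| ^ p.toReal = (|rg n x| ^ p.toReal + |rh n x| ^ p.toReal) / 2 := by
      filter_upwards [hk, hrg n, hrh n] with x h1 h2 h3
      rw [h1, h2, h3]
    have nfn := norm_rpow_of_powerMean hp_top hvm
    have nk := norm_rpow_of_powerMean hp_top hkm
    have bk := bdryTerm_of_powerMean hΩ hp_top φ hkm
    -- The unnormalized inequality is needed because regularization perturbs the trace norm of the
    -- power mean.
    have e2 := firstEigenvalue_mul_le hΩ hp_top hσ φ hvk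
    rw [norm_rpow_sobolev hp_top, nfn, nk, bk] at e2
    linarith
  choose v hv1 hv2 using key
  exact ⟨v, _, tD, hv1, hv2⟩

/-- Two nonnegative minimizers, one of them positive, have proportional gradients. -/
lemma smul_grad_eq_smul_grad (hΩ : IsBoundedSmoothDomain Ω) (hp : 1 < p) (hp_top : p ≠ ⊤) {σ : ℝ}
    (hσ : 0 < σ) (φ : Lp ℝ ∞ (surfaceMeasure Ω)) {u w : Sobolev Ω p}
    {g h : Lp ℝ p (surfaceMeasure Ω)} (hu : HasTrace u g) (hw : HasTrace w h) (hg : ‖g‖ = 1)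
    (hh : ‖h‖ = 1) (hEu : energy σ φ u g = firstEigenvalue p σ φ)
    (hEw : energy σ φ w h = firstEigenvalue p σ φ)
    (hu0 : ∀ᵐ x ∂(interiorMeasure Ω), 0 < fn u x) (hw0 : ∀ᵐ x ∂(interiorMeasure Ω), 0 ≤ fn w x) :
    ∀ᵐ x ∂(interiorMeasure Ω), fn u x • grad w x = fn w x • grad u x := by
  have hq := one_lt_toReal hp hp_top
  obtain ⟨v, D, tD, hgv, hvD⟩ := exists_powerMean_seq hΩ hp hp_top hσ φ hu hw hg hh hEu hEw
  have hε : ∀ n : ℕ, 0 < 1 / ((n : ℝ) + 1) := fun n => by positivity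
  have nu := norm_rpow_lp hp_top (grad u)
  have nw := norm_rpow_lp hp_top (grad w)
  have nv := fun n => norm_rpow_lp hp_top (grad (v n))
  have iu := integrable_norm_rpow_lp hp_top (grad u)
  have iw := integrable_norm_rpow_lp hp_top (grad w)
  have iv := fun n => integrable_norm_rpow_lp hp_top (grad (v n))
  set q := p.toReal with hqdef
  have hq0 : 0 < q := by linarith
  set d : ℕ → Eucl m → ℝ := fun n x =>
    (‖grad u x‖ ^ q + ‖grad w x‖ ^ q) / 2 - ‖grad (v n) x‖ ^ q with hd
  have hdn : ∀ n, ∀ᵐ x ∂(interiorMeasure Ω), 0 ≤ d n x := by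
    intro n
    filter_upwards [hgv n] with x hx
    simp only [hd, hx, sub_nonneg]
    exact norm_midCoef_rpow_le hq (reg_pos (hε n) _) (reg_pos (hε n) _) (abs_le_reg _ _)
      (abs_le_reg _ _) _ _
  have i1 : Integrable (fun x => (‖grad u x‖ ^ q + ‖grad w x‖ ^ q) / 2) (interiorMeasure Ω) :=
    (iu.add iw).div_const 2
  have hdi : ∀ n, Integrable (d n) (interiorMeasure Ω) := fun n => i1.sub (iv n)
  have hdint : ∀ n, ∫ x, d n x ∂(interiorMeasure Ω) ≤ D n := by
    intro n
    refine (le_of_eq ?_).trans (hvD n)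
    simp only [hd]
    rw [integral_sub i1 (iv n), integral_div, integral_add iu iw, nu, nw, nv]
  set d₀ : Eucl m → ℝ := fun x => (‖grad u x‖ ^ q + ‖grad w x‖ ^ q) / 2 -
      ‖midCoef q (fn u x) (fn w x) (fn u x) • grad u x +
        midCoef q (fn w x) (fn u x) (fn w x) • grad w x‖ ^ q with hd₀
  have hlim : ∀ᵐ x ∂(interiorMeasure Ω), Tendsto (fun n => d n x) atTop (𝓝 (d₀ x)) := by
    filter_upwards [hu0, hw0, ae_all_iff.2 hgv] with x h2 h3 h4
    simp only [hd, h4]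
    exact ((((tendsto_midCoef hq h2.le h3).smul_const _).add
      ((tendsto_midCoef hq h3 h2.le).smul_const _)).norm.rpow_const
      (Or.inr hq0.le)).const_sub _
  -- The deficits `d n` are nonnegative with integrals at most `D n → 0`, so by Fatou their
  -- pointwise limit vanishes and the equality case applies.
  have hfatou : ∫⁻ x, ENNReal.ofReal (d₀ x) ∂(interiorMeasure Ω) = 0 := by
    refine le_antisymm ?_ zero_le
    have e : ∫⁻ x, ENNReal.ofReal (d₀ x) ∂(interiorMeasure Ω) =
        ∫⁻ x, liminf (fun n => ENNReal.ofReal (d n x)) atTop ∂(interiorMeasure Ω) := by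
      refine lintegral_congr_ae ?_
      filter_upwards [hlim] with x hx
      exact (((ENNReal.continuous_ofReal.tendsto _).comp hx).liminf_eq).symm
    rw [e]
    refine (lintegral_liminf_le' fun n => (hdi n).aemeasurable.ennreal_ofReal).trans ?_
    have t : Tendsto (fun n => ENNReal.ofReal (D n)) atTop (𝓝 0) := by
      rw [← ENNReal.ofReal_zero]
      exact (ENNReal.continuous_ofReal.tendsto 0).comp tD
    rw [← t.liminf_eq]
    refine liminf_le_liminf (Eventually.of_forall fun n => ?_)
    rw [← ofReal_integral_eq_lintegral_ofReal (hdi n) (hdn n)]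
    exact ENNReal.ofReal_le_ofReal (hdint n)
  rw [lintegral_eq_zero_iff' (aemeasurable_of_tendsto_metrizable_ae atTop
    (fun n => (hdi n).aemeasurable) hlim).ennreal_ofReal] at hfatou
  filter_upwards [hfatou, hu0, hw0] with x h1 h2 h3
  refine smul_eq_smul_of_le_norm_midCoef hq h2 h3 ?_
  exact sub_nonpos.1 (ENNReal.ofReal_eq_zero.1 h1)

end Midpoint

/-! ### Functions with vanishing gradient on a connected open set -/

section Constancy

variable {m : ℕ}

/-- The Poincaré inequality on a ball, with the gradient on the triple ball. -/
lemma lintegral_ball_sub_average_le {f : Eucl m → ℝ} (hf : ContDiff ℝ 1 f) {q : ℝ} (hq : 1 ≤ q)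
    {z : Eucl m} {h : ℝ} (hh : 0 < h) :
    volume (Metric.ball z h) ^ q * ∫⁻ x in Metric.ball z h, ‖f x - ⨍ y in Metric.ball z h, f y‖ₑ ^ q ≤
      2 ^ (q - 1) * (volume (Metric.ball z h) ^ (q - 1) * (ENNReal.ofReal (2 * h) ^ q *
        volume (Metric.ball (0 : Eucl m) (2 * h)) *
          ∫⁻ x in Metric.closedBall z (3 * h), ‖fderiv ℝ f x‖ₑ ^ q)) := by
  set a := ⨍ y in Metric.ball z h, f y with ha
  set B := Metric.ball z h with hB
  have hq0 : 0 < q := by linarith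
  have hBt : volume B ≠ ⊤ := Metric.isBounded_ball.measure_lt_top.ne
  have hB0 : volume B ≠ 0 := (Metric.measure_ball_pos _ _ hh).ne'
  have hfi : IntegrableOn f B :=
    (hf.continuous.continuousOn.integrableOn_compact (isCompact_closedBall z h)).mono_set
      Metric.ball_subset_closedBall
  -- After subtracting its average the function has zero integral over the ball, so only the
  -- oscillation term of the pointwise bound survives.
  have hz : ∫ y in B, (f y - a) = 0 := by
    rw [integral_sub hfi (integrableOn_const hBt), setIntegral_const, ha, setAverage_eq,
      smul_eq_mul, smul_eq_mul, ← mul_assoc, mul_inv_cancel₀, one_mul, sub_self]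
    exact (ENNReal.toReal_pos hB0 hBt).ne'
  have hpt : ∀ x ∈ B, volume B ^ q * ‖f x - a‖ₑ ^ q ≤ 2 ^ (q - 1) * (volume B ^ (q - 1) *
      ∫⁻ v in Metric.ball 0 (2 * h), ‖f (x + v) - f x‖ₑ ^ q) := by
    intro x hx
    have h1 := measure_ball_rpow_mul_enorm_rpow_le (f := fun y => f y - a)
      (hf.continuous.sub continuous_const) hq hx
    rw [← hB, hz, enorm_zero, ENNReal.zero_rpow_of_pos hq0, zero_add] at h1
    simpa only [sub_sub_sub_cancel_right] using h1
  have htr := lintegral_translate_sub_le hf hq (K := B) (U := Metric.closedBall z (3 * h))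
    measurableSet_ball measurableSet_closedBall (ρ := 2 * h) (fun x hx v hv => by
      rw [Metric.mem_closedBall, dist_eq_norm]
      rw [hB, Metric.mem_ball, dist_eq_norm] at hx
      rw [mem_ball_zero_iff] at hv
      calc ‖x + v - z‖ = ‖(x - z) + v‖ := by congr 1; abel
        _ ≤ ‖x - z‖ + ‖v‖ := norm_add_le _ _
        _ ≤ 3 * h := by linarith)
  have hVt : volume B ^ q ≠ ⊤ := ENNReal.rpow_ne_top_of_nonneg hq0.le hBt
  have hV1 : volume B ^ (q - 1) ≠ ⊤ := ENNReal.rpow_ne_top_of_nonneg (by linarith) hBt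
  have h2 : (2 : ℝ≥0∞) ^ (q - 1) ≠ ⊤ := ENNReal.rpow_ne_top_of_nonneg (by linarith) (by simp)
  calc _ = ∫⁻ x in B, volume B ^ q * ‖f x - a‖ₑ ^ q := (lintegral_const_mul' _ _ hVt).symm
    _ ≤ ∫⁻ x in B, 2 ^ (q - 1) * (volume B ^ (q - 1) *
      ∫⁻ v in Metric.ball 0 (2 * h), ‖f (x + v) - f x‖ₑ ^ q) :=
        setLIntegral_mono' measurableSet_ball hpt
    _ = 2 ^ (q - 1) * (volume B ^ (q - 1) *
      ∫⁻ x in B, ∫⁻ v in Metric.ball 0 (2 * h), ‖f (x + v) - f x‖ₑ ^ q) := by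
        rw [lintegral_const_mul' _ _ h2, lintegral_const_mul' _ _ hV1]
    _ ≤ _ := by gcongr

/-- A limit of functions whose gradients tend to zero is constant on a ball. -/
lemma exists_ae_eq_const_ball {p : ℝ≥0∞} [Fact (1 ≤ p)] (hp_top : p ≠ ⊤) {f : Eucl m → ℝ}
    {ψ : ℕ → Eucl m → ℝ} (hψ : ∀ n, ContDiff ℝ 1 (ψ n)) {z : Eucl m} {h : ℝ} (hh : 0 < h)
    (hf : AEStronglyMeasurable f (volume.restrict (Metric.ball z h)))
    (h1 : Tendsto (fun n => eLpNorm (fun x => ψ n x - f x) p (volume.restrict (Metric.ball z h)))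
      atTop (𝓝 0))
    (h2 : Tendsto (fun n => eLpNorm (gradient (ψ n)) p
      (volume.restrict (Metric.closedBall z (3 * h)))) atTop (𝓝 0)) :
    ∃ c, ∀ᵐ x ∂(volume.restrict (Metric.ball z h)), f x = c := by
  have hp0 : p ≠ 0 := (zero_lt_one.trans_le Fact.out).ne'
  have hp1 : (1 : ℝ≥0∞) ≤ p := Fact.out
  have hq := toReal_pos_of_one_le hp_top
  have hq1 : 1 ≤ p.toReal := by
    rw [← ENNReal.toReal_one]
    exact ENNReal.toReal_mono hp_top hp1
  have hr : ∀ {E : Type} [NormedAddCommGroup E] {μ : Measure (Eucl m)} (θ : Eucl m → E),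
      eLpNorm θ p μ ^ p.toReal = ∫⁻ x, ‖θ x‖ₑ ^ p.toReal ∂μ := fun θ => by
    rw [eLpNorm_eq_lintegral_rpow_enorm_toReal hp0 hp_top, ← ENNReal.rpow_mul, one_div,
      inv_mul_cancel₀ hq.ne', ENNReal.rpow_one]
  set B := Metric.ball z h with hB
  set a : ℕ → ℝ := fun n => ⨍ y in B, ψ n y with ha
  have hBt : volume B ≠ ⊤ := Metric.isBounded_ball.measure_lt_top.ne
  have hB0 : volume B ≠ 0 := (Metric.measure_ball_pos _ _ hh).ne'
  have hVq : volume B ^ p.toReal ≠ 0 := (ENNReal.rpow_pos (pos_iff_ne_zero.2 hB0) hBt).ne'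
  have t1 : Tendsto (fun n => eLpNorm (fun x => ψ n x - a n) p (volume.restrict B)) atTop (𝓝 0) := by
    have t : Tendsto (fun n => volume B ^ p.toReal *
        eLpNorm (fun x => ψ n x - a n) p (volume.restrict B) ^ p.toReal) atTop (𝓝 0) := by
      have t2 : Tendsto (fun n => 2 ^ (p.toReal - 1) * (volume B ^ (p.toReal - 1) *
          (ENNReal.ofReal (2 * h) ^ p.toReal * volume (Metric.ball (0 : Eucl m) (2 * h)) *
          eLpNorm (gradient (ψ n)) p (volume.restrict (Metric.closedBall z (3 * h))) ^ p.toReal)))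
          atTop (𝓝 (2 ^ (p.toReal - 1) * (volume B ^ (p.toReal - 1) *
          (ENNReal.ofReal (2 * h) ^ p.toReal * volume (Metric.ball (0 : Eucl m) (2 * h)) *
            0 ^ p.toReal)))) := by
        refine ENNReal.Tendsto.const_mul (ENNReal.Tendsto.const_mul (ENNReal.Tendsto.const_mul
          ((ENNReal.continuous_rpow_const.tendsto 0).comp h2) (Or.inr ?_)) (Or.inr ?_)) (Or.inr ?_)
        · exact ENNReal.mul_ne_top (ENNReal.rpow_ne_top_of_nonneg hq.le ENNReal.ofReal_ne_top)
            Metric.isBounded_ball.measure_lt_top.ne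
        · exact ENNReal.rpow_ne_top_of_nonneg (by linarith) hBt
        · exact ENNReal.rpow_ne_top_of_nonneg (by linarith) (by simp)
      rw [ENNReal.zero_rpow_of_pos hq, mul_zero, mul_zero, mul_zero] at t2
      refine tendsto_of_tendsto_of_tendsto_of_le_of_le tendsto_const_nhds t2 (fun _ => zero_le)
        fun n => ?_
      simp only
      rw [hr, hr]
      refine (lintegral_ball_sub_average_le (hψ n) hq1 hh).trans (le_of_eq ?_)
      simp only [← ofReal_norm, norm_gradient]
      rfl
    have t3 := ENNReal.Tendsto.const_mul (a := (volume B ^ p.toReal)⁻¹) t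
      (Or.inr (ENNReal.inv_ne_top.2 hVq))
    have t4 := (ENNReal.continuous_rpow_const (y := (p.toReal)⁻¹)).tendsto _ |>.comp t3
    rw [mul_zero, ENNReal.zero_rpow_of_pos (inv_pos.2 hq)] at t4
    refine t4.congr fun n => ?_
    rw [Function.comp_apply, ← mul_assoc, ENNReal.inv_mul_cancel
      hVq (ENNReal.rpow_ne_top_of_nonneg hq.le hBt), one_mul,
      ← ENNReal.rpow_mul, mul_inv_cancel₀ hq.ne', ENNReal.rpow_one]
  -- The constants `a n` approximate `f` in `L^p`. Along a subsequence they converge to `f` almost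
  -- everywhere, and a sequence of numbers has only one limit.
  have t2 : Tendsto (fun n => eLpNorm ((fun _ => a n) - f) p (volume.restrict B)) atTop (𝓝 0) := by
    have t3 := t1.add h1
    rw [add_zero] at t3
    refine tendsto_of_tendsto_of_tendsto_of_le_of_le tendsto_const_nhds t3 (fun _ => zero_le)
      fun n => ?_
    have e : ((fun _ => a n) - f) = -(fun x => ψ n x - a n) + fun x => ψ n x - f x := by
      ext x; simp
    have m1 : AEStronglyMeasurable (ψ n) (volume.restrict B) :=
      (hψ n).continuous.aestronglyMeasurable
    rw [e]
    refine (eLpNorm_add_le (m1.sub aestronglyMeasurable_const).neg (m1.sub hf) hp1).trans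
      (le_of_eq ?_)
    rw [eLpNorm_neg]
    rfl
  obtain ⟨ns, -, hns⟩ := (tendstoInMeasure_of_tendsto_eLpNorm hp0
    (fun n => aestronglyMeasurable_const) hf t2).exists_seq_tendsto_ae
  have hne : NeBot (ae (volume.restrict B)) := by
    rw [ae_neBot]
    simpa using hB0
  obtain ⟨x₀, hx₀⟩ := hns.exists
  refine ⟨f x₀, ?_⟩
  filter_upwards [hns] with x hx
  exact tendsto_nhds_unique hx hx₀

/-- On a connected open set, a function that is locally constant almost everywhere is constant
almost everywhere. -/
lemma exists_ae_eq_const_of_locally {Ω : Set (Eucl m)} (hΩ : IsOpen Ω) (hc : IsPreconnected Ω)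
    {f : Eucl m → ℝ}
    (h : ∀ z ∈ Ω, ∃ r > 0, Metric.ball z r ⊆ Ω ∧
      ∃ c, ∀ᵐ x ∂(volume.restrict (Metric.ball z r)), f x = c) :
    ∃ c, ∀ᵐ x ∂(interiorMeasure Ω), f x = c := by
  rcases Ω.eq_empty_or_nonempty with rfl | ⟨z₀, hz₀⟩
  · exact ⟨0, by simp⟩
  have h' : ∀ z : Eucl m, ∃ (r c : ℝ), z ∈ Ω → 0 < r ∧ Metric.ball z r ⊆ Ω ∧
      ∀ᵐ x ∂(volume.restrict (Metric.ball z r)), f x = c := by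
    intro z
    by_cases hz : z ∈ Ω
    · obtain ⟨r, h1, h2, c, h3⟩ := h z hz
      exact ⟨r, c, fun _ => ⟨h1, h2, h3⟩⟩
    · exact ⟨0, 0, fun h => absurd h hz⟩
  choose r c hrc using h'
  have hloc : ∀ z ∈ Ω, ∀ᶠ y in 𝓝[Ω] z, c z = c y := by
    intro z hz
    obtain ⟨hr, -, hae⟩ := hrc z hz
    filter_upwards [self_mem_nhdsWithin, mem_nhdsWithin_of_mem_nhds (Metric.ball_mem_nhds z hr)]
      with y hy hyz
    obtain ⟨hr', -, hae'⟩ := hrc y hy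
    -- The overlap is open and nonempty, hence of positive measure, and some point of it sees both
    -- constants.
    have hpos : volume (Metric.ball z (r z) ∩ Metric.ball y (r y)) ≠ 0 :=
      ((Metric.isOpen_ball.inter Metric.isOpen_ball).measure_pos _
        ⟨y, hyz, Metric.mem_ball_self hr'⟩).ne'
    have hne : NeBot (ae (volume.restrict (Metric.ball z (r z) ∩ Metric.ball y (r y)))) := by
      rw [ae_neBot]
      simpa using hpos
    obtain ⟨x, hx1, hx2⟩ := ((ae_restrict_of_ae_restrict_of_subset inter_subset_left hae).and
      (ae_restrict_of_ae_restrict_of_subset inter_subset_right hae')).exists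
    rw [← hx1, ← hx2]
  have hconst : ∀ z ∈ Ω, c z₀ = c z := fun z hz =>
    hc.induction₂ (fun x y => c x = c y) hloc (fun _ _ _ _ _ _ h1 h2 => h1.trans h2)
      (fun _ _ _ _ h1 => h1.symm) hz₀ hz
  refine ⟨c z₀, ?_⟩
  rw [ae_restrict_iff' hΩ.measurableSet, ae_iff]
  refine measure_null_of_locally_null _ fun x hx => ?_
  simp only [Classical.not_imp, mem_ofPred_eq] at hx
  obtain ⟨hr, -, hae⟩ := hrc x hx.1
  refine ⟨_, inter_mem_nhdsWithin _ (Metric.ball_mem_nhds x hr), ?_⟩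
  rw [ae_restrict_iff' measurableSet_ball, ae_iff] at hae
  refine measure_mono_null (fun y hy => ?_) hae
  have hy1 := hy.1
  simp only [Classical.not_imp, mem_ofPred_eq] at hy1 ⊢
  refine ⟨hy.2, ?_⟩
  rw [← hconst x hx.1]
  exact hy1.2

end Constancy

/-! ### Integrability of the weak form, and eigenfunctions as minimizers -/

section WeakForm

/-- Young's inequality with non-sharp constants: either `y ≤ κ x`, or `x ≤ y / κ`, and one term
alone suffices. -/
lemma rpow_sub_one_mul_le {q κ x y : ℝ} (hq : 1 < q) (hκ : 0 < κ) (hx : 0 ≤ x) (hy : 0 ≤ y) :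
    x ^ (q - 1) * y ≤ κ * x ^ q + κ ^ (1 - q) * y ^ q := by
  have e : ∀ {t : ℝ}, 0 ≤ t → t ^ (q - 1) * t = t ^ q := fun {t} ht => by
    rw [← Real.rpow_add_one' ht (by simp; linarith), sub_add_cancel]
  have p1 : 0 ≤ κ ^ (1 - q) * y ^ q := by positivity
  have p2 : 0 ≤ κ * x ^ q := by positivity
  rcases le_total y (κ * x) with h | h
  · calc x ^ (q - 1) * y ≤ x ^ (q - 1) * (κ * x) := by gcongr
      _ = κ * x ^ q := by rw [← e hx]; ring
      _ ≤ _ := by linarith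
  · have h' : x ≤ y / κ := by rwa [le_div_iff₀ hκ, mul_comm]
    calc x ^ (q - 1) * y ≤ (y / κ) ^ (q - 1) * y := by
          have : 0 ≤ q - 1 := by linarith
          gcongr
      _ = κ ^ (1 - q) * y ^ q := by
        rw [Real.div_rpow hy hκ.le, ← e hy, show 1 - q = -(q - 1) by ring, Real.rpow_neg hκ.le]
        ring
      _ ≤ _ := by linarith

variable {E : Type*} [NormedAddCommGroup E] [InnerProductSpace ℝ E]

lemma norm_rpow_mul_inner_self {q : ℝ} (hq : 0 < q) (X : E) :
    ‖X‖ ^ (q - 2) * inner ℝ X X = ‖X‖ ^ q := by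
  rcases eq_or_ne X 0 with rfl | hX
  · simp [Real.zero_rpow hq.ne']
  · rw [real_inner_self_eq_norm_sq, Real.rpow_sub (norm_pos_iff.2 hX), Real.rpow_two]
    have := norm_pos_iff.2 hX
    field_simp

lemma abs_norm_rpow_mul_inner_le {q : ℝ} (X Y : E) :
    |‖X‖ ^ (q - 2) * inner ℝ X Y| ≤ ‖X‖ ^ (q - 1) * ‖Y‖ := by
  rcases eq_or_ne X 0 with rfl | hX
  · simp only [inner_zero_left, mul_zero, abs_zero]
    positivity
  · have hpos := norm_pos_iff.2 hX
    rw [abs_mul, abs_of_nonneg (by positivity)]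
    calc _ ≤ ‖X‖ ^ (q - 2) * (‖X‖ * ‖Y‖) := by gcongr; exact abs_real_inner_le_norm X Y
      _ = ‖X‖ ^ (q - 1) * ‖Y‖ := by
        rw [← mul_assoc, ← Real.rpow_add_one hpos.ne']; congr 2; ring

lemma integrable_norm_rpow_mul_inner {α : Type*} [MeasurableSpace α] {μ : Measure α} {p : ℝ≥0∞}
    [Fact (1 ≤ p)] (hp : 1 < p) (hp_top : p ≠ ⊤) (U V : Lp E p μ) :
    Integrable (fun x => ‖U x‖ ^ (p.toReal - 2) * inner ℝ (U x) (V x)) μ := by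
  have hq := one_lt_toReal hp hp_top
  have mU := Lp.aestronglyMeasurable U
  have mV := Lp.aestronglyMeasurable V
  refine ((integrable_norm_rpow_lp hp_top U).add (integrable_norm_rpow_lp hp_top V)).mono'
    ((mU.norm.aemeasurable.pow_const _).aestronglyMeasurable.mul (mU.inner mV))
    (Eventually.of_forall fun x => ?_)
  rw [Real.norm_eq_abs]
  refine (abs_norm_rpow_mul_inner_le _ _).trans ?_
  have := rpow_sub_one_mul_le hq zero_lt_one (norm_nonneg (U x)) (norm_nonneg (V x))
  rwa [one_mul, Real.one_rpow, one_mul] at this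

variable {m : ℕ} {Ω : Set (Eucl m)} {p : ℝ≥0∞} [Fact (1 ≤ p)]

lemma integrable_weakForm (hp : 1 < p) (hp_top : p ≠ ⊤) (u v : Sobolev Ω p) :
    Integrable (fun x => ‖grad u x‖ ^ (p.toReal - 2) * inner ℝ (grad u x) (grad v x) +
      |fn u x| ^ (p.toReal - 2) * fn u x * fn v x) (interiorMeasure Ω) := by
  refine (integrable_norm_rpow_mul_inner hp hp_top (grad u) (grad v)).add ?_
  refine (integrable_norm_rpow_mul_inner hp hp_top (fn u) (fn v)).congr
    (Eventually.of_forall fun x => ?_)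
  simp only [Real.norm_eq_abs, RCLike.inner_apply, conj_trivial]
  ring

/-- Normalized eigenfunctions are minimizers. -/
lemma IsWeakSolution.energy_eq {σ : ℝ} {φ : Lp ℝ ∞ (surfaceMeasure Ω)} {lam : ℝ} {u : Sobolev Ω p}
    {g : Lp ℝ p (surfaceMeasure Ω)} (hp_top : p ≠ ⊤) (h : IsWeakSolution σ φ lam u g)
    (hg : ‖g‖ = 1) : energy σ φ u g = lam := by
  have hq := toReal_pos_of_one_le hp_top
  have e : ∀ a : ℝ, |a| ^ (p.toReal - 2) * a * a = |a| ^ p.toReal := fun a => by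
    rw [← Real.norm_eq_abs, ← norm_rpow_mul_inner_self hq a, RCLike.inner_apply, conj_trivial,
      mul_assoc]
  have h1 := h.2 u g h.1
  have h2 : ∫ x, |g x| ^ p.toReal ∂(surfaceMeasure Ω) = 1 := by
    have := norm_rpow_lp hp_top g
    rw [hg, Real.one_rpow] at this
    exact this.symm
  simp only [e, norm_rpow_mul_inner_self hq, h2, mul_one] at h1
  exact h1

end WeakForm

/-! ### Local `L^p` bound for the logarithmic gradient -/

section LogEstimate

/-- An increasing regularization of `3 / 2 * b` for `0 ≤ b`, bounded away from zero. -/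
def rho (ε b : ℝ) : ℝ := reg ε b + b / 2

/-- The bound must hold for negative `b` too, since the chain rule asks for bounded derivatives on
the whole line. The summand `b / 2` in `rho` keeps its derivative at least `1 / 2` for `b ≥ 0`,
where that of `reg` alone degenerates at `0`; this makes the estimate uniform in `ε`. -/
lemma half_le_rho {ε : ℝ} (b : ℝ) : ε / 2 ≤ rho ε b := by
  have h1 := le_reg ε b
  have h2 := abs_le_reg ε b
  have h3 := neg_abs_le b
  rw [rho]
  linarith

lemma rho_pos {ε : ℝ} (hε : 0 < ε) (b : ℝ) : 0 < rho ε b :=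
  (half_pos hε).trans_le (half_le_rho b)

lemma le_rho {ε b : ℝ} (hb : 0 ≤ b) : b ≤ rho ε b := by
  have h2 := abs_le_reg ε b
  have h3 := le_abs_self b
  rw [rho]
  linarith

lemma continuous_rho (ε : ℝ) : Continuous (rho ε) :=
  (continuous_reg ε).add (continuous_id.div_const 2)

lemma hasDerivAt_rho {ε : ℝ} (hε : 0 < ε) (b : ℝ) :
    HasDerivAt (rho ε) (b / reg ε b + 1 / 2) b :=
  (hasDerivAt_reg hε b).add ((hasDerivAt_id' b).div_const 2)

lemma tendsto_rho {b : ℝ} (hb : 0 ≤ b) :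
    Tendsto (fun n : ℕ => rho (1 / ((n : ℝ) + 1)) b) atTop (𝓝 (3 / 2 * b)) := by
  have h := (tendsto_reg b).add_const (b / 2)
  rw [abs_of_nonneg hb] at h
  rwa [show b + b / 2 = 3 / 2 * b by ring] at h

/-- The pointwise inequality behind the logarithmic estimate. -/
lemma weakForm_log_le {E : Type*} [NormedAddCommGroup E] [InnerProductSpace ℝ E] {q : ℝ} (hq : 1 < q)
    (X Y : E) {η b r s : ℝ} (hη : 0 ≤ η) (hb : 0 < b) (hbr : b ≤ r) (hs : 1 / 2 ≤ s) :
    ‖X‖ ^ (q - 2) * inner ℝ X ((η ^ q * ((1 - q) * r ^ (-q) * s)) • X +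
        (r ^ (1 - q) * (q * η ^ (q - 1))) • Y) + |b| ^ (q - 2) * b * (η ^ q * r ^ (1 - q)) ≤
      q * ((q - 1) / (4 * q)) ^ (1 - q) * ‖Y‖ ^ q + η ^ q -
        (q - 1) / 4 * (η ^ q * r ^ (-q) * ‖X‖ ^ q) := by
  have hq0 : 0 < q := by linarith
  have hr : 0 < r := hb.trans_le hbr
  have hP : 0 ≤ η ^ q * r ^ (-q) * ‖X‖ ^ q := by positivity
  have e1 : ‖X‖ ^ (q - 2) * inner ℝ X ((η ^ q * ((1 - q) * r ^ (-q) * s)) • X +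
        (r ^ (1 - q) * (q * η ^ (q - 1))) • Y) =
      -((q - 1) * s * (η ^ q * r ^ (-q) * ‖X‖ ^ q)) +
        (r ^ (1 - q) * (q * η ^ (q - 1))) * (‖X‖ ^ (q - 2) * inner ℝ X Y) := by
    rw [← norm_rpow_mul_inner_self hq0 X, inner_add_right, real_inner_smul_right,
      real_inner_smul_right]
    ring
  have e2 : (r ^ (1 - q) * (q * η ^ (q - 1))) * (‖X‖ ^ (q - 2) * inner ℝ X Y) ≤
      q * ((q - 1) / (4 * q) * (η ^ q * r ^ (-q) * ‖X‖ ^ q) +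
        ((q - 1) / (4 * q)) ^ (1 - q) * ‖Y‖ ^ q) := by
    have h1 := (le_abs_self _).trans (abs_norm_rpow_mul_inner_le (q := q) X Y)
    -- The good term is at least `(q - 1) / 2` times `η^q r^{-q} ‖X‖^q`; this `κ`, multiplied by
    -- `q`, spends half of it and leaves `(q - 1) / 4`.
    have h2 := rpow_sub_one_mul_le hq (κ := (q - 1) / (4 * q)) (x := η * r⁻¹ * ‖X‖) (y := ‖Y‖)
      (div_pos (by linarith) (by linarith)) (by positivity) (norm_nonneg Y)
    rw [Real.mul_rpow (by positivity) (norm_nonneg _), Real.mul_rpow (by positivity)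
      (norm_nonneg _), Real.mul_rpow hη (by positivity), Real.mul_rpow hη (by positivity),
      Real.inv_rpow hr.le, Real.inv_rpow hr.le, ← Real.rpow_neg hr.le, ← Real.rpow_neg hr.le,
      neg_sub] at h2
    calc _ ≤ (r ^ (1 - q) * (q * η ^ (q - 1))) * (‖X‖ ^ (q - 1) * ‖Y‖) := by gcongr
      _ = q * (η ^ (q - 1) * r ^ (1 - q) * ‖X‖ ^ (q - 1) * ‖Y‖) := by ring
      _ ≤ _ := by gcongr
  have e3 : q * ((q - 1) / (4 * q) * (η ^ q * r ^ (-q) * ‖X‖ ^ q) +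
        ((q - 1) / (4 * q)) ^ (1 - q) * ‖Y‖ ^ q) =
      (q - 1) / 4 * (η ^ q * r ^ (-q) * ‖X‖ ^ q) +
        q * ((q - 1) / (4 * q)) ^ (1 - q) * ‖Y‖ ^ q := by
    rw [mul_add, ← mul_assoc, ← mul_assoc q]
    congr 2
    field_simp
  have e4 : |b| ^ (q - 2) * b * (η ^ q * r ^ (1 - q)) ≤ η ^ q := by
    rw [abs_of_pos hb, ← Real.rpow_add_one hb.ne', show q - 2 + 1 = q - 1 by ring]
    have hb' : b ^ (q - 1) ≤ r ^ (q - 1) := Real.rpow_le_rpow hb.le hbr (by linarith)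
    calc b ^ (q - 1) * (η ^ q * r ^ (1 - q)) ≤ r ^ (q - 1) * (η ^ q * r ^ (1 - q)) := by gcongr
      _ = η ^ q * (r ^ (q - 1) * r ^ (1 - q)) := by ring
      _ = η ^ q := by rw [← Real.rpow_add hr, show q - 1 + (1 - q) = 0 by ring, Real.rpow_zero,
          mul_one]
  have e5 : (q - 1) * (1 / 2) * (η ^ q * r ^ (-q) * ‖X‖ ^ q) ≤
      (q - 1) * s * (η ^ q * r ^ (-q) * ‖X‖ ^ q) := by
    have : 0 ≤ q - 1 := by linarith
    gcongr
  rw [e1]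
  linarith

variable {m : ℕ} {Ω : Set (Eucl m)} {p : ℝ≥0∞} [Fact (1 ≤ p)]

lemma contDiff_rpow {q : ℝ} (hq : 1 < q) {η : Eucl m → ℝ} (hη : ContDiff ℝ 1 η) :
    ContDiff ℝ 1 fun x => η x ^ q :=
  ContDiff.rpow_const_of_le (m := 1) hη (by simpa using hq.le)

lemma gradient_rpow {q : ℝ} (hq : 1 < q) {η : Eucl m → ℝ} (hη : ContDiff ℝ 1 η) (x : Eucl m) :
    gradient (fun x => η x ^ q) x = (q * η x ^ (q - 1)) • gradient η x := by
  have h := ((hη.differentiable one_ne_zero x).hasFDerivAt).rpow_const (p := q) (Or.inr hq.le)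
  rw [gradient, h.fderiv, map_smul, gradient]

/-- The test function of the logarithmic estimate. -/
lemma HasTrace.exists_log_test (hΩ : IsBoundedSmoothDomain Ω) (hp : 1 < p) (hp_top : p ≠ ⊤)
    {u : Sobolev Ω p} {g : Lp ℝ p (surfaceMeasure Ω)} (hu : HasTrace u g) {η : Eucl m → ℝ}
    (hη : ContDiff ℝ 1 η) {ε : ℝ} (hε : 0 < ε) :
    ∃ (v : Sobolev Ω p) (k : Lp ℝ p (surfaceMeasure Ω)), HasTrace v k ∧
      (∀ᵐ x ∂(interiorMeasure Ω), fn v x =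
        η x ^ p.toReal * rho ε (fn u x) ^ (1 - p.toReal)) ∧
      (∀ᵐ x ∂(interiorMeasure Ω), grad v x =
        (η x ^ p.toReal * ((1 - p.toReal) * rho ε (fn u x) ^ (-p.toReal) *
          (fn u x / reg ε (fn u x) + 1 / 2))) • grad u x +
        (rho ε (fn u x) ^ (1 - p.toReal) * (p.toReal * η x ^ (p.toReal - 1))) • gradient η x) ∧
      ∀ᵐ x ∂(surfaceMeasure Ω), k x = η x ^ p.toReal * rho ε (g x) ^ (1 - p.toReal) := by
  have hq := one_lt_toReal hp hp_top
  have hcr : Continuous fun z : ℝ × ℝ => rho ε z.1 := (continuous_rho ε).comp continuous_fst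
  have hcg : Continuous fun z : ℝ × ℝ => reg ε z.1 := (continuous_reg ε).comp continuous_fst
  obtain ⟨v₀, k₀, hvk₀, hv₀, hgv₀, hk₀⟩ := HasTrace.exists_comp hΩ hp_top
    (F := fun z : ℝ × ℝ => rho ε z.1 ^ (1 - p.toReal))
    (F₁ := fun z : ℝ × ℝ => (1 - p.toReal) * rho ε z.1 ^ (-p.toReal) * (z.1 / reg ε z.1 + 1 / 2))
    (F₂ := fun _ => 0) (L := (p.toReal - 1) * (ε / 2) ^ (-p.toReal) * (3 / 2)) (fun z => by
      have h1 : HasDerivAt (fun b => rho ε b ^ (1 - p.toReal))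
          ((1 - p.toReal) * rho ε z.1 ^ (-p.toReal) * (z.1 / reg ε z.1 + 1 / 2)) z.1 := by
        refine ((hasDerivAt_rho hε z.1).rpow_const (p := 1 - p.toReal)
          (Or.inl (rho_pos hε _).ne')).congr_deriv ?_
        rw [show 1 - p.toReal - 1 = -p.toReal by ring]
        ring
      refine (HasDerivAt.comp_hasFDerivAt (f := Prod.fst) z h1 hasFDerivAt_fst).congr_fderiv ?_
      rw [zero_smul, add_zero])
    ((continuous_const.mul (hcr.rpow_const fun z => Or.inl (rho_pos hε _).ne')).mul
      ((continuous_fst.div hcg fun z => (reg_pos hε _).ne').add continuous_const))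
    continuous_const
    (fun z => by
      have h1 : rho ε z.1 ^ (-p.toReal) ≤ (ε / 2) ^ (-p.toReal) :=
        Real.rpow_le_rpow_of_nonpos (half_pos hε) (half_le_rho _) (by linarith)
      have h2 : |z.1 / reg ε z.1 + 1 / 2| ≤ 3 / 2 := by
        have : |z.1 / reg ε z.1| ≤ 1 := by
          rw [abs_div, abs_of_pos (reg_pos hε _), div_le_one (reg_pos hε _)]
          exact abs_le_reg _ _
        calc _ ≤ |z.1 / reg ε z.1| + |1 / 2| := abs_add_le _ _
          _ ≤ 1 + 1 / 2 := by
            rw [abs_of_pos (by norm_num : (0 : ℝ) < 1 / 2)]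
            linarith
          _ = 3 / 2 := by norm_num
      rw [abs_mul, abs_mul, abs_of_neg (by linarith : 1 - p.toReal < 0), neg_sub,
        abs_of_pos (Real.rpow_pos_of_pos (rho_pos hε _) _)]
      have : 0 ≤ p.toReal - 1 := by linarith
      gcongr)
    (fun z => by
      rw [abs_zero]
      have : 0 ≤ p.toReal - 1 := by linarith
      positivity) hu hu
  obtain ⟨v, k, hvk, hv, hgv, hk⟩ := hvk₀.exists_mul hΩ (contDiff_rpow hq hη)
  refine ⟨v, k, hvk, ?_, ?_, ?_⟩
  · filter_upwards [hv, hv₀] with x h1 h2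
    rw [h1, h2]
  · filter_upwards [hgv, hgv₀, hv₀] with x h1 h2 h3
    rw [h1, h2, h3, gradient_rpow hq hη, zero_smul, add_zero, smul_smul, smul_smul]
  · filter_upwards [hk, hk₀] with x h1 h2
    rw [h1, h2]

/-- The regularized logarithmic estimate: the bound does not depend on `ε`. -/
lemma IsWeakSolution.lintegral_log_le (hΩ : IsBoundedSmoothDomain Ω) (hp : 1 < p) (hp_top : p ≠ ⊤)
    {σ : ℝ} {φ : Lp ℝ ∞ (surfaceMeasure Ω)} {lam : ℝ} {u : Sobolev Ω p}
    {g : Lp ℝ p (surfaceMeasure Ω)} (hu : IsWeakSolution σ φ lam u g)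
    (hu0 : ∀ᵐ x ∂(interiorMeasure Ω), 0 < fn u x) {η : Eucl m → ℝ} (hη : ContDiff ℝ 1 η)
    (hη0 : ∀ x, 0 ≤ η x) (hηf : ∀ x ∈ frontier Ω, η x = 0) {ε : ℝ} (hε : 0 < ε) :
    ∫⁻ x, ENNReal.ofReal (η x ^ p.toReal * rho ε (fn u x) ^ (-p.toReal) * ‖grad u x‖ ^ p.toReal)
        ∂(interiorMeasure Ω) ≤
      ENNReal.ofReal (∫ x, 4 / (p.toReal - 1) * (p.toReal * ((p.toReal - 1) / (4 * p.toReal)) ^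
        (1 - p.toReal) * ‖gradient η x‖ ^ p.toReal + η x ^ p.toReal) ∂(interiorMeasure Ω)) := by
  have hq := one_lt_toReal hp hp_top
  have hq0 : 0 < p.toReal := by linarith
  obtain ⟨v, k, hvk, hv, hgv, hk⟩ := hu.1.exists_log_test hΩ hp hp_top hη hε
  -- The cutoff vanishes on the boundary, so both boundary integrals drop out and the estimate is
  -- independent of `φ` and the eigenvalue.
  have hk0 : ∀ᵐ x ∂(surfaceMeasure Ω), k x = 0 := by
    filter_upwards [hk, ae_restrict_mem isClosed_frontier.measurableSet] with x h1 h2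
    rw [h1, hηf x h2, Real.zero_rpow hq0.ne', zero_mul]
  have hI := hu.2 v k hvk
  have z1 : ∫ x, φ x * (|g x| ^ (p.toReal - 2) * g x * k x) ∂(surfaceMeasure Ω) = 0 :=
    integral_eq_zero_of_ae (hk0.mono fun x hx => by simp [hx])
  have z2 : ∫ x, |g x| ^ (p.toReal - 2) * g x * k x ∂(surfaceMeasure Ω) = 0 :=
    integral_eq_zero_of_ae (hk0.mono fun x hx => by simp [hx])
  rw [z1, z2, mul_zero, mul_zero, add_zero] at hI
  have iI := integrable_weakForm hp hp_top u v
  have hc : Continuous fun x => 4 / (p.toReal - 1) * (p.toReal *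
      ((p.toReal - 1) / (4 * p.toReal)) ^ (1 - p.toReal) * ‖gradient η x‖ ^ p.toReal +
      η x ^ p.toReal) :=
    continuous_const.mul ((continuous_const.mul ((continuous_gradient hη).norm.rpow_const
      fun _ => Or.inr hq0.le)).add (hη.continuous.rpow_const fun _ => Or.inr hq0.le))
  have iC := memLp_one_iff_integrable.1 (hΩ.memLp_interior hc 1)
  have iD : Integrable (fun x => 4 / (p.toReal - 1) * (p.toReal *
      ((p.toReal - 1) / (4 * p.toReal)) ^ (1 - p.toReal) * ‖gradient η x‖ ^ p.toReal +
      η x ^ p.toReal) - 4 / (p.toReal - 1) * (‖grad u x‖ ^ (p.toReal - 2) *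
      inner ℝ (grad u x) (grad v x) + |fn u x| ^ (p.toReal - 2) * fn u x * fn v x))
      (interiorMeasure Ω) := iC.sub (iI.const_mul (4 / (p.toReal - 1)))
  have hpt : ∀ᵐ x ∂(interiorMeasure Ω),
      η x ^ p.toReal * rho ε (fn u x) ^ (-p.toReal) * ‖grad u x‖ ^ p.toReal ≤
        4 / (p.toReal - 1) * (p.toReal * ((p.toReal - 1) / (4 * p.toReal)) ^
        (1 - p.toReal) * ‖gradient η x‖ ^ p.toReal + η x ^ p.toReal) -
        4 / (p.toReal - 1) * (‖grad u x‖ ^ (p.toReal - 2) * inner ℝ (grad u x) (grad v x) +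
          |fn u x| ^ (p.toReal - 2) * fn u x * fn v x) := by
    filter_upwards [hv, hgv, hu0] with x h1 h2 h3
    have h := weakForm_log_le hq (grad u x) (gradient η x) (hη0 x) h3
      (le_rho (ε := ε) h3.le) (s := fn u x / reg ε (fn u x) + 1 / 2) (by
        have := div_nonneg h3.le (reg_pos hε (fn u x)).le
        linarith)
    rw [← h1, ← h2] at h
    have hpos : 0 < 4 / (p.toReal - 1) := div_pos (by norm_num) (by linarith)
    have h' := mul_le_mul_of_nonneg_left h hpos.le
    rw [mul_sub, ← mul_assoc (4 / (p.toReal - 1)) ((p.toReal - 1) / 4),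
      div_mul_div_cancel₀ (by linarith), div_self (by norm_num), one_mul] at h'
    linarith
  have e : ∫ x, (4 / (p.toReal - 1) * (p.toReal * ((p.toReal - 1) / (4 * p.toReal)) ^
        (1 - p.toReal) * ‖gradient η x‖ ^ p.toReal + η x ^ p.toReal) -
        4 / (p.toReal - 1) * (‖grad u x‖ ^ (p.toReal - 2) * inner ℝ (grad u x) (grad v x) +
          |fn u x| ^ (p.toReal - 2) * fn u x * fn v x)) ∂(interiorMeasure Ω) =
      ∫ x, 4 / (p.toReal - 1) * (p.toReal * ((p.toReal - 1) / (4 * p.toReal)) ^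
        (1 - p.toReal) * ‖gradient η x‖ ^ p.toReal + η x ^ p.toReal) ∂(interiorMeasure Ω) := by
    rw [integral_sub iC (iI.const_mul _), integral_const_mul (4 / (p.toReal - 1))
      (fun x => ‖grad u x‖ ^ (p.toReal - 2) * inner ℝ (grad u x) (grad v x) +
          |fn u x| ^ (p.toReal - 2) * fn u x * fn v x), hI, mul_zero, sub_zero]
  rw [← e, ofReal_integral_eq_lintegral_ofReal iD]
  · exact lintegral_mono_ae (hpt.mono fun x hx => ENNReal.ofReal_le_ofReal hx)
  · filter_upwards [hpt] with x hx
    refine le_trans ?_ hx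
    have := rho_pos hε (fn u x)
    have := hη0 x
    simp only [Pi.zero_apply]
    positivity

/-- The logarithmic gradient of a positive solution is locally in `L^p`. -/
lemma IsWeakSolution.memLp_log (hΩ : IsBoundedSmoothDomain Ω) (hp : 1 < p) (hp_top : p ≠ ⊤)
    {σ : ℝ} {φ : Lp ℝ ∞ (surfaceMeasure Ω)} {lam : ℝ} {u : Sobolev Ω p}
    {g : Lp ℝ p (surfaceMeasure Ω)} (hu : IsWeakSolution σ φ lam u g)
    (hu0 : ∀ᵐ x ∂(interiorMeasure Ω), 0 < fn u x) {z : Eucl m} {r R : ℝ} (hr : 0 < r) (hR : r < R)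
    (hball : Metric.ball z R ⊆ Ω) :
    MemLp (fun x => ‖grad u x‖ / fn u x) p (volume.restrict (Metric.closedBall z r)) := by
  have hq := one_lt_toReal hp hp_top
  have hq0 : 0 < p.toReal := by linarith
  let b : ContDiffBump z := ⟨r, R, hr, hR⟩
  have hη : ContDiff ℝ 1 b := b.contDiff
  have hsub : Metric.closedBall z r ⊆ Ω := (Metric.closedBall_subset_ball hR).trans hball
  have hηf : ∀ x ∈ frontier Ω, b x = 0 := fun x hx => b.zero_of_le_dist (by
    by_contra hcon
    rw [hΩ.isOpen.frontier_eq] at hx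
    exact hx.2 (hball (not_le.1 hcon)))
  have mu := Lp.aestronglyMeasurable (fn u)
  have mg := Lp.aestronglyMeasurable (grad u)
  refine ⟨((mg.norm.aemeasurable.div mu.aemeasurable).mono_measure
    (Measure.restrict_mono hsub le_rfl)).aestronglyMeasurable, ?_⟩
  rw [eLpNorm_lt_top_iff_lintegral_rpow_enorm_lt_top (zero_lt_one.trans_le Fact.out).ne' hp_top]
  set P : ℕ → Eucl m → ℝ := fun n x => b x ^ p.toReal *
    rho (1 / ((n : ℝ) + 1)) (fn u x) ^ (-p.toReal) * ‖grad u x‖ ^ p.toReal with hP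
  have mP : ∀ n, AEMeasurable (fun x => ENNReal.ofReal (P n x)) (interiorMeasure Ω) := fun n =>
    (((hη.continuous.aemeasurable.pow_const _).mul
      (((continuous_rho _).measurable.comp_aemeasurable mu.aemeasurable).pow_const _)).mul
      (mg.norm.aemeasurable.pow_const _)).ennreal_ofReal
  -- The cutoff is `1` here and `rho` tends to `3 / 2` times `fn u`, whence the factor `(3 / 2) ^
  -- p`. Fatou then transfers the bound, uniform in `n`, to the limit.
  have hpt : ∀ᵐ x ∂(volume.restrict (Metric.closedBall z r)),
      ‖‖grad u x‖ / fn u x‖ₑ ^ p.toReal ≤ ENNReal.ofReal ((3 / 2) ^ p.toReal) *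
        liminf (fun n => ENNReal.ofReal (P n x)) atTop := by
    filter_upwards [ae_restrict_of_ae_restrict_of_subset hsub hu0,
      ae_restrict_mem measurableSet_closedBall] with x h1 h2
    have t : Tendsto (fun n => P n x) atTop
        (𝓝 ((3 / 2 * fn u x) ^ (-p.toReal) * ‖grad u x‖ ^ p.toReal)) := by
      simp only [hP, b.one_of_mem_closedBall h2, Real.one_rpow, one_mul]
      exact ((tendsto_rho h1.le).rpow_const (Or.inl (by positivity))).mul_const _
    have t' : Tendsto (fun n => ENNReal.ofReal (P n x)) atTop _ :=
      (ENNReal.continuous_ofReal.tendsto _).comp t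
    rw [t'.liminf_eq,
      ← ENNReal.ofReal_mul (by positivity), Real.enorm_of_nonneg (by positivity),
      ENNReal.ofReal_rpow_of_nonneg (by positivity) hq0.le]
    refine ENNReal.ofReal_le_ofReal (le_of_eq ?_)
    rw [Real.div_rpow (norm_nonneg _) h1.le, Real.rpow_neg (by positivity),
      Real.mul_rpow (by norm_num) h1.le]
    have := Real.rpow_pos_of_pos h1 p.toReal
    have := Real.rpow_pos_of_pos (by norm_num : (0 : ℝ) < 3 / 2) p.toReal
    field_simp
  refine (lintegral_mono_ae hpt).trans_lt ?_
  refine (lintegral_mono' (Measure.restrict_mono hsub le_rfl) le_rfl).trans_lt ?_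
  rw [lintegral_const_mul' _ _ ENNReal.ofReal_ne_top]
  refine ENNReal.mul_lt_top ENNReal.ofReal_lt_top ((lintegral_liminf_le' mP).trans_lt ?_)
  refine lt_of_le_of_lt (liminf_le_liminf (Eventually.of_forall fun n =>
    hu.lintegral_log_le hΩ hp hp_top hu0 hη (fun _ => b.nonneg) hηf (ε := 1 / ((n : ℝ) + 1))
      (by positivity))) ?_
  rw [liminf_const]
  exact ENNReal.ofReal_lt_top

end LogEstimate

/-! ### Simplicity of the first eigenvalue and convergence of eigenfunctions -/

section Simplicity

variable {m : ℕ} {Ω : Set (Eucl m)} {p : ℝ≥0∞} [Fact (1 ≤ p)]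

lemma hasFDerivAt_arctan_div_reg {ε : ℝ} (hε : 0 < ε) (z : ℝ × ℝ) :
    HasFDerivAt (fun z : ℝ × ℝ => Real.arctan (z.1 / reg ε z.2))
      ((reg ε z.2 / (z.1 ^ 2 + reg ε z.2 ^ 2)) • ContinuousLinearMap.fst ℝ ℝ ℝ +
        (-(z.1 * (z.2 / reg ε z.2) / (z.1 ^ 2 + reg ε z.2 ^ 2))) •
          ContinuousLinearMap.snd ℝ ℝ ℝ) z := by
  have hr := reg_pos hε z.2
  have h1 : HasFDerivAt (fun z : ℝ × ℝ => (reg ε z.2)⁻¹)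
      ((-(z.2 / reg ε z.2) / reg ε z.2 ^ 2) • ContinuousLinearMap.snd ℝ ℝ ℝ) z :=
    HasDerivAt.comp_hasFDerivAt (h₂ := fun b => (reg ε b)⁻¹) (f := Prod.snd) z
      ((hasDerivAt_reg hε z.2).inv hr.ne') hasFDerivAt_snd
  have h0 : HasFDerivAt (Prod.fst : ℝ × ℝ → ℝ) (ContinuousLinearMap.fst ℝ ℝ ℝ) z :=
    hasFDerivAt_fst
  have h2 : HasFDerivAt (fun z : ℝ × ℝ => z.1 / reg ε z.2)
      (z.1 • ((-(z.2 / reg ε z.2) / reg ε z.2 ^ 2) • ContinuousLinearMap.snd ℝ ℝ ℝ) +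
        (reg ε z.2)⁻¹ • ContinuousLinearMap.fst ℝ ℝ ℝ) z := by
    simp only [div_eq_mul_inv] at h1 ⊢
    exact h0.mul h1
  refine h2.arctan.congr_fderiv ?_
  rw [smul_add, smul_smul, smul_smul, smul_smul, add_comm]
  congr 2
  · field_simp
    ring
  · field_simp
    ring

/-- The quotient `w / u` need not be a Sobolev function; after regularizing `u` and composing with
`arctan` it is a bounded function of `(w, u)` with bounded partial derivatives. -/
lemma HasTrace.exists_arctan (hΩ : IsBoundedSmoothDomain Ω) (hp_top : p ≠ ⊤) {u w : Sobolev Ω p}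
    {g h : Lp ℝ p (surfaceMeasure Ω)} (hu : HasTrace u g) (hw : HasTrace w h) {ε : ℝ} (hε : 0 < ε) :
    ∃ (v : Sobolev Ω p) (k : Lp ℝ p (surfaceMeasure Ω)), HasTrace v k ∧
      (∀ᵐ x ∂(interiorMeasure Ω), fn v x = Real.arctan (fn w x / reg ε (fn u x))) ∧
      ∀ᵐ x ∂(interiorMeasure Ω), grad v x =
        (reg ε (fn u x) / (fn w x ^ 2 + reg ε (fn u x) ^ 2)) • grad w x +
        (-(fn w x * (fn u x / reg ε (fn u x)) / (fn w x ^ 2 + reg ε (fn u x) ^ 2))) • grad u x := by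
  have hr : ∀ b, 0 < reg ε b := reg_pos hε
  have hc : Continuous fun z : ℝ × ℝ => reg ε z.2 := (continuous_reg ε).comp continuous_snd
  have hne : ∀ z : ℝ × ℝ, z.1 ^ 2 + reg ε z.2 ^ 2 ≠ 0 := fun z => by
    have := hr z.2
    positivity
  have hden : Continuous fun z : ℝ × ℝ => z.1 ^ 2 + reg ε z.2 ^ 2 :=
    (continuous_fst.pow 2).add (hc.pow 2)
  have hb : ∀ a r : ℝ, ε ≤ r → r / (a ^ 2 + r ^ 2) ≤ 1 / ε := by
    intro a r h
    have : 0 < r := hε.trans_le h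
    rw [div_le_div_iff₀ (by positivity) hε]
    nlinarith [sq_nonneg a]
  have hb' : ∀ a r : ℝ, ε ≤ r → |a| / (a ^ 2 + r ^ 2) ≤ 1 / ε := by
    intro a r h
    have : 0 < r := hε.trans_le h
    rw [div_le_div_iff₀ (by positivity) hε]
    nlinarith [sq_nonneg (|a| - r), sq_abs a, mul_le_mul_of_nonneg_left h (abs_nonneg a)]
  obtain ⟨v, k, hvk, hv, hgv, -⟩ := HasTrace.exists_comp hΩ hp_top
    (F := fun z : ℝ × ℝ => Real.arctan (z.1 / reg ε z.2))
    (F₁ := fun z : ℝ × ℝ => reg ε z.2 / (z.1 ^ 2 + reg ε z.2 ^ 2))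
    (F₂ := fun z : ℝ × ℝ => -(z.1 * (z.2 / reg ε z.2) / (z.1 ^ 2 + reg ε z.2 ^ 2))) (L := 1 / ε)
    (hasFDerivAt_arctan_div_reg hε) (hc.div hden hne)
    ((continuous_fst.mul (continuous_snd.div hc fun z => (hr _).ne')).div hden hne).neg
    (fun z => by
      have := hr z.2
      rw [abs_of_nonneg (by positivity)]
      exact hb _ _ (le_reg _ _))
    (fun z => by
      have h1 := hr z.2
      have h2 : |z.2 / reg ε z.2| ≤ 1 := by
        rw [abs_div, abs_of_pos h1, div_le_one h1]
        exact abs_le_reg _ _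
      rw [abs_neg, abs_div, abs_mul, abs_of_nonneg (by positivity : 0 ≤ z.1 ^ 2 + reg ε z.2 ^ 2)]
      refine le_trans ?_ (hb' z.1 _ (le_reg ε z.2))
      gcongr
      exact mul_le_of_le_one_right (abs_nonneg _) h2) hw hu
  exact ⟨v, k, hvk, hv, hgv⟩

/-- Substituting `Y = (b / a) • X`, the two terms cancel up to `reg ε a ^ 2 - a ^ 2 = ε ^ 2`. The
remaining coefficient lies in `[0, 1]` and tends to zero, so the logarithmic gradient dominates. -/
lemma norm_grad_arctan_le {E : Type*} [NormedAddCommGroup E] [NormedSpace ℝ E] {ε a b : ℝ}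
    (hε : 0 < ε) (ha : 0 < a) {X Y : E} (h : a • Y = b • X) :
    ‖(reg ε a / (b ^ 2 + reg ε a ^ 2)) • Y + (-(b * (a / reg ε a) / (b ^ 2 + reg ε a ^ 2))) • X‖ ≤
      ε ^ 2 / (a ^ 2 + ε ^ 2) * (‖X‖ / a) := by
  have hr := reg_pos hε a
  have hsq := reg_sq ε a
  have hY : Y = (b / a) • X := by
    rw [div_eq_inv_mul, mul_smul, ← h, smul_smul, inv_mul_cancel₀ ha.ne', one_smul]
  have hb : |b| * reg ε a ≤ b ^ 2 + reg ε a ^ 2 := by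
    nlinarith [sq_nonneg (|b| - reg ε a), sq_abs b, mul_nonneg (abs_nonneg b) hr.le]
  have e : reg ε a / (b ^ 2 + reg ε a ^ 2) * (b / a) +
      -(b * (a / reg ε a) / (b ^ 2 + reg ε a ^ 2)) =
      ε ^ 2 / (a * reg ε a) * (b / (b ^ 2 + reg ε a ^ 2)) := by
    have : ε ^ 2 = reg ε a ^ 2 - a ^ 2 := by rw [hsq]; ring
    rw [this]
    have : b ^ 2 + reg ε a ^ 2 ≠ 0 := by positivity
    field_simp
    ring
  rw [hY, smul_smul, ← add_smul, norm_smul, e, norm_mul, Real.norm_of_nonneg (by positivity),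
    norm_div, Real.norm_eq_abs, Real.norm_of_nonneg (by positivity : 0 ≤ b ^ 2 + reg ε a ^ 2)]
  have h1 : |b| / (b ^ 2 + reg ε a ^ 2) ≤ 1 / reg ε a := by
    rw [div_le_div_iff₀ (by positivity) hr]
    linarith
  calc _ ≤ ε ^ 2 / (a * reg ε a) * (1 / reg ε a) * ‖X‖ := by gcongr
    _ = ε ^ 2 / (a ^ 2 + ε ^ 2) * (‖X‖ / a) := by
      rw [← hsq]
      field_simp

/-- A function with gradient proportional to that of a positive solution is a multiple of it. -/
lemma exists_fn_eq_mul (hΩ : IsBoundedSmoothDomain Ω) (hp : 1 < p) (hp_top : p ≠ ⊤)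
    {σ : ℝ} {φ : Lp ℝ ∞ (surfaceMeasure Ω)} {lam : ℝ} {u w : Sobolev Ω p}
    {g h : Lp ℝ p (surfaceMeasure Ω)} (hu : IsWeakSolution σ φ lam u g)
    (hu0 : ∀ᵐ x ∂(interiorMeasure Ω), 0 < fn u x) (hw : HasTrace w h)
    (hprop : ∀ᵐ x ∂(interiorMeasure Ω), fn u x • grad w x = fn w x • grad u x) :
    ∃ c : ℝ, ∀ᵐ x ∂(interiorMeasure Ω), fn w x = c * fn u x := by
  have := hΩ.isFiniteMeasure_interiorMeasure
  have hp1 : (1 : ℝ≥0∞) ≤ p := Fact.out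
  have hε : ∀ n : ℕ, 0 < 1 / ((n : ℝ) + 1) := fun n => by positivity
  have mu := (Lp.aestronglyMeasurable (fn u)).aemeasurable
  have mw := (Lp.aestronglyMeasurable (fn w)).aemeasurable
  choose v k hvk hv hgv using fun n : ℕ => hu.1.exists_arctan hΩ hp_top hw (hε n)
  -- The Poincaré argument is available for `C^1` functions, so each `v n` is replaced by one within
  -- `1 / (n + 1)` in the Sobolev norm.
  have hψ : ∀ n : ℕ, ∃ ψ : Eucl m → ℝ, ContDiff ℝ 1 ψ ∧
      eLpNorm (fun x => ψ x - fn (v n) x) p (interiorMeasure Ω) < ENNReal.ofReal (1 / ((n : ℝ) + 1)) ∧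
      eLpNorm (fun x => gradient ψ x - grad (v n) x) p (interiorMeasure Ω) <
        ENNReal.ofReal (1 / ((n : ℝ) + 1)) := by
    intro n
    obtain ⟨ψ, h1, h2, h3, -⟩ := hvk n
    have hpos : 0 < ENNReal.ofReal (1 / ((n : ℝ) + 1)) := ENNReal.ofReal_pos.2 (hε n)
    obtain ⟨j, hj1, hj2⟩ := ((h2.eventually_lt_const hpos).and (h3.eventually_lt_const hpos)).exists
    exact ⟨ψ j, h1 j, hj1, hj2⟩
  choose ψ hψ1 hψ2 hψ3 using hψ
  have tε : Tendsto (fun n : ℕ => ENNReal.ofReal (1 / ((n : ℝ) + 1))) atTop (𝓝 0) := by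
    rw [← ENNReal.ofReal_zero]
    exact (ENNReal.continuous_ofReal.tendsto 0).comp tendsto_one_div_add_atTop_nhds_zero_nat
  have marc : ∀ n : ℕ, AEStronglyMeasurable
      (fun x => Real.arctan (fn w x / reg (1 / ((n : ℝ) + 1)) (fn u x))) (interiorMeasure Ω) :=
    fun n => (Real.measurable_arctan.comp_aemeasurable
      (mw.div ((continuous_reg _).measurable.comp_aemeasurable mu))).aestronglyMeasurable
  have mf : AEStronglyMeasurable (fun x => Real.arctan (fn w x / fn u x)) (interiorMeasure Ω) :=
    (Real.measurable_arctan.comp_aemeasurable (mw.div mu)).aestronglyMeasurable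
  have harc : ∀ t : ℝ, |Real.arctan t| ≤ Real.pi / 2 := fun t =>
    abs_le.2 ⟨(Real.neg_pi_div_two_lt_arctan t).le, (Real.arctan_lt_pi_div_two t).le⟩
  have t1 : Tendsto (fun n => eLpNorm (fun x => ψ n x - Real.arctan (fn w x / fn u x)) p
      (interiorMeasure Ω)) atTop (𝓝 0) := by
    have h1 := tendsto_eLpNorm_smul (μ := interiorMeasure Ω) hp_top
      (c := fun (n : ℕ) x => Real.arctan (fn w x / reg (1 / ((n : ℝ) + 1)) (fn u x)))
      (c₀ := fun x => Real.arctan (fn w x / fn u x)) (G := fun _ _ => (1 : ℝ)) (G₀ := fun _ => 1)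
      (L := Real.pi / 2) marc mf (fun _ _ => harc _) (fun _ => harc _) (by
        filter_upwards [hu0] with x hx
        have t := tendsto_reg (fn u x)
        rw [abs_of_pos hx] at t
        exact (Real.continuous_arctan.tendsto _).comp (tendsto_const_nhds.div t hx.ne'))
      (fun _ => aestronglyMeasurable_const) (memLp_const 1) (by simp)
    have h2 := tε.add h1
    rw [add_zero] at h2
    refine tendsto_of_tendsto_of_tendsto_of_le_of_le tendsto_const_nhds h2 (fun _ => zero_le)
      fun n => ?_
    have e : (fun x => ψ n x - Real.arctan (fn w x / fn u x)) =ᵐ[interiorMeasure Ω]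
        (fun x => ψ n x - fn (v n) x) + fun x =>
          Real.arctan (fn w x / reg (1 / ((n : ℝ) + 1)) (fn u x)) • (1 : ℝ) -
            Real.arctan (fn w x / fn u x) • (1 : ℝ) := by
      filter_upwards [hv n] with x hx
      simp [hx]
    rw [eLpNorm_congr_ae e]
    refine (eLpNorm_add_le ((hψ1 n).continuous.aestronglyMeasurable.sub
      (Lp.aestronglyMeasurable _)) (((marc n).smul aestronglyMeasurable_const).sub
      (mf.smul aestronglyMeasurable_const)) hp1).trans ?_
    exact add_le_add (hψ2 n).le le_rfl
  have t2 : ∀ (z : Eucl m) (r R : ℝ), 0 < r → r < R → Metric.ball z R ⊆ Ω →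
      Tendsto (fun n => eLpNorm (gradient (ψ n)) p (volume.restrict (Metric.closedBall z r))) atTop
        (𝓝 0) := by
    intro z r R hr hR hball
    have hsub : Metric.closedBall z r ⊆ Ω := (Metric.closedBall_subset_ball hR).trans hball
    have hle : volume.restrict (Metric.closedBall z r) ≤ interiorMeasure Ω :=
      Measure.restrict_mono hsub le_rfl
    have hlog := hu.memLp_log hΩ hp hp_top hu0 hr hR hball
    have mu' := mu.mono_measure hle
    have h1 := tendsto_eLpNorm_smul (μ := volume.restrict (Metric.closedBall z r)) hp_top
      (c := fun (n : ℕ) x => (1 / ((n : ℝ) + 1)) ^ 2 / (fn u x ^ 2 + (1 / ((n : ℝ) + 1)) ^ 2))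
      (c₀ := fun _ => 0) (G := fun _ x => ‖grad u x‖ / fn u x) (L := 1)
      (fun n => (aemeasurable_const.div ((mu'.pow_const 2).add_const _)).aestronglyMeasurable)
      aestronglyMeasurable_const (fun n x => by
        have := hε n
        rw [abs_of_nonneg (by positivity), div_le_one (by positivity)]
        linarith [sq_nonneg (fn u x)]) (by simp) (by
        filter_upwards [ae_restrict_of_ae_restrict_of_subset hsub hu0] with x hx
        have t := (tendsto_one_div_add_atTop_nhds_zero_nat (𝕜 := ℝ)).pow 2
        have t' := t.div (t.const_add (fn u x ^ 2)) (by positivity)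
        rw [zero_pow two_ne_zero, zero_div] at t'
        exact t')
      (fun _ => hlog.1) hlog (by simp)
    have h2 := tε.add h1
    rw [add_zero] at h2
    refine tendsto_of_tendsto_of_tendsto_of_le_of_le tendsto_const_nhds h2 (fun _ => zero_le)
      fun n => ?_
    have e : gradient (ψ n) = (fun x => gradient (ψ n) x - grad (v n) x) + grad (v n) := by
      ext1 x; simp
    have mgv := (Lp.aestronglyMeasurable (grad (v n))).mono_measure hle
    rw [e]
    refine (eLpNorm_add_le ((continuous_gradient (hψ1 n)).aestronglyMeasurable.sub mgv) mgv
      hp1).trans (add_le_add ((eLpNorm_mono_measure _ hle).trans (hψ3 n).le) ?_)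
    refine eLpNorm_mono_ae ?_
    filter_upwards [ae_restrict_of_ae_restrict_of_subset hsub hu0,
      ae_restrict_of_ae_restrict_of_subset hsub hprop,
      ae_restrict_of_ae_restrict_of_subset hsub (hgv n)] with x h3 h4 h5
    rw [h5, zero_smul, sub_zero, smul_eq_mul]
    exact (norm_grad_arctan_le (hε n) h3 h4).trans (Real.le_norm_self _)
  obtain ⟨c, hc⟩ := exists_ae_eq_const_of_locally hΩ.isOpen hΩ.isConnected.isPreconnected
    (f := fun x => Real.arctan (fn w x / fn u x)) (fun z hz => by
      obtain ⟨R, hR, hball⟩ := Metric.isOpen_iff.1 hΩ.isOpen z hz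
      have hsub : Metric.ball z (R / 4) ⊆ Ω :=
        (Metric.ball_subset_ball (by linarith)).trans hball
      have hle : volume.restrict (Metric.ball z (R / 4)) ≤ interiorMeasure Ω :=
        Measure.restrict_mono hsub le_rfl
      -- With radius `R / 4` the tripled ball of the Poincaré inequality still lies in the ball of
      -- radius `R` contained in `Ω`.
      refine ⟨R / 4, by positivity, hsub, exists_ae_eq_const_ball hp_top hψ1 (by positivity)
        (mf.mono_measure hle) ?_ (t2 z (3 * (R / 4)) R (by positivity) (by linarith) hball)⟩
      exact tendsto_of_tendsto_of_tendsto_of_le_of_le tendsto_const_nhds t1 (fun _ => zero_le)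
        fun n => eLpNorm_mono_measure _ hle)
  refine ⟨Real.tan c, ?_⟩
  filter_upwards [hc, hu0] with x h1 h2
  rw [← h1, Real.tan_arctan, div_mul_cancel₀ _ h2.ne']

/-- Simplicity of the first eigenvalue: a nonnegative normalized minimizer coincides with the
positive normalized eigenfunction. -/
theorem IsWeakSolution.eq_of_minimizer (hΩ : IsBoundedSmoothDomain Ω) (hp : 1 < p) (hp_top : p ≠ ⊤)
    {σ : ℝ} (hσ : 0 < σ) {φ : Lp ℝ ∞ (surfaceMeasure Ω)} {u w : Sobolev Ω p}
    {g h : Lp ℝ p (surfaceMeasure Ω)} (hu : IsWeakSolution σ φ (firstEigenvalue p σ φ) u g)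
    (hu0 : ∀ᵐ x ∂(interiorMeasure Ω), 0 < fn u x) (hg : ‖g‖ = 1) (hw : HasTrace w h)
    (hw0 : ∀ᵐ x ∂(interiorMeasure Ω), 0 ≤ fn w x) (hh : ‖h‖ = 1)
    (hEw : energy σ φ w h = firstEigenvalue p σ φ) : w = u := by
  have hprop := smul_grad_eq_smul_grad hΩ hp hp_top hσ φ hu.1 hw hg hh (hu.energy_eq hp_top hg) hEw
    hu0 hw0
  obtain ⟨c, hc⟩ := exists_fn_eq_mul hΩ hp hp_top hu hu0 hw hprop
  have hwu : w = c • u := by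
    refine Subtype.ext ?_
    refine (WithLp.equiv p _).injective (Prod.ext ?_ ?_)
    · change fn w = c • fn u
      refine Lp.ext ?_
      filter_upwards [hc, Lp.coeFn_smul c (fn u)] with x h1 h2
      rw [h2, h1, Pi.smul_apply, smul_eq_mul]
    · change grad w = c • grad u
      refine Lp.ext ?_
      filter_upwards [hc, hu0, hprop, Lp.coeFn_smul c (grad u)] with x h1 h2 h3 h4
      rw [h4, Pi.smul_apply]
      rw [h1, mul_comm, mul_smul] at h3
      exact smul_right_injective _ h2.ne' h3
  have hgh : h = c • g := by
    refine HasTrace.unique hΩ hp hp_top hw ?_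
    rw [hwu]
    exact hu.1.smul hΩ c
  have hc1 : |c| = 1 := by
    rw [hgh, norm_smul, hg, mul_one, Real.norm_eq_abs] at hh
    exact hh
  -- Since `Ω` has positive measure, the almost everywhere statements meet at some point, and the
  -- signs of `u` and `w` there decide that of `c`.
  have hc0 : 0 ≤ c := by
    have hne : NeBot (ae (interiorMeasure Ω)) := by
      rw [ae_neBot, Ne, Measure.restrict_eq_zero]
      exact (hΩ.isOpen.measure_pos _ hΩ.isConnected.nonempty).ne'
    obtain ⟨x, ⟨h1, h2⟩, h3⟩ := ((hc.and hw0).and hu0).exists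
    rw [h1] at h2
    exact nonneg_of_mul_nonneg_left h2 h3
  rw [hwu, ← abs_of_nonneg hc0, hc1, one_smul]

/-- Positive normalized eigenfunctions converge strongly along weak-* convergent weights. -/
theorem tendsto_eigenfunction (hΩ : IsBoundedSmoothDomain Ω) (hp : 1 < p) (hp_top : p ≠ ⊤)
    {σ : ℝ} (hσ : 0 < σ) {φs : ℕ → Lp ℝ ∞ (surfaceMeasure Ω)} {φ : Lp ℝ ∞ (surfaceMeasure Ω)}
    (hφ : WeakStarTendsto φs φ) {us : ℕ → Sobolev Ω p} {u : Sobolev Ω p}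
    (hus : ∀ j, IsPositiveNormalizedEigenfunction σ (φs j) (us j))
    (hu : IsPositiveNormalizedEigenfunction σ φ u) : Tendsto us atTop (𝓝 u) := by
  obtain ⟨hu0, g, hg, hsol⟩ := hu
  choose hus0 gs hgs hsols using hus
  refine tendsto_of_subseq_tendsto fun ns hns => ?_
  obtain ⟨w, h, κ, -, tw, hw, hh, hEw⟩ := exists_subseq_tendsto_minimizer hΩ hp hp_top hσ
    (hφ.comp hns) (us := fun j => us (ns j)) (gs := fun j => gs (ns j)) (fun j => (hsols _).1)
    (fun j => hgs _) (fun j => (hsols _).energy_eq hp_top (hgs _))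
  have hw0 : ∀ᵐ x ∂(interiorMeasure Ω), 0 ≤ fn w x := by
    have t := (continuous_fn.tendsto w).comp tw
    -- Strict positivity may be lost in the limit, but the nonnegative cone of `L^p` is closed;
    -- simplicity asks for strict positivity only of `u`.
    have h0 : 0 ≤ fn w := ge_of_tendsto' t fun j =>
      (Lp.coeFn_nonneg _).1 ((hus0 (ns (κ j))).mono fun x hx => hx.le)
    exact (Lp.coeFn_nonneg _).2 h0
  refine ⟨κ, ?_⟩
  rwa [hsol.eq_of_minimizer hΩ hp hp_top hσ hu0 hg hw hw0 hh hEw] at tw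

end Simplicity

end Steklov

end

theorem mainTheorem5 {m : ℕ} (Ω : Set (Steklov.Eucl m)) (hΩ : Steklov.IsBoundedSmoothDomain Ω)
    (p : ℝ≥0∞) [Fact (1 ≤ p)] (hp : 1 < p) (hp_top : p ≠ ⊤) (σ : ℝ) (hσ : 0 < σ)
    (φs : ℕ → Lp ℝ ∞ (Steklov.surfaceMeasure Ω)) (φ : Lp ℝ ∞ (Steklov.surfaceMeasure Ω))
    (hφ : Steklov.WeakStarTendsto φs φ) :
    Tendsto (fun j => Steklov.firstEigenvalue p σ (φs j)) atTop
        (𝓝 (Steklov.firstEigenvalue p σ φ)) ∧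
      ∀ (us : ℕ → Steklov.Sobolev Ω p) (u : Steklov.Sobolev Ω p),
        (∀ j, Steklov.IsPositiveNormalizedEigenfunction σ (φs j) (us j)) →
        Steklov.IsPositiveNormalizedEigenfunction σ φ u →
        Tendsto us atTop (𝓝 u) := by
  exact ⟨Steklov.tendsto_firstEigenvalue hΩ hp hp_top hσ hφ, fun us u hus hu =>
    Steklov.tendsto_eigenfunction hΩ hp hp_top hσ hφ hus hu⟩
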